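/- **Setting.** For integers $N_1,N_2\ge 0$ consider the ETL lattice with periodic boundary conditions (periods $2N_1+1$, $2N_2+1$) on the sites $\mathbb Z^2_{N_1,N_2}=\{j\in\mathbb Z^2: |j_1|\le N_1,\ |j_2|\le N_2\}$, $$\dot Q_j=-(\Delta_1P)_j,\qquad \dot P_j=-(Q_j+\alpha Q_j^2+\beta Q_j^3),\qquad (1)$$ where $\Delta_1$ is the discrete Laplacian, $(\Delta_1P)_j=\sum_{i=1,2}(P_{j+e_i}-2P_j+P_{j-e_i})$, and $\alpha,\beta\in\mathbb R$. Put $\mu=\frac{2}{2N_1+1}$ and let $\sigma$ be defined by $N_2+\frac12=(N_1+\frac12)^\sigma$, so that $\mu^\sigma=\frac2{2N_2+1}$. With $N=(2N_1+1)(2N_2+1)$ and $\hat Q_k=N^{-1/2}\sum_jQ_j\,e^{-2\pi i\left(\frac{j_1k_1}{2N_1+1}+\frac{j_2k_2}{2N_2+1}\right)}$ (and likewise $\hat P_k$), let $$E_k=\tfrac12\big(\omega_k^2|\hat P_k|^2+|\hat Q_k|^2\big),\quad \omega_k^2=4\sin^2\tfrac{k_1\pi}{2N_1+1}+4\sin^2\tfrac{k_2\pi}{2N_2+1},\quad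 \kappa(k)=(\mu k_1,\mu^\sigma k_2),$$ and let the specific energy be $\mathcal E_\kappa=\frac{E_k}{(N_1+\frac12)(N_2+\frac12)}$ if $\kappa=\kappa(k)$ with $k\in\mathbb Z^2_{N_1,N_2}$, and $\mathcal E_\kappa=0$ otherwise. For functions $f$ on the torus $(\mathbb R/2\mathbb Z)^2$ put $\hat f_k=\frac12\int_{[-1,1]^2}f(y)e^{-i\pi k\cdot y}\,dy$, and for $\rho>0$, $n\ge1$ let $$\|(\xi,\eta)\|_{\mathcal H^{\rho,n}}^2=\sum_{k\in\mathbb Z^2\setminus\{0\}}\big(|\hat\xi_k|^2+|\hat\eta_k|^2\big)e^{2\rho|k|}|k|^{2n}.$$ Consider real solutions $(\xi,\eta)(s,y_1,y_2)$, smooth and $2$-periodic in $y_1$ and in $y_2$ and with zero average in $y_1$ for every $y_2$, of the uncoupled KP system $$\xi_s=-\tfrac1{24}\partial_{y_1}^3\xi-\tfrac12\partial_{y_1}^{-1}\partial_{y_2}^2\xi-\tfrac{\alpha}{2\sqrt2}\partial_{y_1}(\xi^2),\qquad \eta_s=\tfrac1{24}\partial_{y_1}^3\eta+\tfrac12\partial_{y_1}^{-1}\partial_{y_2}^2\eta+\tfrac{\alpha}{2\sqrt2}\partial_{y_1}(\eta^2),\qquad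 (2)$$ where $\partial_{y_1}^{-1}$ is the primitive with zero $y_1$-average. With $\tau=\mu t$, $y=(\mu x_1,\mu^\sigma x_2)$, define the approximate solution $$Q_a(t,x)=\tfrac{\mu^2}{\sqrt2}\big[\xi(\mu^2\tau,y_1-\tau,y_2)+\eta(\mu^2\tau,y_1+\tau,y_2)\big],$$ $$P_a(t,x)=\tfrac{\mu}{\sqrt2}\big[(\partial_{y_1}^{-1}\xi)(\mu^2\tau,y_1-\tau,y_2)-(\partial_{y_1}^{-1}\eta)(\mu^2\tau,y_1+\tau,y_2)\big].$$ **Proposition.** Let $\alpha,\beta\in\mathbb R$, $0<\gamma<\frac12$, $\delta>0$, $\rho>0$, $n\ge1$, $T_0>0$ and $R>0$. There are $\mu_0>0$ and $C>0$, depending only on these quantities, such that the following holds for all $N_1,N_2$ with $\mu<\mu_0$ and $\sigma=2$ up to rounding, i.e. $\big|(N_2+\frac12)-(N_1+\frac12)^2\big|<1$. Let $(\xi,\eta)$ be a solution of (2) for $|s|\le T_0$ with $(\xi(s),\eta(s))\in\mathcal H^{\rho,n}$ and $\|(\xi(s),\eta(s))\|_{\mathcal H^{\rho,n}}\le R$ for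 $|s|\le T_0$. Then (1) has a solution on $|t|\le T_0/\mu^3$ with the corresponding initial datum $Q_j(0)=Q_a(0,j)$, $P_j(0)=P_a(0,j)$, and every such solution satisfies, for all $|t|\le T_0/\mu^3$: 1. $|Q_j(t)-Q_a(t,j)|+|P_j(t)-P_a(t,j)|\le C\mu^\gamma$ for all $j\in\mathbb Z^2_{N_1,N_2}$; 2. $\Big|\mathcal E_{\kappa}(t)-\mu^4\,\dfrac{|\hat\xi_K(\mu^3t)|^2+|\hat\eta_K(\mu^3t)|^2}{2}\Big|\le C\mu^{4+\gamma}$ for $\kappa=\kappa(K)$, for all $K\in\mathbb Z^2_{N_1,N_2}$ with $|K_1|+|K_2|\le\frac{(2+\delta)|\log\mu|}{\rho}$; 3. $|\mathcal E_{\kappa}(t)|\le\mu^{4+\gamma}$ for $\kappa=\kappa(K)$, for all $K\in\mathbb Z^2_{N_1,N_2}$ with $|K_1|+|K_2|>\frac{(2+\delta)|\log\mu|}{\rho}$; 4. $\mathcal E_\kappa(t)=0$ for every other $\kappa\in\mathbb R^2$. -/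

import Mathlib

open Set
open scoped ContDiff

noncomputable section

namespace ETL

/-! ### The periodic lattice -/

/-- The mesh parameter `2 / (2 N + 1) = 1 / (N + 1/2)`. For a lattice with parameters `N₁, N₂`,
`mesh N₁` is `μ` and `mesh N₂` is `μ ^ σ` (see `mesh_rpow_sigma`). -/
def mesh (N : ℕ) : ℝ := 2 / (2 * (N : ℝ) + 1)

/-- The anisotropy exponent `σ`, that is `N₂ + 1/2 = (N₁ + 1/2) ^ σ`. -/
def sigma (N₁ N₂ : ℕ) : ℝ := Real.logb ((N₁ : ℝ) + 1 / 2) ((N₂ : ℝ) + 1 / 2)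

theorem mesh_rpow_sigma (N₁ N₂ : ℕ) (h : 1 ≤ N₁) : mesh N₁ ^ sigma N₁ N₂ = mesh N₂ := by
  have h1 : (1 : ℝ) ≤ N₁ := by exact_mod_cast h
  have e : ∀ N : ℕ, mesh N = ((N : ℝ) + 1 / 2)⁻¹ := by
    intro N
    have : (0 : ℝ) ≤ N := N.cast_nonneg
    unfold mesh
    field_simp
  have h2 : (0 : ℝ) < (N₁ : ℝ) + 1 / 2 := by positivity
  have h3 : (0 : ℝ) < (N₂ : ℝ) + 1 / 2 := by positivity
  rw [e, e, Real.inv_rpow h2.le, sigma, Real.rpow_logb h2 (by linarith) h3]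

/-- The set of sites (and of modes) `{ (j₁, j₂) : |j₁| ≤ N₁, |j₂| ≤ N₂ }`. -/
def box (N₁ N₂ : ℕ) : Finset (ℤ × ℤ) :=
  Finset.Icc (-(N₁ : ℤ)) N₁ ×ˢ Finset.Icc (-(N₂ : ℤ)) N₂

/-- The discrete Laplacian. -/
def laplacian (P : ℤ × ℤ → ℝ) (j : ℤ × ℤ) : ℝ :=
  (P (j.1 + 1, j.2) - 2 * P j + P (j.1 - 1, j.2)) +
    (P (j.1, j.2 + 1) - 2 * P j + P (j.1, j.2 - 1))

/-- A state on the periodic lattice, as a function on `ℤ²` with periods `2 N₁ + 1`, `2 N₂ + 1`. -/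
def IsLatticePeriodic (N₁ N₂ : ℕ) (Q : ℤ × ℤ → ℝ) : Prop :=
  ∀ j : ℤ × ℤ, Q (j.1 + (2 * (N₁ : ℤ) + 1), j.2) = Q j ∧ Q (j.1, j.2 + (2 * (N₂ : ℤ) + 1)) = Q j

/-- `(Q, P)` solves the Hamilton equations of the ETL lattice for `|t| ≤ T`:
`Q_j' = - (Δ₁ P)_j` and `P_j' = - V'(Q_j)`, with `V(x) = x²/2 + α x³/3 + β x⁴/4`;
equivalently `Q_j'' = (Δ₁ V'(Q))_j`. -/
structure IsLatticeSolution (N₁ N₂ : ℕ) (α β T : ℝ) (Q P : ℝ → ℤ × ℤ → ℝ) : Prop where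
  periodic_Q : ∀ t ∈ Icc (-T) T, IsLatticePeriodic N₁ N₂ (Q t)
  periodic_P : ∀ t ∈ Icc (-T) T, IsLatticePeriodic N₁ N₂ (P t)
  deriv_Q : ∀ t ∈ Icc (-T) T, ∀ j : ℤ × ℤ,
    HasDerivWithinAt (fun r => Q r j) (-laplacian (P t) j) (Icc (-T) T) t
  deriv_P : ∀ t ∈ Icc (-T) T, ∀ j : ℤ × ℤ,
    HasDerivWithinAt (fun r => P r j) (-(Q t j + α * Q t j ^ 2 + β * Q t j ^ 3)) (Icc (-T) T) t

/-- The discrete Fourier coefficients `Q̂_k`, normalized so that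
`Q_j = N^(-1/2) ∑_k Q̂_k exp (2 π i (j₁ k₁ / (2 N₁ + 1) + j₂ k₂ / (2 N₂ + 1)))`,
where `N = (2 N₁ + 1) (2 N₂ + 1)` is the number of sites. -/
def latticeFourier (N₁ N₂ : ℕ) (Q : ℤ × ℤ → ℝ) (k : ℤ × ℤ) : ℂ :=
  (1 / (Real.sqrt ((2 * (N₁ : ℝ) + 1) * (2 * (N₂ : ℝ) + 1)) : ℂ)) *
    ∑ j ∈ box N₁ N₂, (Q j : ℂ) * Complex.exp (-(2 * (Real.pi : ℂ) * Complex.I *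
      ((j.1 : ℂ) * (k.1 : ℂ) / (2 * (N₁ : ℂ) + 1) + (j.2 : ℂ) * (k.2 : ℂ) / (2 * (N₂ : ℂ) + 1))))

/-- The squared frequency `ω_k²`. -/
def freqSq (N₁ N₂ : ℕ) (k : ℤ × ℤ) : ℝ :=
  4 * Real.sin ((k.1 : ℝ) * Real.pi / (2 * (N₁ : ℝ) + 1)) ^ 2 +
    4 * Real.sin ((k.2 : ℝ) * Real.pi / (2 * (N₂ : ℝ) + 1)) ^ 2

/-- The energy `E_k` of the mode `k` of the state `(Q, P)`. -/
def modeEnergy (N₁ N₂ : ℕ) (Q P : ℤ × ℤ → ℝ) (k : ℤ × ℤ) : ℝ :=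
  (freqSq N₁ N₂ k * ‖latticeFourier N₁ N₂ P k‖ ^ 2 + ‖latticeFourier N₁ N₂ Q k‖ ^ 2) / 2

/-- The specific wave vector `κ(k) = (k₁ / (N₁ + 1/2), k₂ / (N₂ + 1/2)) = (μ k₁, μ^σ k₂)`. -/
def waveVector (N₁ N₂ : ℕ) (k : ℤ × ℤ) : ℝ × ℝ :=
  ((k.1 : ℝ) / ((N₁ : ℝ) + 1 / 2), (k.2 : ℝ) / ((N₂ : ℝ) + 1 / 2))

open Classical in
/-- The specific energy `𝓔_κ` of the state `(Q, P)`: it is `E_k / ((N₁ + 1/2) (N₂ + 1/2))` if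
`κ = κ(k)` for a (necessarily unique) mode `k` of the lattice, and `0` if there is no such `k`. -/
def specificEnergy (N₁ N₂ : ℕ) (Q P : ℤ × ℤ → ℝ) (κ : ℝ × ℝ) : ℝ :=
  ∑ k ∈ (box N₁ N₂).filter (fun k => waveVector N₁ N₂ k = κ),
    modeEnergy N₁ N₂ Q P k / (((N₁ : ℝ) + 1 / 2) * ((N₂ : ℝ) + 1 / 2))

theorem specificEnergy_waveVector (N₁ N₂ : ℕ) (Q P : ℤ × ℤ → ℝ) (k : ℤ × ℤ)
    (hk : k ∈ box N₁ N₂) :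
    specificEnergy N₁ N₂ Q P (waveVector N₁ N₂ k) =
      modeEnergy N₁ N₂ Q P k / (((N₁ : ℝ) + 1 / 2) * ((N₂ : ℝ) + 1 / 2)) := by
  classical
  have hinj : ∀ l : ℤ × ℤ, waveVector N₁ N₂ l = waveVector N₁ N₂ k → l = k := by
    intro l hl
    have h1 : ((N₁ : ℝ) + 1 / 2) ≠ 0 := by positivity
    have h2 : ((N₂ : ℝ) + 1 / 2) ≠ 0 := by positivity
    simp only [waveVector, Prod.mk.injEq, div_left_inj' h1, div_left_inj' h2, Int.cast_inj] at hl
    exact Prod.ext hl.1 hl.2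
  unfold specificEnergy
  rw [Finset.sum_eq_single_of_mem k (by simp [hk])]
  intro l hl hne
  exact absurd (hinj l (Finset.mem_filter.mp hl).2) hne

/-! ### Functions on the torus `(ℝ / 2ℤ)²` -/

/-- The Fourier coefficient `f̂_k = (1/2) ∫_{[-1,1]²} f(y) exp (-i π k·y) dy`, so that
`f(y) = (1/2) ∑_k f̂_k exp (i π k·y)`. -/
def fourierCoef (f : ℝ → ℝ → ℝ) (k : ℤ × ℤ) : ℂ :=
  (1 / 2) * ∫ y₁ in (-1 : ℝ)..1, ∫ y₂ in (-1 : ℝ)..1,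
    (f y₁ y₂ : ℂ) * Complex.exp (-((Real.pi : ℂ) * Complex.I *
      ((k.1 : ℂ) * (y₁ : ℂ) + (k.2 : ℂ) * (y₂ : ℂ))))

/-- The Euclidean length `|k|`. -/
def modeNorm (k : ℤ × ℤ) : ℝ := Real.sqrt ((k.1 : ℝ) ^ 2 + (k.2 : ℝ) ^ 2)

/-- The terms `|f̂_k|² exp (2 ρ |k|) |k|^(2 s)` of the squared norm of `ℓ²_{ρ,s}`. -/
def normTerm (ρ s : ℝ) (f : ℝ → ℝ → ℝ) (k : {k : ℤ × ℤ // k ≠ 0}) : ℝ :=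
  ‖fourierCoef f k‖ ^ 2 * Real.exp (2 * ρ * modeNorm k) * modeNorm k ^ (2 * s)

/-- `(ξ, η)` belongs to `𝓗^{ρ,s} = ℓ²_{ρ,s} × ℓ²_{ρ,s}`. -/
def MemH (ρ s : ℝ) (ξ η : ℝ → ℝ → ℝ) : Prop :=
  Summable (normTerm ρ s ξ) ∧ Summable (normTerm ρ s η)

/-- The norm of `(ξ, η)` in `𝓗^{ρ,s}` (meaningful under `MemH ρ s ξ η`). -/
def normH (ρ s : ℝ) (ξ η : ℝ → ℝ → ℝ) : ℝ :=
  Real.sqrt ((∑' k, normTerm ρ s ξ k) + ∑' k, normTerm ρ s η k)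

/-- Smooth functions of `(y₁, y₂)`, of period `2` in each variable, whose average with respect to
`y₁` vanishes for every `y₂` (so that `∂_{y₁}⁻¹` makes sense on them). -/
structure IsZeroMeanPeriodic (f : ℝ → ℝ → ℝ) : Prop where
  smooth : ContDiff ℝ ∞ (fun y : ℝ × ℝ => f y.1 y.2)
  periodic_fst : ∀ y₁ y₂, f (y₁ + 2) y₂ = f y₁ y₂
  periodic_snd : ∀ y₁ y₂, f y₁ (y₂ + 2) = f y₁ y₂
  zero_mean : ∀ y₂, ∫ y₁ in (-1 : ℝ)..1, f y₁ y₂ = 0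

/-- `∂_{y₁}⁻¹ f`: the primitive of `f` with respect to `y₁` whose `y₁`-average over a period is
zero. -/
def antideriv (f : ℝ → ℝ → ℝ) (y₁ y₂ : ℝ) : ℝ :=
  (∫ x in (-1 : ℝ)..y₁, f x y₂) - (1 / 2) * ∫ z in (-1 : ℝ)..1, ∫ x in (-1 : ℝ)..z, f x y₂

/-- `- (1/24) ∂₁³ f - (1/2) ∂₁⁻¹ ∂₂² f - (α / (2 √2)) ∂₁ (f²)`. -/
def kpField (α : ℝ) (f : ℝ → ℝ → ℝ) (y₁ y₂ : ℝ) : ℝ :=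
  -(1 / 24) * iteratedDeriv 3 (fun x => f x y₂) y₁
    - (1 / 2) * antideriv (fun z₁ z₂ => iteratedDeriv 2 (fun w => f z₁ w) z₂) y₁ y₂
    - α / (2 * Real.sqrt 2) * deriv (fun x => f x y₂ ^ 2) y₁

/-- `(ξ, η)` is a (classical) solution for `|s| ≤ T` of the uncoupled KP system
`ξ_s = - (1/24) ∂₁³ ξ - (1/2) ∂₁⁻¹ ∂₂² ξ - (α / (2 √2)) ∂₁ (ξ²)`,
`η_s =   (1/24) ∂₁³ η + (1/2) ∂₁⁻¹ ∂₂² η + (α / (2 √2)) ∂₁ (η²)`. -/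
structure IsKPSolution (α T : ℝ) (ξ η : ℝ → ℝ → ℝ → ℝ) : Prop where
  regular_fst : ∀ s ∈ Icc (-T) T, IsZeroMeanPeriodic (ξ s)
  regular_snd : ∀ s ∈ Icc (-T) T, IsZeroMeanPeriodic (η s)
  eq_fst : ∀ s ∈ Icc (-T) T, ∀ y₁ y₂ : ℝ,
    HasDerivWithinAt (fun r => ξ r y₁ y₂) (kpField α (ξ s) y₁ y₂) (Icc (-T) T) s
  eq_snd : ∀ s ∈ Icc (-T) T, ∀ y₁ y₂ : ℝ,
    HasDerivWithinAt (fun r => η r y₁ y₂) (-kpField α (η s) y₁ y₂) (Icc (-T) T) s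

/-! ### The approximate solutions

With `μ = mesh N₁`, `μ^σ = mesh N₂`, `τ = μ t`, and `y = (μ j₁, μ^σ j₂)`. -/

/-- `Q_a(t, j) = (μ²/√2) [ξ(μ² τ, y₁ - τ, y₂) + η(μ² τ, y₁ + τ, y₂)]`. -/
def approxQ (N₁ N₂ : ℕ) (ξ η : ℝ → ℝ → ℝ → ℝ) (t : ℝ) (j : ℤ × ℤ) : ℝ :=
  mesh N₁ ^ 2 / Real.sqrt 2 *
    (ξ (mesh N₁ ^ 2 * (mesh N₁ * t)) (mesh N₁ * j.1 - mesh N₁ * t) (mesh N₂ * j.2) +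
      η (mesh N₁ ^ 2 * (mesh N₁ * t)) (mesh N₁ * j.1 + mesh N₁ * t) (mesh N₂ * j.2))

/-- `P_a(t, j)`, where `P_a` has zero `y₁`-average and
`∂_{y₁} P_a = (μ/√2) [ξ(μ² τ, y₁ - τ, y₂) - η(μ² τ, y₁ + τ, y₂)]`. -/
def approxP (N₁ N₂ : ℕ) (ξ η : ℝ → ℝ → ℝ → ℝ) (t : ℝ) (j : ℤ × ℤ) : ℝ :=
  mesh N₁ / Real.sqrt 2 *
    (antideriv (ξ (mesh N₁ ^ 2 * (mesh N₁ * t)))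
        (mesh N₁ * j.1 - mesh N₁ * t) (mesh N₂ * j.2) -
      antideriv (η (mesh N₁ ^ 2 * (mesh N₁ * t)))
        (mesh N₁ * j.1 + mesh N₁ * t) (mesh N₂ * j.2))

/-- `(Q, P)` is a solution for `|t| ≤ T` of the ETL lattice whose initial datum is the one that
corresponds to `(ξ(0), η(0))`. -/
def IsCorrespondingSolution (N₁ N₂ : ℕ) (α β T : ℝ) (ξ η : ℝ → ℝ → ℝ → ℝ)
    (Q P : ℝ → ℤ × ℤ → ℝ) : Prop :=
  IsLatticeSolution N₁ N₂ α β T Q P ∧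
    ∀ j : ℤ × ℤ, Q 0 j = approxQ N₁ N₂ ξ η 0 j ∧ P 0 j = approxP N₁ N₂ ξ η 0 j

end ETL

end

open Set
open scoped ContDiff

noncomputable section

namespace ETL

open Filter Topology MeasureTheory

/-! ### Exponentially decaying Fourier series on the torus -/

/-! Write m for `mesh N₁` and n for `mesh N₂`; the rounding condition gives n = m² + O(m⁴). Data of
size m² that vary on the scales 1/m and 1/m² obey, to leading order, the wave equation in the first
direction: Q splits into two waves of opposite unit velocities, while dispersion, transverse
diffraction and the quadratic force act only over times of order 1/m³. The proof combines a
consistency estimate, a stability estimate and a Fourier analysis of the outcome.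

Consistency. The leading ansatz leaves residuals of order m⁵ and m⁴ in the two lattice equations,
too large for times 1/m³. It is therefore corrected by m³ `corrP` in P and m⁴ `corrQ` in Q. At the
critical order the KP equations cancel what each wave does to itself. The interaction of the two
counter-propagating waves is not resonant: it is absorbed by a corrector built from xη - ξy, where
x, y are the y₁-primitives of ξ, η. This corrector does not grow in time, because zero y₁-average
makes the primitives periodic. The residuals drop to m⁷ and m⁶ (`displacement_residual_identity`,
`potential_residual_identity`, `Wave.exists_approxSol`). All functions are handled as Fourier series
with exponentially decaying coefficients (`Ana`), so every derivative is bounded; `UA` makes the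
constants uniform over all solutions, times, shifts and meshes.

Stability. The error is measured by half the squared discrete gradient of the error of P plus the
potential energy relative to the approximate Q. Summation by parts cancels the main terms of its
derivative. What is left are the residuals and a quadratic Taylor remainder times the velocity of
the approximate Q, which is O(m³); hence the growth rate is O(m³), harmless over times T₀/m³. With
O(m⁻³) sites the energy stays O(m⁵) (`ApproxSol.errEnergy_le`). The argument is run for a truncated
force, whose solutions are global and whose potential is uniformly convex; the estimate then shows
that the truncation is never felt, and uniqueness transfers it to every solution
(`exists_shadowing`). The energy does not see the mean of P, which is controlled by its own
differential equation (`ApproxSol.abs_sum_le`) and combined with a Poincaré estimate.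

Spectrum. Aliasing is negligible for analytic profiles (`norm_lcoef_sub_fc_le`), and the frequency
reduces to π k₁ m up to higher order. In the mode energy the kinetic and the potential part contain
|a - b|² and |a + b|² for the two wave amplitudes a, b, so the parallelogram law removes the
oscillating cross term (`exists_specificEnergy_bound`). The errors obtained are O(m) on the lattice
and O(m⁶) for the specific energies, which implies the stated exponents. -/

/-- The character `exp (i π n y)`. -/
def char1 (n : ℤ) (y : ℝ) : ℂ := Complex.exp ((Real.pi : ℂ) * Complex.I * ((n : ℂ) * (y : ℂ)))

/-- The character `exp (i π k·y)`. -/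
def char2 (k : ℤ × ℤ) (y₁ y₂ : ℝ) : ℂ := char1 k.1 y₁ * char1 k.2 y₂

/-- The weight `exp (- r (|k₁| + |k₂|))`. -/
def wt (r : ℝ) (k : ℤ × ℤ) : ℝ := Real.exp (-(r * (|(k.1 : ℝ)| + |(k.2 : ℝ)|)))

/-- The sum of a Fourier series. -/
def fsum (a : ℤ × ℤ → ℂ) (y₁ y₂ : ℝ) : ℂ := ∑' k, a k * char2 k y₁ y₂

/-- The coefficient of `char2 k` in the Fourier series of `f`. -/
def fc (f : ℝ → ℝ → ℝ) (k : ℤ × ℤ) : ℂ := fourierCoef f k / 2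

/-- `f` is the sum of its Fourier series, whose coefficients are bounded by `M * wt r`. -/
structure Ana (r M : ℝ) (f : ℝ → ℝ → ℝ) : Prop where
  bound : ∀ k, ‖fc f k‖ ≤ M * wt r k
  eq : ∀ y₁ y₂, (f y₁ y₂ : ℂ) = fsum (fc f) y₁ y₂

theorem norm_char1 (n : ℤ) (y : ℝ) : ‖char1 n y‖ = 1 := by
  unfold char1
  rw [show (Real.pi : ℂ) * Complex.I * ((n : ℂ) * (y : ℂ)) =
    ((Real.pi * (n * y) : ℝ) : ℂ) * Complex.I by push_cast; ring, Complex.norm_exp_ofReal_mul_I]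

theorem norm_char2 (k : ℤ × ℤ) (y₁ y₂ : ℝ) : ‖char2 k y₁ y₂‖ = 1 := by
  simp [char2, norm_char1]

theorem char1_add_right (n : ℤ) (y z : ℝ) : char1 n (y + z) = char1 n y * char1 n z := by
  unfold char1
  rw [← Complex.exp_add]
  congr 1
  push_cast
  ring

theorem char1_add_left (m n : ℤ) (y : ℝ) : char1 (m + n) y = char1 m y * char1 n y := by
  unfold char1
  rw [← Complex.exp_add]
  congr 1
  push_cast
  ring

theorem char1_zero_left (y : ℝ) : char1 0 y = 1 := by simp [char1]

theorem char1_two (n : ℤ) : char1 n 2 = 1 := by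
  unfold char1
  rw [show (Real.pi : ℂ) * Complex.I * ((n : ℂ) * ((2 : ℝ) : ℂ)) =
    (n : ℂ) * (2 * Real.pi * Complex.I) by push_cast; ring]
  exact Complex.exp_int_mul_two_pi_mul_I n

theorem char2_add_left (k l : ℤ × ℤ) (y₁ y₂ : ℝ) :
    char2 (k + l) y₁ y₂ = char2 k y₁ y₂ * char2 l y₁ y₂ := by
  simp only [char2, Prod.fst_add, Prod.snd_add, char1_add_left]
  ring

theorem hasDerivAt_char1 (n : ℤ) (y : ℝ) :
    HasDerivAt (char1 n) ((Real.pi : ℂ) * Complex.I * n * char1 n y) y := by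
  have h : HasDerivAt (fun y : ℝ => (Real.pi : ℂ) * Complex.I * ((n : ℂ) * (y : ℂ)))
      ((Real.pi : ℂ) * Complex.I * n) y := by
    have := ((Complex.ofRealCLM.hasDerivAt (x := y)).const_mul (n : ℂ)).const_mul
      ((Real.pi : ℂ) * Complex.I)
    simpa using this
  have := h.cexp
  unfold char1
  convert this using 1
  ring

theorem continuous_char1 (n : ℤ) : Continuous (char1 n) :=
  continuous_iff_continuousAt.2 fun y => (hasDerivAt_char1 n y).continuousAt

theorem integral_char1 (n : ℤ) : ∫ y in (-1 : ℝ)..1, char1 n y = if n = 0 then 2 else 0 := by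
  split_ifs with h
  · subst h
    simp [char1_zero_left]
    norm_num
  · have hne : (Real.pi : ℂ) * Complex.I * n ≠ 0 := by
      simp [Real.pi_ne_zero, h]
    have hd : ∀ y ∈ uIcc (-1 : ℝ) 1, HasDerivAt
        (fun y => char1 n y / ((Real.pi : ℂ) * Complex.I * n)) (char1 n y) y := by
      intro y _
      have := (hasDerivAt_char1 n y).div_const ((Real.pi : ℂ) * Complex.I * n)
      rwa [mul_div_cancel_left₀ _ hne] at this
    rw [intervalIntegral.integral_eq_sub_of_hasDerivAt hd
      ((continuous_char1 n).intervalIntegrable _ _)]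
    have : char1 n 1 = char1 n (-1) := by
      have h2 := char1_add_right n (-1) 2
      rw [char1_two, mul_one] at h2
      rw [← h2]
      norm_num
    rw [this, sub_self]

theorem wt_pos (r : ℝ) (k : ℤ × ℤ) : 0 < wt r k := Real.exp_pos _

theorem wt_le_one {r : ℝ} (hr : 0 ≤ r) (k : ℤ × ℤ) : wt r k ≤ 1 := by
  unfold wt
  rw [Real.exp_le_one_iff]
  have : 0 ≤ r * (|(k.1 : ℝ)| + |(k.2 : ℝ)|) := by positivity
  linarith

theorem wt_mono {r r' : ℝ} (h : r' ≤ r) (k : ℤ × ℤ) : wt r k ≤ wt r' k := by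
  unfold wt
  rw [Real.exp_le_exp]
  have : 0 ≤ |(k.1 : ℝ)| + |(k.2 : ℝ)| := by positivity
  nlinarith

theorem summable_exp_neg_abs {r : ℝ} (hr : 0 < r) :
    Summable fun n : ℤ => Real.exp (-(r * |(n : ℝ)|)) := by
  have h1 : Summable fun n : ℕ => Real.exp (-(r * (n : ℝ))) := by
    have := summable_geometric_of_lt_one (Real.exp_pos (-r)).le
      (by rw [Real.exp_lt_one_iff]; linarith : Real.exp (-r) < 1)
    refine this.congr fun n => ?_
    rw [← Real.exp_nat_mul]
    congr 1
    ring
  refine Summable.of_nat_of_neg ?_ ?_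
  · refine h1.congr fun n => ?_
    simp
  · refine h1.congr fun n => ?_
    simp

theorem summable_wt {r : ℝ} (hr : 0 < r) : Summable (wt r) := by
  have h := summable_exp_neg_abs hr
  have := Summable.mul_of_nonneg h h (fun _ => (Real.exp_pos _).le) (fun _ => (Real.exp_pos _).le)
  refine this.congr fun k => ?_
  rw [← Real.exp_add]
  unfold wt
  congr 1
  ring

/-- The sum of the weights. -/
def wtSum (r : ℝ) : ℝ := ∑' k, wt r k

theorem wtSum_nonneg (r : ℝ) : 0 ≤ wtSum r := tsum_nonneg fun k => (wt_pos r k).le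

/-- Half of the exponential decay pays for one power of the frequency, since x exp(-x) ≤ 1. This is
why every derivative below halves the radius `r`. -/
theorem abs_add_abs_mul_wt_le {r : ℝ} (hr : 0 < r) (k : ℤ × ℤ) :
    (|(k.1 : ℝ)| + |(k.2 : ℝ)|) * wt r k ≤ 2 / r * wt (r / 2) k := by
  set x := |(k.1 : ℝ)| + |(k.2 : ℝ)| with hx
  have h1 : wt r k = wt (r / 2) k * Real.exp (-(r / 2 * x)) := by
    unfold wt
    rw [← Real.exp_add]
    congr 1
    ring
  have h2 : r / 2 * x ≤ Real.exp (r / 2 * x) := by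
    have := Real.add_one_le_exp (r / 2 * x)
    linarith
  have h3 : x * Real.exp (-(r / 2 * x)) ≤ 2 / r := by
    rw [Real.exp_neg, ← div_eq_mul_inv, div_le_iff₀ (Real.exp_pos _), div_mul_eq_mul_div,
      le_div_iff₀ hr]
    linarith
  rw [h1]
  have := mul_le_mul_of_nonneg_right h3 (wt_pos (r / 2) k).le
  linarith

/-- By the triangle inequality half of the decay of the product already gives decay in `k`; the
other half remains to sum a convolution over `l`. -/
theorem wt_mul_wt_sub_le {r : ℝ} (hr : 0 ≤ r) (k l : ℤ × ℤ) :
    wt r l * wt r (k - l) ≤ wt (r / 2) k * wt (r / 2) l := by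
  unfold wt
  rw [← Real.exp_add, ← Real.exp_add, Real.exp_le_exp]
  have h1 : |(k.1 : ℝ)| ≤ |(l.1 : ℝ)| + |(k.1 : ℝ) - l.1| := by
    have := abs_add_le (l.1 : ℝ) ((k.1 : ℝ) - l.1)
    rwa [add_sub_cancel] at this
  have h2 : |(k.2 : ℝ)| ≤ |(l.2 : ℝ)| + |(k.2 : ℝ) - l.2| := by
    have := abs_add_le (l.2 : ℝ) ((k.2 : ℝ) - l.2)
    rwa [add_sub_cancel] at this
  simp only [Prod.fst_sub, Prod.snd_sub, Int.cast_sub]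
  have h3 := abs_nonneg ((k.1 : ℝ) - l.1)
  have h4 := abs_nonneg ((k.2 : ℝ) - l.2)
  nlinarith

theorem summable_of_wt {r M : ℝ} (hr : 0 < r) {a : ℤ × ℤ → ℂ} (ha : ∀ k, ‖a k‖ ≤ M * wt r k) :
    Summable fun k => ‖a k‖ :=
  Summable.of_nonneg_of_le (fun _ => norm_nonneg _) ha ((summable_wt hr).mul_left M)

theorem summable_fsum {a : ℤ × ℤ → ℂ} (ha : Summable fun k => ‖a k‖) (y₁ y₂ : ℝ) :
    Summable fun k => a k * char2 k y₁ y₂ :=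
  Summable.of_norm (by simpa [norm_char2] using ha)

theorem norm_fsum_le {r M : ℝ} (hr : 0 < r) {a : ℤ × ℤ → ℂ} (ha : ∀ k, ‖a k‖ ≤ M * wt r k)
    (y₁ y₂ : ℝ) : ‖fsum a y₁ y₂‖ ≤ M * wtSum r := by
  have h1 := (summable_wt hr).mul_left M
  have h2 := tsum_of_norm_bounded (f := fun k => a k * char2 k y₁ y₂) h1.hasSum
    (fun k => by simpa [norm_char2] using ha k)
  rwa [tsum_mul_left] at h2

theorem continuous_fsum {a : ℤ × ℤ → ℂ} (ha : Summable fun k => ‖a k‖) :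
    Continuous fun y : ℝ × ℝ => fsum a y.1 y.2 := by
  unfold fsum
  refine continuous_tsum (fun k => ?_) ha (fun k y => by simp [norm_char2])
  unfold char2
  exact continuous_const.mul (((continuous_char1 _).comp continuous_fst).mul
    ((continuous_char1 _).comp continuous_snd))

/-- Absolute summability allows integration term by term in each variable, and orthogonality leaves
one term; 4 is the area of the square. -/
theorem integral_fsum_mul_char {a : ℤ × ℤ → ℂ} (ha : Summable fun k => ‖a k‖) (k : ℤ × ℤ) :
    ∫ y₁ in (-1 : ℝ)..1, ∫ y₂ in (-1 : ℝ)..1, fsum a y₁ y₂ * char2 (-k) y₁ y₂ = 4 * a k := by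
  have hterm : ∀ l y₁ y₂, a l * char2 l y₁ y₂ * char2 (-k) y₁ y₂ =
      a l * char1 (l.1 - k.1) y₁ * char1 (l.2 - k.2) y₂ := by
    intro l y₁ y₂
    rw [mul_assoc, ← char2_add_left, char2, mul_assoc]
    simp [sub_eq_add_neg]
  have hin : ∀ y₁ : ℝ, HasSum (fun l => ∫ y₂ in (-1 : ℝ)..1, a l * char1 (l.1 - k.1) y₁ *
      char1 (l.2 - k.2) y₂) (∫ y₂ in (-1 : ℝ)..1, fsum a y₁ y₂ * char2 (-k) y₁ y₂) := by
    intro y₁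
    refine intervalIntegral.hasSum_integral_of_dominated_convergence (fun l _ => ‖a l‖)
      (fun l => ?_) (fun l => ?_) ?_ ?_ ?_
    · exact (continuous_const.mul (continuous_char1 _)).aestronglyMeasurable
    · exact ae_of_all _ fun y _ => by simp [norm_char1]
    · exact ae_of_all _ fun y _ => ha
    · exact intervalIntegrable_const
    · refine ae_of_all _ fun y _ => ?_
      have := (summable_fsum ha y₁ y).hasSum.mul_right (char2 (-k) y₁ y)
      simp only [hterm] at this
      exact this
  have hout : HasSum (fun l => ∫ y₁ in (-1 : ℝ)..1, ∫ y₂ in (-1 : ℝ)..1,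
      a l * char1 (l.1 - k.1) y₁ * char1 (l.2 - k.2) y₂)
      (∫ y₁ in (-1 : ℝ)..1, ∫ y₂ in (-1 : ℝ)..1, fsum a y₁ y₂ * char2 (-k) y₁ y₂) := by
    refine intervalIntegral.hasSum_integral_of_dominated_convergence (fun l _ => 2 * ‖a l‖)
      (fun l => ?_) (fun l => ?_) ?_ ?_ ?_
    · simp only [intervalIntegral.integral_const_mul]
      exact ((continuous_const.mul (continuous_char1 _)).mul
        continuous_const).aestronglyMeasurable
    · refine ae_of_all _ fun y _ => ?_
      refine (intervalIntegral.norm_integral_le_of_norm_le_const (C := ‖a l‖) ?_).trans ?_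
      · intro x _
        simp [norm_char1]
      · norm_num
        linarith [norm_nonneg (a l)]
    · exact ae_of_all _ fun y _ => ha.mul_left 2
    · exact intervalIntegrable_const
    · exact ae_of_all _ fun y _ => hin y
  refine hout.unique ?_
  convert hasSum_ite_eq k (4 * a k) using 2 with l
  simp only [intervalIntegral.integral_const_mul, intervalIntegral.integral_mul_const,
    integral_char1]
  by_cases h : l = k
  · subst h
    simp
    ring
  · have : ¬ (l.1 = k.1 ∧ l.2 = k.2) := fun h' => h (Prod.ext h'.1 h'.2)
    rw [if_neg h]
    by_cases h1 : l.1 = k.1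
    · have h2 : l.2 - k.2 ≠ 0 := fun h2 => this ⟨h1, by omega⟩
      simp [h2]
    · have h2 : l.1 - k.1 ≠ 0 := fun h2 => h1 (by omega)
      simp [h2]

theorem char2_neg_eq (k : ℤ × ℤ) (y₁ y₂ : ℝ) : char2 (-k) y₁ y₂ =
    Complex.exp (-((Real.pi : ℂ) * Complex.I * ((k.1 : ℂ) * (y₁ : ℂ) + (k.2 : ℂ) * (y₂ : ℂ)))) := by
  unfold char2 char1
  rw [← Complex.exp_add]
  congr 1
  simp only [Prod.fst_neg, Prod.snd_neg]
  push_cast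
  ring

theorem fc_eq (f : ℝ → ℝ → ℝ) (k : ℤ × ℤ) : fc f k =
    (1 / 4) * ∫ y₁ in (-1 : ℝ)..1, ∫ y₂ in (-1 : ℝ)..1, (f y₁ y₂ : ℂ) * char2 (-k) y₁ y₂ := by
  unfold fc fourierCoef
  simp only [char2_neg_eq]
  ring

/-- Uniqueness of Fourier coefficients. Each formula below for the coefficients of a derivative,
primitive or shift is read off from a series through this lemma. -/
theorem fc_of_series {a : ℤ × ℤ → ℂ} (ha : Summable fun k => ‖a k‖) {f : ℝ → ℝ → ℝ}
    (hf : ∀ y₁ y₂, (f y₁ y₂ : ℂ) = fsum a y₁ y₂) : fc f = a := by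
  funext k
  rw [fc_eq]
  simp only [hf]
  rw [integral_fsum_mul_char ha]
  ring

theorem Ana.of_series {r M : ℝ} (hr : 0 < r) {a : ℤ × ℤ → ℂ} (ha : ∀ k, ‖a k‖ ≤ M * wt r k)
    {f : ℝ → ℝ → ℝ} (hf : ∀ y₁ y₂, (f y₁ y₂ : ℂ) = fsum a y₁ y₂) : Ana r M f := by
  have := fc_of_series (summable_of_wt hr ha) hf
  exact ⟨by rwa [this], by rwa [this]⟩

theorem Ana.summable {r M : ℝ} {f : ℝ → ℝ → ℝ} (h : Ana r M f) (hr : 0 < r) :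
    Summable fun k => ‖fc f k‖ := summable_of_wt hr h.bound

theorem Ana.nonneg {r M : ℝ} {f : ℝ → ℝ → ℝ} (h : Ana r M f) : 0 ≤ M := by
  have := (norm_nonneg _).trans (h.bound 0)
  exact nonneg_of_mul_nonneg_left this (wt_pos _ _)

theorem Ana.mono {r M r' M' : ℝ} {f : ℝ → ℝ → ℝ} (h : Ana r M f) (hr : r' ≤ r) (hM : M ≤ M') :
    Ana r' M' f :=
  ⟨fun k => (h.bound k).trans (mul_le_mul hM (wt_mono hr k) (wt_pos _ _).le (h.nonneg.trans hM)),
    h.eq⟩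

theorem Ana.abs_le {r M : ℝ} {f : ℝ → ℝ → ℝ} (h : Ana r M f) (hr : 0 < r) (y₁ y₂ : ℝ) :
    |f y₁ y₂| ≤ M * wtSum r := by
  have := norm_fsum_le hr h.bound y₁ y₂
  rwa [← h.eq, Complex.norm_real, Real.norm_eq_abs] at this

theorem Ana.continuous {r M : ℝ} {f : ℝ → ℝ → ℝ} (h : Ana r M f) (hr : 0 < r) :
    Continuous fun y : ℝ × ℝ => f y.1 y.2 := by
  have h1 := continuous_fsum (h.summable hr)
  have h2 : (fun y : ℝ × ℝ => f y.1 y.2) = fun y => (fsum (fc f) y.1 y.2).re := by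
    funext y
    rw [← h.eq, Complex.ofReal_re]
  rw [h2]
  exact Complex.continuous_re.comp h1

/-! ### Algebraic operations -/

theorem fsum_add {a b : ℤ × ℤ → ℂ} (ha : Summable fun k => ‖a k‖) (hb : Summable fun k => ‖b k‖)
    (y₁ y₂ : ℝ) : fsum (fun k => a k + b k) y₁ y₂ = fsum a y₁ y₂ + fsum b y₁ y₂ := by
  unfold fsum
  rw [← (summable_fsum ha y₁ y₂).tsum_add (summable_fsum hb y₁ y₂)]
  simp only [add_mul]

theorem fsum_const_mul (c : ℂ) (a : ℤ × ℤ → ℂ) (y₁ y₂ : ℝ) :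
    fsum (fun k => c * a k) y₁ y₂ = c * fsum a y₁ y₂ := by
  unfold fsum
  rw [← tsum_mul_left]
  simp only [mul_assoc]

theorem Ana.add {r M M' : ℝ} {f g : ℝ → ℝ → ℝ} (hr : 0 < r) (hf : Ana r M f) (hg : Ana r M' g) :
    Ana r (M + M') (fun y₁ y₂ => f y₁ y₂ + g y₁ y₂) := by
  refine Ana.of_series hr (a := fun k => fc f k + fc g k) (fun k => ?_) (fun y₁ y₂ => ?_)
  · have := norm_add_le (fc f k) (fc g k)
    have h1 := hf.bound k
    have h2 := hg.bound k
    nlinarith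
  · rw [fsum_add (hf.summable hr) (hg.summable hr), ← hf.eq, ← hg.eq]
    push_cast
    ring

theorem Ana.const_mul {r M : ℝ} {f : ℝ → ℝ → ℝ} (hr : 0 < r) (hf : Ana r M f) (c : ℝ) :
    Ana r (|c| * M) (fun y₁ y₂ => c * f y₁ y₂) := by
  refine Ana.of_series hr (a := fun k => (c : ℂ) * fc f k) (fun k => ?_) (fun y₁ y₂ => ?_)
  · rw [norm_mul, Complex.norm_real, Real.norm_eq_abs, mul_assoc]
    exact mul_le_mul_of_nonneg_left (hf.bound k) (abs_nonneg c)
  · rw [fsum_const_mul, ← hf.eq]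
    push_cast
    ring

theorem norm_conv_le {r M M' : ℝ} (hr : 0 < r) {a b : ℤ × ℤ → ℂ}
    (ha : ∀ k, ‖a k‖ ≤ M * wt r k) (hb : ∀ k, ‖b k‖ ≤ M' * wt r k) (k : ℤ × ℤ) :
    ‖∑' l, a l * b (k - l)‖ ≤ M * M' * wtSum (r / 2) * wt (r / 2) k := by
  have h1 := (summable_wt (half_pos hr)).mul_left (M * M' * wt (r / 2) k)
  have h2 := tsum_of_norm_bounded (f := fun l => a l * b (k - l)) h1.hasSum (fun l => by
    have hM : 0 ≤ M * wt r l := (norm_nonneg _).trans (ha l)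
    have hM0 : 0 ≤ M := nonneg_of_mul_nonneg_left hM (wt_pos _ _)
    have hM' : 0 ≤ M' := nonneg_of_mul_nonneg_left ((norm_nonneg _).trans (hb 0)) (wt_pos _ _)
    calc ‖a l * b (k - l)‖ = ‖a l‖ * ‖b (k - l)‖ := norm_mul _ _
      _ ≤ (M * wt r l) * (M' * wt r (k - l)) :=
        mul_le_mul (ha l) (hb _) (norm_nonneg _) hM
      _ = M * M' * (wt r l * wt r (k - l)) := by ring
      _ ≤ M * M' * (wt (r / 2) k * wt (r / 2) l) :=
        mul_le_mul_of_nonneg_left (wt_mul_wt_sub_le hr.le k l) (mul_nonneg hM0 hM')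
      _ = _ := by ring)
  rw [tsum_mul_left] at h2
  calc _ ≤ _ := h2
    _ = _ := by unfold wtSum; ring

theorem fsum_mul {a b : ℤ × ℤ → ℂ} (ha : Summable fun k => ‖a k‖) (hb : Summable fun k => ‖b k‖)
    (y₁ y₂ : ℝ) :
    fsum a y₁ y₂ * fsum b y₁ y₂ = fsum (fun k => ∑' l, a l * b (k - l)) y₁ y₂ := by
  have hA : Summable fun k => ‖a k * char2 k y₁ y₂‖ := by simpa [norm_char2] using ha
  have hB : Summable fun k => ‖b k * char2 k y₁ y₂‖ := by simpa [norm_char2] using hb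
  unfold fsum
  rw [tsum_mul_tsum_of_summable_norm hA hB]
  -- Reindexing of the double sum that turns the product of two series into a convolution: the pair
  -- (k, l) stands for the product of the modes l and k - l.
  let E : (ℤ × ℤ) × (ℤ × ℤ) ≃ (ℤ × ℤ) × (ℤ × ℤ) :=
    { toFun := fun p => (p.2, p.1 - p.2)
      invFun := fun p => (p.1 + p.2, p.1)
      left_inv := fun p => by simp
      right_inv := fun p => by simp }
  have hs := summable_mul_of_summable_norm hA hB
  have hs' := (E.summable_iff).2 hs
  rw [← E.tsum_eq]
  refine (Summable.tsum_prod hs').trans ?_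
  refine tsum_congr fun k => ?_
  rw [← tsum_mul_right]
  refine tsum_congr fun l => ?_
  simp only [E, Equiv.coe_fn_mk, Function.comp_apply]
  have : char2 k y₁ y₂ = char2 l y₁ y₂ * char2 (k - l) y₁ y₂ := by
    rw [← char2_add_left, add_sub_cancel]
  rw [this]
  ring

theorem Ana.mul {r M M' : ℝ} {f g : ℝ → ℝ → ℝ} (hr : 0 < r) (hf : Ana r M f) (hg : Ana r M' g) :
    Ana (r / 2) (M * M' * wtSum (r / 2)) (fun y₁ y₂ => f y₁ y₂ * g y₁ y₂) := by
  refine Ana.of_series (half_pos hr) (norm_conv_le hr hf.bound hg.bound) (fun y₁ y₂ => ?_)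
  rw [← fsum_mul (hf.summable hr) (hg.summable hr), ← hf.eq, ← hg.eq]
  push_cast
  ring

theorem fsum_shift_fst (a : ℤ × ℤ → ℂ) (h y₁ y₂ : ℝ) :
    fsum (fun k => char1 k.1 h * a k) y₁ y₂ = fsum a (y₁ + h) y₂ := by
  unfold fsum char2
  refine tsum_congr fun k => ?_
  rw [char1_add_right]
  ring

theorem fc_shift {r M : ℝ} {f : ℝ → ℝ → ℝ} (hr : 0 < r) (hf : Ana r M f) (h : ℝ) :
    fc (fun y₁ y₂ => f (y₁ + h) y₂) = fun k => char1 k.1 h * fc f k := by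
  refine fc_of_series ?_ fun y₁ y₂ => ?_
  · simpa [norm_char1] using hf.summable hr
  · rw [fsum_shift_fst, hf.eq]

theorem Ana.shift {r M : ℝ} {f : ℝ → ℝ → ℝ} (hr : 0 < r) (hf : Ana r M f) (h : ℝ) :
    Ana r M (fun y₁ y₂ => f (y₁ + h) y₂) := by
  refine Ana.of_series hr (a := fun k => char1 k.1 h * fc f k) (fun k => ?_) (fun y₁ y₂ => ?_)
  · simpa [norm_char1] using hf.bound k
  · rw [fsum_shift_fst, hf.eq]

/-! ### Derivatives -/

/-- The partial derivative with respect to the first variable. -/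
def d1 (f : ℝ → ℝ → ℝ) (y₁ y₂ : ℝ) : ℝ := deriv (fun x => f x y₂) y₁

/-- The partial derivative with respect to the second variable. -/
def d2 (f : ℝ → ℝ → ℝ) (y₁ y₂ : ℝ) : ℝ := deriv (fun x => f y₁ x) y₂

theorem norm_mul_fst_le {r M : ℝ} (hr : 0 < r) {a : ℤ × ℤ → ℂ} (ha : ∀ k, ‖a k‖ ≤ M * wt r k)
    (k : ℤ × ℤ) :
    ‖(Real.pi : ℂ) * Complex.I * k.1 * a k‖ ≤ Real.pi * (2 / r) * M * wt (r / 2) k := by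
  have hM : 0 ≤ M := nonneg_of_mul_nonneg_left ((norm_nonneg _).trans (ha 0)) (wt_pos _ _)
  simp only [norm_mul, Complex.norm_real, Complex.norm_I, mul_one, Complex.norm_intCast,
    Real.norm_eq_abs, abs_of_pos Real.pi_pos]
  have h1 := abs_add_abs_mul_wt_le hr k
  have h2 : |(k.1 : ℝ)| * wt r k ≤ 2 / r * wt (r / 2) k := by
    nlinarith [abs_nonneg (k.2 : ℝ), wt_pos r k]
  calc Real.pi * |(k.1 : ℝ)| * ‖a k‖ ≤ Real.pi * |(k.1 : ℝ)| * (M * wt r k) := by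
        gcongr
        exact ha k
    _ = Real.pi * M * (|(k.1 : ℝ)| * wt r k) := by ring
    _ ≤ Real.pi * M * (2 / r * wt (r / 2) k) := by gcongr
    _ = _ := by ring

theorem norm_mul_snd_le {r M : ℝ} (hr : 0 < r) {a : ℤ × ℤ → ℂ} (ha : ∀ k, ‖a k‖ ≤ M * wt r k)
    (k : ℤ × ℤ) :
    ‖(Real.pi : ℂ) * Complex.I * k.2 * a k‖ ≤ Real.pi * (2 / r) * M * wt (r / 2) k := by
  have hM : 0 ≤ M := nonneg_of_mul_nonneg_left ((norm_nonneg _).trans (ha 0)) (wt_pos _ _)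
  simp only [norm_mul, Complex.norm_real, Complex.norm_I, mul_one, Complex.norm_intCast,
    Real.norm_eq_abs, abs_of_pos Real.pi_pos]
  have h1 := abs_add_abs_mul_wt_le hr k
  have h2 : |(k.2 : ℝ)| * wt r k ≤ 2 / r * wt (r / 2) k := by
    nlinarith [abs_nonneg (k.1 : ℝ), wt_pos r k]
  calc Real.pi * |(k.2 : ℝ)| * ‖a k‖ ≤ Real.pi * |(k.2 : ℝ)| * (M * wt r k) := by
        gcongr
        exact ha k
    _ = Real.pi * M * (|(k.2 : ℝ)| * wt r k) := by ring
    _ ≤ Real.pi * M * (2 / r * wt (r / 2) k) := by gcongr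
    _ = _ := by ring

theorem hasDerivAt_fsum_fst {r M : ℝ} (hr : 0 < r) {a : ℤ × ℤ → ℂ}
    (ha : ∀ k, ‖a k‖ ≤ M * wt r k) (y₁ y₂ : ℝ) :
    HasDerivAt (fun x => fsum a x y₂)
      (fsum (fun k => (Real.pi : ℂ) * Complex.I * k.1 * a k) y₁ y₂) y₁ := by
  unfold fsum
  refine hasDerivAt_tsum (g := fun k x => a k * char2 k x y₂)
    (g' := fun k x => Real.pi * Complex.I * k.1 * a k * char2 k x y₂)
    ((summable_wt (half_pos hr)).mul_left (Real.pi * (2 / r) * M))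
    (fun k x => ?_) (fun k x => ?_) (y₀ := y₁) ?_ y₁
  · have := ((hasDerivAt_char1 k.1 x).mul_const (char1 k.2 y₂)).const_mul (a k)
    unfold char2
    exact this.congr_deriv (by ring)
  · rw [norm_mul, norm_char2, mul_one]
    exact norm_mul_fst_le hr ha k
  · exact summable_fsum (summable_of_wt hr ha) y₁ y₂

theorem hasDerivAt_fsum_snd {r M : ℝ} (hr : 0 < r) {a : ℤ × ℤ → ℂ}
    (ha : ∀ k, ‖a k‖ ≤ M * wt r k) (y₁ y₂ : ℝ) :
    HasDerivAt (fun x => fsum a y₁ x)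
      (fsum (fun k => (Real.pi : ℂ) * Complex.I * k.2 * a k) y₁ y₂) y₂ := by
  unfold fsum
  refine hasDerivAt_tsum (g := fun k x => a k * char2 k y₁ x)
    (g' := fun k x => Real.pi * Complex.I * k.2 * a k * char2 k y₁ x)
    ((summable_wt (half_pos hr)).mul_left (Real.pi * (2 / r) * M))
    (fun k x => ?_) (fun k x => ?_) (y₀ := y₂) ?_ y₂
  · have := ((hasDerivAt_char1 k.2 x).const_mul (char1 k.1 y₁)).const_mul (a k)
    unfold char2
    exact this.congr_deriv (by ring)
  · rw [norm_mul, norm_char2, mul_one]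
    exact norm_mul_snd_le hr ha k
  · exact summable_fsum (summable_of_wt hr ha) y₁ y₂

/-- The series are complex while the functions are real: taking real parts gives the real
derivative, and uniqueness of derivatives shows that the complex one is real. -/
theorem hasDerivAt_of_ofReal {g : ℝ → ℝ} {D : ℂ} {x : ℝ}
    (h : HasDerivAt (fun x => (g x : ℂ)) D x) : HasDerivAt g D.re x ∧ ((D.re : ℝ) : ℂ) = D := by
  have h1 : HasDerivAt g D.re x := by
    simpa [Function.comp_def] using Complex.reCLM.hasFDerivAt.comp_hasDerivAt x h
  exact ⟨h1, h1.ofReal_comp.unique h⟩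

theorem Ana.hasDerivAt_fst_aux {r M : ℝ} {f : ℝ → ℝ → ℝ} (hr : 0 < r) (hf : Ana r M f)
    (y₁ y₂ : ℝ) : HasDerivAt (fun x => f x y₂) (d1 f y₁ y₂) y₁ ∧
      (d1 f y₁ y₂ : ℂ) = fsum (fun k => (Real.pi : ℂ) * Complex.I * k.1 * fc f k) y₁ y₂ := by
  have h := hasDerivAt_fsum_fst hr hf.bound y₁ y₂
  simp only [← hf.eq] at h
  obtain ⟨h1, h2⟩ := hasDerivAt_of_ofReal h
  have : d1 f y₁ y₂ = _ := h1.deriv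
  rw [this]
  exact ⟨h1, h2⟩

theorem Ana.hasDerivAt_snd_aux {r M : ℝ} {f : ℝ → ℝ → ℝ} (hr : 0 < r) (hf : Ana r M f)
    (y₁ y₂ : ℝ) : HasDerivAt (fun x => f y₁ x) (d2 f y₁ y₂) y₂ ∧
      (d2 f y₁ y₂ : ℂ) = fsum (fun k => (Real.pi : ℂ) * Complex.I * k.2 * fc f k) y₁ y₂ := by
  have h := hasDerivAt_fsum_snd hr hf.bound y₁ y₂
  simp only [← hf.eq] at h
  obtain ⟨h1, h2⟩ := hasDerivAt_of_ofReal h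
  have : d2 f y₁ y₂ = _ := h1.deriv
  rw [this]
  exact ⟨h1, h2⟩

theorem Ana.hasDerivAt_fst {r M : ℝ} {f : ℝ → ℝ → ℝ} (hr : 0 < r) (hf : Ana r M f)
    (y₁ y₂ : ℝ) : HasDerivAt (fun x => f x y₂) (d1 f y₁ y₂) y₁ := (hf.hasDerivAt_fst_aux hr _ _).1

theorem Ana.hasDerivAt_snd {r M : ℝ} {f : ℝ → ℝ → ℝ} (hr : 0 < r) (hf : Ana r M f)
    (y₁ y₂ : ℝ) : HasDerivAt (fun x => f y₁ x) (d2 f y₁ y₂) y₂ := (hf.hasDerivAt_snd_aux hr _ _).1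

theorem Ana.fc_d1 {r M : ℝ} {f : ℝ → ℝ → ℝ} (hr : 0 < r) (hf : Ana r M f) :
    fc (d1 f) = fun k => (Real.pi : ℂ) * Complex.I * k.1 * fc f k :=
  fc_of_series (summable_of_wt (half_pos hr) (norm_mul_fst_le hr hf.bound))
    fun _ _ => (hf.hasDerivAt_fst_aux hr _ _).2

theorem Ana.fc_d2 {r M : ℝ} {f : ℝ → ℝ → ℝ} (hr : 0 < r) (hf : Ana r M f) :
    fc (d2 f) = fun k => (Real.pi : ℂ) * Complex.I * k.2 * fc f k :=
  fc_of_series (summable_of_wt (half_pos hr) (norm_mul_snd_le hr hf.bound))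
    fun _ _ => (hf.hasDerivAt_snd_aux hr _ _).2

theorem Ana.d1 {r M : ℝ} {f : ℝ → ℝ → ℝ} (hr : 0 < r) (hf : Ana r M f) :
    Ana (r / 2) (Real.pi * (2 / r) * M) (d1 f) :=
  Ana.of_series (half_pos hr) (norm_mul_fst_le hr hf.bound)
    fun _ _ => (hf.hasDerivAt_fst_aux hr _ _).2

theorem Ana.d2 {r M : ℝ} {f : ℝ → ℝ → ℝ} (hr : 0 < r) (hf : Ana r M f) :
    Ana (r / 2) (Real.pi * (2 / r) * M) (d2 f) :=
  Ana.of_series (half_pos hr) (norm_mul_snd_le hr hf.bound)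
    fun _ _ => (hf.hasDerivAt_snd_aux hr _ _).2

/-! ### The antiderivative -/

/-- All Fourier coefficients with `k₁ = 0` vanish. -/
def ZeroMean (f : ℝ → ℝ → ℝ) : Prop := ∀ n : ℤ, fc f (0, n) = 0

/-- The Fourier coefficients of the antiderivative. -/
def divFst (a : ℤ × ℤ → ℂ) (k : ℤ × ℤ) : ℂ := a k / ((Real.pi : ℂ) * Complex.I * k.1)

/-- Off the line k₁ = 0 the divisor has modulus at least π; on that line division by zero returns 0,
the right coefficient for a primitive of zero y₁-average. Unlike differentiation, `∂₁⁻¹` therefore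
costs no radius. -/
theorem norm_divFst_le (a : ℤ × ℤ → ℂ) (k : ℤ × ℤ) : ‖divFst a k‖ ≤ ‖a k‖ := by
  unfold divFst
  by_cases h : k.1 = 0
  · simp [h]
  · rw [norm_div]
    refine div_le_self (norm_nonneg _) ?_
    simp only [norm_mul, Complex.norm_real, Complex.norm_I, mul_one, Complex.norm_intCast,
      Real.norm_eq_abs, abs_of_pos Real.pi_pos]
    have h1 : (1 : ℝ) ≤ |(k.1 : ℝ)| := by exact_mod_cast Int.one_le_abs h
    nlinarith [Real.pi_gt_three]

theorem integral_fsum_fst {a : ℤ × ℤ → ℂ} (ha : Summable fun k => ‖a k‖)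
    (h0 : ∀ n : ℤ, a (0, n) = 0) (y₂ : ℝ) : ∫ y₁ in (-1 : ℝ)..1, fsum a y₁ y₂ = 0 := by
  have h : HasSum (fun k => ∫ y₁ in (-1 : ℝ)..1, a k * char2 k y₁ y₂)
      (∫ y₁ in (-1 : ℝ)..1, fsum a y₁ y₂) := by
    refine intervalIntegral.hasSum_integral_of_dominated_convergence (fun k _ => ‖a k‖)
      (fun k => ?_) (fun k => ?_) ?_ ?_ ?_
    · unfold char2
      exact (continuous_const.mul
        ((continuous_char1 _).mul continuous_const)).aestronglyMeasurable
    · exact ae_of_all _ fun y _ => by simp [norm_char2]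
    · exact ae_of_all _ fun y _ => ha
    · exact intervalIntegrable_const
    · exact ae_of_all _ fun y _ => (summable_fsum ha y y₂).hasSum
  refine h.unique ?_
  convert hasSum_zero with k
  unfold char2
  simp only [intervalIntegral.integral_const_mul, intervalIntegral.integral_mul_const,
    integral_char1]
  by_cases hk : k.1 = 0
  · have : a k = 0 := by
      have := h0 k.2
      rwa [← hk] at this
    simp [this]
  · simp [hk]

theorem Ana.antideriv_eq {r M : ℝ} {f : ℝ → ℝ → ℝ} (hr : 0 < r) (hf : Ana r M f)
    (h0 : ZeroMean f) (y₁ y₂ : ℝ) : (antideriv f y₁ y₂ : ℂ) = fsum (divFst (fc f)) y₁ y₂ := by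
  have hb : ∀ k, ‖divFst (fc f) k‖ ≤ M * wt r k := fun k =>
    (norm_divFst_le _ k).trans (hf.bound k)
  have hd : ∀ x, HasDerivAt (fun x => fsum (divFst (fc f)) x y₂) (f x y₂ : ℂ) x := by
    intro x
    have := hasDerivAt_fsum_fst hr hb x y₂
    have e : (fun k : ℤ × ℤ => (Real.pi : ℂ) * Complex.I * k.1 * divFst (fc f) k) = fc f := by
      funext k
      unfold divFst
      by_cases h : k.1 = 0
      · have := h0 k.2
        rw [← h] at this
        simp [this]
      · rw [mul_div_cancel₀]
        simp [Real.pi_ne_zero, h]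
    rwa [e, ← hf.eq] at this
  have hc : Continuous fun x => f x y₂ :=
    (hf.continuous hr).comp (Continuous.prodMk continuous_id continuous_const)
  have hi : ∀ z, ((∫ x in (-1 : ℝ)..z, f x y₂ : ℝ) : ℂ) =
      fsum (divFst (fc f)) z y₂ - fsum (divFst (fc f)) (-1) y₂ := by
    intro z
    rw [← intervalIntegral.integral_ofReal]
    exact intervalIntegral.integral_eq_sub_of_hasDerivAt (fun x _ => hd x)
      ((Complex.continuous_ofReal.comp hc).intervalIntegrable _ _)
  have hgc : Continuous fun x => fsum (divFst (fc f)) x y₂ :=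
    continuous_iff_continuousAt.2 fun x => (hd x).continuousAt
  unfold antideriv
  rw [Complex.ofReal_sub, Complex.ofReal_mul, hi, ← intervalIntegral.integral_ofReal]
  simp only [hi]
  -- The divided series is a primitive without k₁ = 0 modes, so its y₁-average vanishes; only its
  -- value at -1 survives the averaging, and it cancels the lower limit of the inner integral.
  rw [intervalIntegral.integral_sub (hgc.intervalIntegrable _ _) intervalIntegrable_const,
    integral_fsum_fst (summable_of_wt hr hb) (fun n => by simp [divFst])]
  simp
  ring

theorem Ana.fc_antideriv {r M : ℝ} {f : ℝ → ℝ → ℝ} (hr : 0 < r) (hf : Ana r M f)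
    (h0 : ZeroMean f) : fc (antideriv f) = divFst (fc f) :=
  fc_of_series (summable_of_wt hr fun k => (norm_divFst_le _ k).trans (hf.bound k))
    (hf.antideriv_eq hr h0)

theorem Ana.antideriv {r M : ℝ} {f : ℝ → ℝ → ℝ} (hr : 0 < r) (hf : Ana r M f)
    (h0 : ZeroMean f) : Ana r M (antideriv f) :=
  Ana.of_series hr (fun k => (norm_divFst_le _ k).trans (hf.bound k)) (hf.antideriv_eq hr h0)

theorem Ana.ext {r M r' M' : ℝ} {f g : ℝ → ℝ → ℝ} (hf : Ana r M f) (hg : Ana r' M' g)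
    (h : fc f = fc g) : f = g := by
  funext y₁ y₂
  have h1 := hf.eq y₁ y₂
  rw [h, ← hg.eq] at h1
  exact_mod_cast h1

theorem Ana.d1_antideriv {r M : ℝ} {f : ℝ → ℝ → ℝ} (hr : 0 < r) (hf : Ana r M f)
    (h0 : ZeroMean f) : ETL.d1 (ETL.antideriv f) = f := by
  have h1 := hf.antideriv hr h0
  refine (h1.d1 hr).ext hf ?_
  rw [h1.fc_d1 hr, hf.fc_antideriv hr h0]
  funext k
  unfold divFst
  by_cases h : k.1 = 0
  · have := h0 k.2
    rw [← h] at this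
    simp [this]
  · rw [mul_div_cancel₀]
    simp [Real.pi_ne_zero, h]

theorem Ana.zeroMean_d2 {r M : ℝ} {f : ℝ → ℝ → ℝ} (hr : 0 < r) (hf : Ana r M f)
    (h0 : ZeroMean f) : ZeroMean (ETL.d2 f) := fun n => by simp [hf.fc_d2 hr, h0 n]

theorem Ana.antideriv_d2 {r M : ℝ} {f : ℝ → ℝ → ℝ} (hr : 0 < r) (hf : Ana r M f)
    (h0 : ZeroMean f) : ETL.antideriv (ETL.d2 f) = ETL.d2 (ETL.antideriv f) := by
  have hr' := half_pos hr
  refine ((hf.d2 hr).antideriv hr' (hf.zeroMean_d2 hr h0)).ext ((hf.antideriv hr h0).d2 hr) ?_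
  rw [(hf.d2 hr).fc_antideriv hr' (hf.zeroMean_d2 hr h0), (hf.antideriv hr h0).fc_d2 hr,
    hf.fc_antideriv hr h0, hf.fc_d2 hr]
  funext k
  unfold divFst
  ring

/-! ### Fourier inversion -/

/-- The function descends to `AddCircle 2`, where a continuous function with summable coefficients
is the sum of its Fourier series. -/
theorem hasSum_char1_of_summable {g : ℝ → ℂ} (hg : Continuous g) (hp : ∀ y, g (y + 2) = g y)
    (hs : Summable fun n : ℤ => (1 / 2 : ℂ) * ∫ x in (-1 : ℝ)..1, g x * char1 (-n) x) (y : ℝ) :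
    HasSum (fun n : ℤ => ((1 / 2 : ℂ) * ∫ x in (-1 : ℝ)..1, g x * char1 (-n) x) * char1 n y)
      (g y) := by
  have : Fact ((0 : ℝ) < 2) := ⟨two_pos⟩
  have hper : Function.Periodic g 2 := hp
  let G : C(AddCircle (2 : ℝ), ℂ) := ⟨hper.lift, continuous_coinduced_dom.2 hg⟩
  have hGe : ∀ x : ℝ, G (x : AddCircle (2 : ℝ)) = g x := fun x => hper.lift_coe x
  have hchar : ∀ (n : ℤ) (x : ℝ), fourier n (x : AddCircle (2 : ℝ)) = char1 n x := by
    intro n x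
    rw [fourier_coe_apply]
    unfold char1
    congr 1
    push_cast
    ring
  have hc : ∀ n : ℤ, fourierCoeff G n =
      (1 / 2 : ℂ) * ∫ x in (-1 : ℝ)..1, g x * char1 (-n) x := by
    intro n
    rw [fourierCoeff_eq_intervalIntegral G n (-1)]
    simp only [hGe, hchar, smul_eq_mul]
    rw [show (-1 : ℝ) + 2 = 1 by norm_num, Complex.real_smul]
    simp only [mul_comm]
    push_cast
    ring_nf
  have h := has_pointwise_sum_fourier_series_of_summable (f := G)
    (by simpa only [← hc] using hs) (y : AddCircle (2 : ℝ))
  simpa only [hGe, hchar, hc, smul_eq_mul] using h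

/-- Two one-dimensional inversions: in y₂ with coefficients `A n` depending on y₁, then of each `A
n` in y₁. Absolute summability of the double family joins the two iterated sums into one. -/
theorem fsum_fc_of_continuous {f : ℝ → ℝ → ℝ} (hc : Continuous fun y : ℝ × ℝ => f y.1 y.2)
    (hp₁ : ∀ y₁ y₂, f (y₁ + 2) y₂ = f y₁ y₂) (hp₂ : ∀ y₁ y₂, f y₁ (y₂ + 2) = f y₁ y₂)
    (hs : Summable fun k => ‖fc f k‖) (y₁ y₂ : ℝ) : (f y₁ y₂ : ℂ) = fsum (fc f) y₁ y₂ := by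
  set A : ℤ → ℝ → ℂ := fun n x => (1 / 2 : ℂ) * ∫ z in (-1 : ℝ)..1, (f x z : ℂ) * char1 (-n) z
    with hA
  have hAc : ∀ n, Continuous (A n) := by
    intro n
    refine continuous_const.mul ?_
    refine intervalIntegral.continuous_parametric_intervalIntegral_of_continuous'
      (f := fun x z => (f x z : ℂ) * char1 (-n) z) ?_ _ _
    exact (Complex.continuous_ofReal.comp hc).mul ((continuous_char1 _).comp continuous_snd)
  have hAp : ∀ n x, A n (x + 2) = A n x := by
    intro n x
    simp only [hA, hp₁]
  have hAf : ∀ m n, (1 / 2 : ℂ) * ∫ x in (-1 : ℝ)..1, A n x * char1 (-m) x = fc f (m, n) := by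
    intro m n
    rw [fc_eq, ← intervalIntegral.integral_const_mul, ← intervalIntegral.integral_const_mul]
    refine intervalIntegral.integral_congr fun x _ => ?_
    simp only [hA, char2, Prod.fst_neg, Prod.snd_neg]
    rw [mul_assoc, ← intervalIntegral.integral_mul_const, ← mul_assoc]
    congr 1
    · norm_num
    · congr 1
      funext z
      ring
  have hs' : Summable fun p : ℤ × ℤ => ‖fc f (p.2, p.1)‖ := (Equiv.prodComm ℤ ℤ).summable_iff.2 hs
  have hsum : ∀ n, Summable fun m : ℤ => ‖fc f (m, n)‖ := fun n => hs'.prod_factor n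
  have hA1 : ∀ n x, HasSum (fun m : ℤ => fc f (m, n) * char1 m x) (A n x) := by
    intro n x
    have := hasSum_char1_of_summable (hAc n) (hAp n) (by
      simp only [hAf]
      exact (hsum n).of_norm) x
    simpa only [hAf] using this
  have hA2 : Summable fun n => A n y₁ := by
    refine Summable.of_norm_bounded hs'.prod fun n => ?_
    rw [← (hA1 n y₁).tsum_eq]
    refine tsum_of_norm_bounded (hsum n).hasSum fun m => ?_
    simp [norm_char1]
  have hf := hasSum_char1_of_summable (g := fun z => (f y₁ z : ℂ))
    (Complex.continuous_ofReal.comp (hc.comp (Continuous.prodMk continuous_const continuous_id)))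
    (fun z => by simp only [hp₂]) hA2 y₂
  rw [← hf.tsum_eq]
  have hF : Summable fun p : ℤ × ℤ => fc f (p.2, p.1) * char2 (p.2, p.1) y₁ y₂ :=
    (Equiv.prodComm ℤ ℤ).summable_iff.2 (summable_fsum hs y₁ y₂)
  unfold fsum
  rw [← (Equiv.prodComm ℤ ℤ).tsum_eq]
  refine Eq.trans ?_ hF.tsum_prod.symm
  refine tsum_congr fun n => ?_
  change A n y₁ * _ = _
  rw [← (hA1 n y₁).tsum_eq, ← tsum_mul_right]
  refine tsum_congr fun m => ?_
  simp only [char2]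
  ring

theorem zeroMean_of_integral {f : ℝ → ℝ → ℝ} (hc : Continuous fun y : ℝ × ℝ => f y.1 y.2)
    (h0 : ∀ y₂, ∫ y₁ in (-1 : ℝ)..1, f y₁ y₂ = 0) : ZeroMean f := by
  intro n
  have hc' : Continuous fun y : ℝ × ℝ => (f y.1 y.2 : ℂ) * char1 (-n) y.2 :=
    (Complex.continuous_ofReal.comp hc).mul ((continuous_char1 _).comp continuous_snd)
  have hle : (-1 : ℝ) ≤ 1 := by norm_num
  rw [fc_eq]
  simp only [char2, Prod.fst_neg, Prod.snd_neg, neg_zero, char1_zero_left, one_mul]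
  have hint : Integrable (Function.uncurry fun y₁ y₂ : ℝ => (f y₁ y₂ : ℂ) * char1 (-n) y₂)
      ((volume.restrict (Ioc (-1 : ℝ) 1)).prod (volume.restrict (Ioc (-1 : ℝ) 1))) := by
    rw [Measure.prod_restrict]
    refine (ContinuousOn.integrableOn_compact (isCompact_Icc.prod isCompact_Icc)
      hc'.continuousOn).mono_set (prod_mono Ioc_subset_Icc_self Ioc_subset_Icc_self)
  simp only [intervalIntegral.integral_of_le hle]
  rw [integral_integral_swap hint]
  simp only [← intervalIntegral.integral_of_le hle]
  have : ∀ y₂ : ℝ, ∫ y₁ in (-1 : ℝ)..1, (f y₁ y₂ : ℂ) * char1 (-n) y₂ = 0 := by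
    intro y₂
    rw [intervalIntegral.integral_mul_const, intervalIntegral.integral_ofReal, h0]
    simp
  simp [this]

/-! ### Symmetric difference quotients -/

/-- The mean value inequality gains one power of |t|. The factor 1/(m + 1) of exact integration is
given up, so that the same `K` survives iteration. -/
theorem abs_le_of_abs_deriv_le {φ φ' : ℝ → ℝ} {K : ℝ} {m : ℕ} (hK : 0 ≤ K)
    (hφ : ∀ t, HasDerivAt φ (φ' t) t) (h0 : φ 0 = 0) (hb : ∀ t, |φ' t| ≤ K * |t| ^ m) (t : ℝ) :
    |φ t| ≤ K * |t| ^ (m + 1) := by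
  have h := (convex_uIcc (0 : ℝ) t).norm_image_sub_le_of_norm_hasDerivWithin_le
    (f := φ) (f' := φ') (C := K * |t| ^ m) (fun x _ => (hφ x).hasDerivWithinAt)
    (fun x hx => by
      have h1 : |x| ≤ |t| := by
        have := abs_sub_left_of_mem_uIcc hx
        simpa using this
      rw [Real.norm_eq_abs]
      exact (hb x).trans (by gcongr)) left_mem_uIcc right_mem_uIcc
  rw [h0, sub_zero, sub_zero, Real.norm_eq_abs, Real.norm_eq_abs] at h
  calc _ ≤ _ := h
    _ = _ := by ring

theorem hasDerivAt_symm_diff {g g' : ℝ → ℝ} (hg : ∀ t, HasDerivAt g (g' t) t) (x t : ℝ) :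
    HasDerivAt (fun t => g (x + t) + g (x - t)) (g' (x + t) - g' (x - t)) t := by
  have h1 : HasDerivAt (fun t => g (x + t)) (g' (x + t)) t := (hg _).comp_const_add x t
  have h2 : HasDerivAt (fun t => g (x - t)) (-g' (x - t)) t := (hg _).comp_const_sub x t
  exact h1.add h2

theorem hasDerivAt_asymm_diff {g g' : ℝ → ℝ} (hg : ∀ t, HasDerivAt g (g' t) t) (x t : ℝ) :
    HasDerivAt (fun t => g (x + t) - g (x - t)) (g' (x + t) + g' (x - t)) t := by
  have h1 : HasDerivAt (fun t => g (x + t)) (g' (x + t)) t := (hg _).comp_const_add x t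
  have h2 : HasDerivAt (fun t => g (x - t)) (-g' (x - t)) t := (hg _).comp_const_sub x t
  have := h1.sub h2
  rwa [sub_neg_eq_add] at this

theorem abs_symm_diff_le {g g1 g2 : ℝ → ℝ} {C : ℝ} (hC : 0 ≤ C)
    (h1 : ∀ t, HasDerivAt g (g1 t) t) (h2 : ∀ t, HasDerivAt g1 (g2 t) t)
    (hb : ∀ t, |g2 t| ≤ C) (x t : ℝ) :
    |g (x + t) + g (x - t) - 2 * g x| ≤ 2 * C * |t| ^ 2 := by
  have hC' : 0 ≤ 2 * C := by linarith
  refine abs_le_of_abs_deriv_le hC' (φ := fun t => g (x + t) + g (x - t) - 2 * g x)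
    (fun t => (hasDerivAt_symm_diff h1 x t).sub_const _) (by simp; ring) ?_ t
  refine abs_le_of_abs_deriv_le hC' (fun t => hasDerivAt_asymm_diff h2 x t) (by simp) ?_
  intro t
  have := (abs_add_le (g2 (x + t)) (g2 (x - t))).trans (add_le_add (hb _) (hb _))
  rw [pow_zero]
  linarith

/-- The remainder and its t-derivative vanish at t = 0, and its second t-derivative is the
second-order symmetric difference of `g2`. The sixth-order version reduces to this one in the same
way. -/
theorem abs_symm_diff_four_le {g g1 g2 g3 g4 : ℝ → ℝ} {C : ℝ} (hC : 0 ≤ C)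
    (h1 : ∀ t, HasDerivAt g (g1 t) t) (h2 : ∀ t, HasDerivAt g1 (g2 t) t)
    (h3 : ∀ t, HasDerivAt g2 (g3 t) t) (h4 : ∀ t, HasDerivAt g3 (g4 t) t)
    (hb : ∀ t, |g4 t| ≤ C) (x t : ℝ) :
    |g (x + t) + g (x - t) - 2 * g x - t ^ 2 * g2 x| ≤ 2 * C * |t| ^ 4 := by
  have hC' : 0 ≤ 2 * C := by linarith
  refine abs_le_of_abs_deriv_le hC'
    (φ := fun t => g (x + t) + g (x - t) - 2 * g x - t ^ 2 * g2 x)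
    (φ' := fun t => g1 (x + t) - g1 (x - t) - 2 * t * g2 x)
    (fun t => ?_) (by simp; ring) ?_ t
  · refine ((hasDerivAt_symm_diff h1 x t).sub_const _).sub ?_
    exact ((hasDerivAt_pow 2 t).mul_const (g2 x)).congr_deriv (by norm_num)
  refine abs_le_of_abs_deriv_le hC'
    (φ' := fun t => g2 (x + t) + g2 (x - t) - 2 * g2 x)
    (fun t => ?_) (by simp) ?_
  · refine (hasDerivAt_asymm_diff h2 x t).sub ?_
    exact (((hasDerivAt_id t).const_mul 2).mul_const (g2 x)).congr_deriv (by norm_num)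
  exact abs_symm_diff_le hC h3 h4 hb x

theorem abs_symm_diff_six_le {g g1 g2 g3 g4 g5 g6 : ℝ → ℝ} {C : ℝ} (hC : 0 ≤ C)
    (h1 : ∀ t, HasDerivAt g (g1 t) t) (h2 : ∀ t, HasDerivAt g1 (g2 t) t)
    (h3 : ∀ t, HasDerivAt g2 (g3 t) t) (h4 : ∀ t, HasDerivAt g3 (g4 t) t)
    (h5 : ∀ t, HasDerivAt g4 (g5 t) t) (h6 : ∀ t, HasDerivAt g5 (g6 t) t)
    (hb : ∀ t, |g6 t| ≤ C) (x t : ℝ) :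
    |g (x + t) + g (x - t) - 2 * g x - t ^ 2 * g2 x - t ^ 4 / 12 * g4 x| ≤ 2 * C * |t| ^ 6 := by
  have hC' : 0 ≤ 2 * C := by linarith
  refine abs_le_of_abs_deriv_le hC'
    (φ := fun t => g (x + t) + g (x - t) - 2 * g x - t ^ 2 * g2 x - t ^ 4 / 12 * g4 x)
    (φ' := fun t => g1 (x + t) - g1 (x - t) - 2 * t * g2 x - t ^ 3 / 3 * g4 x)
    (fun t => ?_) (by simp; ring) ?_ t
  · refine (((hasDerivAt_symm_diff h1 x t).sub_const _).sub ?_).sub ?_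
    · exact ((hasDerivAt_pow 2 t).mul_const (g2 x)).congr_deriv (by norm_num)
    · exact (((hasDerivAt_pow 4 t).div_const 12).mul_const (g4 x)).congr_deriv (by
        push_cast; ring)
  refine abs_le_of_abs_deriv_le hC'
    (φ' := fun t => g2 (x + t) + g2 (x - t) - 2 * g2 x - t ^ 2 * g4 x)
    (fun t => ?_) (by simp) ?_
  · refine ((hasDerivAt_asymm_diff h2 x t).sub ?_).sub ?_
    · exact (((hasDerivAt_id t).const_mul 2).mul_const (g2 x)).congr_deriv (by norm_num)
    · exact (((hasDerivAt_pow 3 t).div_const 3).mul_const (g4 x)).congr_deriv (by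
        norm_num)
  exact abs_symm_diff_four_le hC h3 h4 h5 h6 hb x

/-! ### Families of functions with uniformly decaying Fourier coefficients -/

/-- The members of the family are sums of uniformly exponentially decaying Fourier series. -/
def UA {ι : Type*} (F : ι → ℝ → ℝ → ℝ) : Prop := ∃ r M : ℝ, 0 < r ∧ ∀ i, Ana r M (F i)

section UA

variable {ι κ : Type*} {F G : ι → ℝ → ℝ → ℝ}

theorem UA.comp (hF : UA F) (g : κ → ι) : UA fun i => F (g i) := by
  obtain ⟨r, M, hr, h⟩ := hF
  exact ⟨r, M, hr, fun i => h _⟩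

theorem UA.common (hF : UA F) (hG : UA G) :
    ∃ r M : ℝ, 0 < r ∧ ∀ i, Ana r M (F i) ∧ Ana r M (G i) := by
  obtain ⟨r, M, hr, h⟩ := hF
  obtain ⟨r', M', hr', h'⟩ := hG
  exact ⟨min r r', max M M', lt_min hr hr', fun i =>
    ⟨(h i).mono (min_le_left _ _) (le_max_left _ _),
      (h' i).mono (min_le_right _ _) (le_max_right _ _)⟩⟩

theorem UA.add (hF : UA F) (hG : UA G) : UA fun i y₁ y₂ => F i y₁ y₂ + G i y₁ y₂ := by
  obtain ⟨r, M, hr, h⟩ := hF.common hG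
  exact ⟨r, _, hr, fun i => (h i).1.add hr (h i).2⟩

theorem UA.mul (hF : UA F) (hG : UA G) : UA fun i y₁ y₂ => F i y₁ y₂ * G i y₁ y₂ := by
  obtain ⟨r, M, hr, h⟩ := hF.common hG
  exact ⟨r / 2, _, half_pos hr, fun i => (h i).1.mul hr (h i).2⟩

theorem UA.smul (hF : UA F) {c : ι → ℝ} {K : ℝ} (hc : ∀ i, |c i| ≤ K) :
    UA fun i y₁ y₂ => c i * F i y₁ y₂ := by
  obtain ⟨r, M, hr, h⟩ := hF
  exact ⟨r, K * M, hr, fun i => ((h i).const_mul hr (c i)).mono le_rfl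
    (mul_le_mul_of_nonneg_right (hc i) (h i).nonneg)⟩

theorem UA.const_mul (hF : UA F) (c : ℝ) : UA fun i y₁ y₂ => c * F i y₁ y₂ :=
  hF.smul (c := fun _ => c) fun _ => le_rfl

theorem UA.neg (hF : UA F) : UA fun i y₁ y₂ => -F i y₁ y₂ := by
  simpa using hF.const_mul (-1)

theorem UA.sub (hF : UA F) (hG : UA G) : UA fun i y₁ y₂ => F i y₁ y₂ - G i y₁ y₂ := by
  simpa only [sub_eq_add_neg] using hF.add hG.neg

theorem UA.shift (hF : UA F) (c : ι → ℝ) : UA fun i y₁ y₂ => F i (y₁ + c i) y₂ := by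
  obtain ⟨r, M, hr, h⟩ := hF
  exact ⟨r, M, hr, fun i => (h i).shift hr _⟩

theorem UA.d1 (hF : UA F) : UA fun i => d1 (F i) := by
  obtain ⟨r, M, hr, h⟩ := hF
  exact ⟨r / 2, _, half_pos hr, fun i => (h i).d1 hr⟩

theorem UA.d2 (hF : UA F) : UA fun i => d2 (F i) := by
  obtain ⟨r, M, hr, h⟩ := hF
  exact ⟨r / 2, _, half_pos hr, fun i => (h i).d2 hr⟩

theorem UA.antideriv (hF : UA F) (h0 : ∀ i, ZeroMean (F i)) : UA fun i => antideriv (F i) := by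
  obtain ⟨r, M, hr, h⟩ := hF
  exact ⟨r, M, hr, fun i => (h i).antideriv hr (h0 i)⟩

theorem UA.bound (hF : UA F) : ∃ C : ℝ, 0 < C ∧ ∀ i y₁ y₂, |F i y₁ y₂| ≤ C := by
  obtain ⟨r, M, hr, h⟩ := hF
  exact ⟨max (M * wtSum r) 1, lt_max_of_lt_right one_pos, fun i y₁ y₂ =>
    ((h i).abs_le hr y₁ y₂).trans (le_max_left _ _)⟩

theorem UA.hasDerivAt_fst (hF : UA F) (i : ι) (y₁ y₂ : ℝ) :
    HasDerivAt (fun x => F i x y₂) (ETL.d1 (F i) y₁ y₂) y₁ := by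
  obtain ⟨r, M, hr, h⟩ := hF
  exact (h i).hasDerivAt_fst hr _ _

theorem UA.hasDerivAt_snd (hF : UA F) (i : ι) (y₁ y₂ : ℝ) :
    HasDerivAt (fun x => F i y₁ x) (ETL.d2 (F i) y₁ y₂) y₂ := by
  obtain ⟨r, M, hr, h⟩ := hF
  exact (h i).hasDerivAt_snd hr _ _

theorem UA.lipschitz_fst (hF : UA F) : ∃ C : ℝ, 0 < C ∧ ∀ i y₁ y₂ z,
    |F i z y₂ - F i y₁ y₂| ≤ C * |z - y₁| := by
  obtain ⟨C, hC, hb⟩ := hF.d1.bound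
  refine ⟨C, hC, fun i y₁ y₂ z => ?_⟩
  exact (convex_univ).norm_image_sub_le_of_norm_hasDerivWithin_le
    (f := fun x => F i x y₂) (fun x _ => (hF.hasDerivAt_fst i x y₂).hasDerivWithinAt)
    (fun x _ => hb i x y₂) (mem_univ _) (mem_univ _)

theorem UA.lipschitz_snd (hF : UA F) : ∃ C : ℝ, 0 < C ∧ ∀ i y₁ y₂ z,
    |F i y₁ z - F i y₁ y₂| ≤ C * |z - y₂| := by
  obtain ⟨C, hC, hb⟩ := hF.d2.bound
  refine ⟨C, hC, fun i y₁ y₂ z => ?_⟩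
  exact (convex_univ).norm_image_sub_le_of_norm_hasDerivWithin_le
    (f := fun x => F i y₁ x) (fun x _ => (hF.hasDerivAt_snd i y₁ x).hasDerivWithinAt)
    (fun x _ => hb i y₁ x) (mem_univ _) (mem_univ _)

theorem UA.symm_diff_fst (hF : UA F) : ∃ C : ℝ, 0 < C ∧ ∀ i y₁ y₂ h,
    |F i (y₁ + h) y₂ + F i (y₁ - h) y₂ - 2 * F i y₁ y₂ -
      h ^ 2 * ETL.d1 (ETL.d1 (F i)) y₁ y₂| ≤ C * |h| ^ 4 := by
  obtain ⟨C, hC, hb⟩ := hF.d1.d1.d1.d1.bound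
  refine ⟨2 * C, by linarith, fun i y₁ y₂ h => ?_⟩
  exact abs_symm_diff_four_le (g := fun x => F i x y₂) hC.le
    (fun t => hF.hasDerivAt_fst i t y₂) (fun t => hF.d1.hasDerivAt_fst i t y₂)
    (fun t => hF.d1.d1.hasDerivAt_fst i t y₂) (fun t => hF.d1.d1.d1.hasDerivAt_fst i t y₂)
    (fun t => hb i t y₂) y₁ h

theorem UA.symm_diff_snd (hF : UA F) : ∃ C : ℝ, 0 < C ∧ ∀ i y₁ y₂ h,
    |F i y₁ (y₂ + h) + F i y₁ (y₂ - h) - 2 * F i y₁ y₂ -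
      h ^ 2 * ETL.d2 (ETL.d2 (F i)) y₁ y₂| ≤ C * |h| ^ 4 := by
  obtain ⟨C, hC, hb⟩ := hF.d2.d2.d2.d2.bound
  refine ⟨2 * C, by linarith, fun i y₁ y₂ h => ?_⟩
  exact abs_symm_diff_four_le (g := fun x => F i y₁ x) hC.le
    (fun t => hF.hasDerivAt_snd i y₁ t) (fun t => hF.d2.hasDerivAt_snd i y₁ t)
    (fun t => hF.d2.d2.hasDerivAt_snd i y₁ t) (fun t => hF.d2.d2.d2.hasDerivAt_snd i y₁ t)
    (fun t => hb i y₁ t) y₂ h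

theorem UA.symm_diff_fst_six (hF : UA F) : ∃ C : ℝ, 0 < C ∧ ∀ i y₁ y₂ h,
    |F i (y₁ + h) y₂ + F i (y₁ - h) y₂ - 2 * F i y₁ y₂ -
      h ^ 2 * ETL.d1 (ETL.d1 (F i)) y₁ y₂ -
      h ^ 4 / 12 * ETL.d1 (ETL.d1 (ETL.d1 (ETL.d1 (F i)))) y₁ y₂| ≤ C * |h| ^ 6 := by
  obtain ⟨C, hC, hb⟩ := hF.d1.d1.d1.d1.d1.d1.bound
  refine ⟨2 * C, by linarith, fun i y₁ y₂ h => ?_⟩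
  exact abs_symm_diff_six_le (g := fun x => F i x y₂) hC.le
    (fun t => hF.hasDerivAt_fst i t y₂) (fun t => hF.d1.hasDerivAt_fst i t y₂)
    (fun t => hF.d1.d1.hasDerivAt_fst i t y₂) (fun t => hF.d1.d1.d1.hasDerivAt_fst i t y₂)
    (fun t => hF.d1.d1.d1.d1.hasDerivAt_fst i t y₂)
    (fun t => hF.d1.d1.d1.d1.d1.hasDerivAt_fst i t y₂)
    (fun t => hb i t y₂) y₁ h

end UA

/-! ### Time-dependent families -/

/-- The mean value inequality on the convex set dominates the slopes by the summable `u`, so the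
limit passes under the sum. Derivatives within the set are needed because the solutions live on a
closed time interval. -/
theorem hasDerivWithinAt_tsum {κ : Type*} {I : Set ℝ} (hI : Convex ℝ I) {a a' : ℝ → κ → ℂ}
    {u : κ → ℝ} (hu : Summable u)
    (hd : ∀ s ∈ I, ∀ k, HasDerivWithinAt (fun s => a s k) (a' s k) I s)
    (hb : ∀ s ∈ I, ∀ k, ‖a' s k‖ ≤ u k) (hs : ∀ s ∈ I, Summable (a s)) {s₀ : ℝ} (h₀ : s₀ ∈ I) :
    HasDerivWithinAt (fun s => ∑' k, a s k) (∑' k, a' s₀ k) I s₀ := by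
  rw [hasDerivWithinAt_iff_tendsto_slope]
  have key : Tendsto (fun s => ∑' k, slope (fun s => a s k) s₀ s) (𝓝[I \ {s₀}] s₀)
      (𝓝 (∑' k, a' s₀ k)) := by
    refine tendsto_tsum_of_dominated_convergence hu (fun k => ?_) ?_
    · exact hasDerivWithinAt_iff_tendsto_slope.1 (hd s₀ h₀ k)
    · filter_upwards [self_mem_nhdsWithin] with s hs' k
      have h1 := hI.norm_image_sub_le_of_norm_hasDerivWithin_le (fun x hx => hd x hx k)
        (fun x hx => hb x hx k) h₀ hs'.1
      have h2 : 0 < ‖s - s₀‖ := norm_pos_iff.2 (sub_ne_zero.2 hs'.2)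
      rw [slope_def_module, norm_smul, norm_inv, inv_mul_le_iff₀ h2, mul_comm]
      exact h1
  refine key.congr' ?_
  filter_upwards [self_mem_nhdsWithin] with s hs'
  rw [slope_def_module, ← (hs s hs'.1).tsum_sub (hs s₀ h₀), ← tsum_const_smul'']
  simp only [slope_def_module]

theorem hasDerivWithinAt_integral_of_lipschitz {I : Set ℝ} {f : ℝ → ℝ → ℂ} {f' : ℝ → ℂ} {s₀ M : ℝ}
    (h₀ : s₀ ∈ I) (hc : ∀ s ∈ I, Continuous (f s))
    (hd : ∀ x, HasDerivWithinAt (fun s => f s x) (f' x) I s₀)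
    (hL : ∀ s ∈ I, ∀ x, ‖f s x - f s₀ x‖ ≤ M * |s - s₀|) :
    HasDerivWithinAt (fun s => ∫ x in (-1 : ℝ)..1, f s x) (∫ x in (-1 : ℝ)..1, f' x) I s₀ := by
  rw [hasDerivWithinAt_iff_tendsto_slope]
  have key : Tendsto (fun s => ∫ x in (-1 : ℝ)..1, slope (fun s => f s x) s₀ s) (𝓝[I \ {s₀}] s₀)
      (𝓝 (∫ x in (-1 : ℝ)..1, f' x)) := by
    refine intervalIntegral.tendsto_integral_filter_of_dominated_convergence (fun _ => M)
      ?_ ?_ intervalIntegrable_const ?_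
    · filter_upwards [self_mem_nhdsWithin] with s hs'
      simp only [slope_def_module]
      exact (((hc s hs'.1).sub (hc s₀ h₀)).const_smul _).aestronglyMeasurable
    · filter_upwards [self_mem_nhdsWithin] with s hs'
      refine ae_of_all _ fun x _ => ?_
      have h2 : 0 < ‖s - s₀‖ := norm_pos_iff.2 (sub_ne_zero.2 hs'.2)
      rw [slope_def_module, norm_smul, norm_inv, inv_mul_le_iff₀ h2, mul_comm]
      exact hL s hs'.1 x
    · exact ae_of_all _ fun x _ => hasDerivWithinAt_iff_tendsto_slope.1 (hd x)
  refine key.congr' ?_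
  filter_upwards [self_mem_nhdsWithin] with s hs'
  simp only [slope_def_module]
  rw [intervalIntegral.integral_smul, intervalIntegral.integral_sub
    ((hc s hs'.1).intervalIntegrable _ _) ((hc s₀ h₀).intervalIntegrable _ _)]

/-- A family of time-dependent functions, with uniformly decaying Fourier coefficients, whose
time derivative has the same property. -/
structure UT {ι : Type*} (T : ℝ) (F F' : ι → ℝ → ℝ → ℝ → ℝ) : Prop where
  ana : UA fun p : ι × Icc (-T) T => F p.1 p.2
  ana' : UA fun p : ι × Icc (-T) T => F' p.1 p.2
  deriv : ∀ i, ∀ s ∈ Icc (-T) T, ∀ y₁ y₂,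
    HasDerivWithinAt (fun r => F i r y₁ y₂) (F' i s y₁ y₂) (Icc (-T) T) s

section UT

variable {ι : Type*} {T : ℝ} {F F' G G' : ι → ℝ → ℝ → ℝ → ℝ}

theorem UT.add (hF : UT T F F') (hG : UT T G G') :
    UT T (fun i s y₁ y₂ => F i s y₁ y₂ + G i s y₁ y₂)
      (fun i s y₁ y₂ => F' i s y₁ y₂ + G' i s y₁ y₂) :=
  ⟨hF.ana.add hG.ana, hF.ana'.add hG.ana',
    fun i s hs y₁ y₂ => (hF.deriv i s hs y₁ y₂).add (hG.deriv i s hs y₁ y₂)⟩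

theorem UT.const_mul (hF : UT T F F') (c : ℝ) :
    UT T (fun i s y₁ y₂ => c * F i s y₁ y₂) (fun i s y₁ y₂ => c * F' i s y₁ y₂) :=
  ⟨hF.ana.const_mul c, hF.ana'.const_mul c,
    fun i s hs y₁ y₂ => (hF.deriv i s hs y₁ y₂).const_mul c⟩

theorem UT.mul (hF : UT T F F') (hG : UT T G G') :
    UT T (fun i s y₁ y₂ => F i s y₁ y₂ * G i s y₁ y₂)
      (fun i s y₁ y₂ => F' i s y₁ y₂ * G i s y₁ y₂ + F i s y₁ y₂ * G' i s y₁ y₂) :=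
  ⟨hF.ana.mul hG.ana, (hF.ana'.mul hG.ana).add (hF.ana.mul hG.ana'),
    fun i s hs y₁ y₂ => (hF.deriv i s hs y₁ y₂).mul (hG.deriv i s hs y₁ y₂)⟩

/-- The time derivative is known only pointwise in space, but it is uniformly bounded, so the
functions are uniformly Lipschitz in time. Dominated convergence then differentiates both integrals
that define the coefficient. -/
theorem UT.hasDerivWithinAt_fc (hF : UT T F F') (i : ι) {s : ℝ} (hs : s ∈ Icc (-T) T)
    (k : ℤ × ℤ) :
    HasDerivWithinAt (fun r => fc (F i r) k) (fc (F' i s) k) (Icc (-T) T) s := by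
  obtain ⟨r, M, hr, hA⟩ := hF.ana
  obtain ⟨C, hC, hb⟩ := hF.ana'.bound
  have hcont : ∀ s ∈ Icc (-T) T, Continuous fun y : ℝ × ℝ => F i s y.1 y.2 :=
    fun s hs => (hA (i, ⟨s, hs⟩)).continuous hr
  have hlip : ∀ r ∈ Icc (-T) T, ∀ y₁ y₂, |F i r y₁ y₂ - F i s y₁ y₂| ≤ C * |r - s| := by
    intro r hr y₁ y₂
    exact (convex_Icc (-T) T).norm_image_sub_le_of_norm_hasDerivWithin_le
      (fun x hx => hF.deriv i x hx y₁ y₂) (fun x hx => hb (i, ⟨x, hx⟩) y₁ y₂) hs hr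
  have hci : ∀ s ∈ Icc (-T) T, Continuous fun y : ℝ × ℝ =>
      (F i s y.1 y.2 : ℂ) * char2 (-k) y.1 y.2 := fun s hs =>
    (Complex.continuous_ofReal.comp (hcont s hs)).mul
      (((continuous_char1 _).comp continuous_fst).mul ((continuous_char1 _).comp continuous_snd))
  have hlip' : ∀ r ∈ Icc (-T) T, ∀ y₁ y₂,
      ‖(F i r y₁ y₂ : ℂ) * char2 (-k) y₁ y₂ - (F i s y₁ y₂ : ℂ) * char2 (-k) y₁ y₂‖
        ≤ C * |r - s| := by
    intro r hr y₁ y₂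
    rw [← sub_mul, norm_mul, norm_char2, mul_one, ← Complex.ofReal_sub, Complex.norm_real]
    exact hlip r hr y₁ y₂
  simp only [fc_eq]
  refine HasDerivWithinAt.const_mul _ ?_
  refine hasDerivWithinAt_integral_of_lipschitz (M := C * 2) hs (fun r hr => ?_)
    (fun y₁ => ?_) (fun r hr y₁ => ?_)
  · exact intervalIntegral.continuous_parametric_intervalIntegral_of_continuous'
      (f := fun x z => (F i r x z : ℂ) * char2 (-k) x z) (hci r hr) _ _
  · refine hasDerivWithinAt_integral_of_lipschitz (M := C) hs (fun r hr => ?_)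
      (fun y₂ => ?_) (fun r hr y₂ => hlip' r hr y₁ y₂)
    · exact (hci r hr).comp (Continuous.prodMk continuous_const continuous_id)
    · exact ((hF.deriv i s hs y₁ y₂).ofReal_comp).mul_const _
  · have hcy : ∀ r ∈ Icc (-T) T, IntervalIntegrable
        (fun y₂ => (F i r y₁ y₂ : ℂ) * char2 (-k) y₁ y₂) volume (-1) 1 := fun r hr =>
      ((hci r hr).comp
        (Continuous.prodMk continuous_const continuous_id)).intervalIntegrable _ _
    rw [← intervalIntegral.integral_sub (hcy r hr) (hcy s hs)]
    refine (intervalIntegral.norm_integral_le_of_norm_le_const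
      fun x _ => hlip' r hr y₁ x).trans (le_of_eq ?_)
    norm_num
    ring

/-- Fourier multipliers commute with the time derivative: differentiate each coefficient and resum,
the decay of the coefficients of `G'` being the domination. Derivatives and primitives in space are
the cases used. -/
theorem UT.of_multiplier (hF : UT T F F') (m : ℤ × ℤ → ℂ)
    (hG : UA fun p : ι × Icc (-T) T => G p.1 p.2) (hG' : UA fun p : ι × Icc (-T) T => G' p.1 p.2)
    (hm : ∀ i, ∀ s ∈ Icc (-T) T, ∀ k, fc (G i s) k = m k * fc (F i s) k)
    (hm' : ∀ i, ∀ s ∈ Icc (-T) T, ∀ k, fc (G' i s) k = m k * fc (F' i s) k) : UT T G G' := by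
  refine ⟨hG, hG', fun i s hs y₁ y₂ => ?_⟩
  obtain ⟨r, M, hr, h⟩ := hG
  obtain ⟨r', M', hr', h'⟩ := hG'
  have key : HasDerivWithinAt (fun r => fsum (fc (G i r)) y₁ y₂)
      (fsum (fc (G' i s)) y₁ y₂) (Icc (-T) T) s := by
    unfold fsum
    refine hasDerivWithinAt_tsum (convex_Icc _ _) ((summable_wt hr').mul_left M')
      (a' := fun r k => fc (G' i r) k * char2 k y₁ y₂) (fun x hx k => ?_) (fun x hx k => ?_)
      (fun x hx => ?_) hs
    · have := ((hF.hasDerivWithinAt_fc i hx k).const_mul (m k)).mul_const (char2 k y₁ y₂)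
      rw [← hm' i x hx] at this
      refine this.congr (fun z hz => ?_) ?_
      · rw [hm i z hz]
      · rw [hm i x hx]
    · rw [norm_mul, norm_char2, mul_one]
      exact (h' (i, ⟨x, hx⟩)).bound k
    · exact summable_fsum ((h (i, ⟨x, hx⟩)).summable hr) y₁ y₂
  rw [← (h' (i, ⟨s, hs⟩)).eq] at key
  have key2 := (Complex.reCLM.hasFDerivAt (x := fsum (fc (G i s)) y₁ y₂)).comp_hasDerivWithinAt
    s key
  have e : ∀ x ∈ Icc (-T) T, G i x y₁ y₂ = (fsum (fc (G i x)) y₁ y₂).re := fun x hx => by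
    rw [← (h (i, ⟨x, hx⟩)).eq, Complex.ofReal_re]
  simp only [Complex.reCLM_apply, Complex.ofReal_re] at key2
  exact key2.congr e (e s hs)

theorem UT.d1 (hF : UT T F F') : UT T (fun i s => d1 (F i s)) (fun i s => d1 (F' i s)) := by
  refine hF.of_multiplier (fun k => Real.pi * Complex.I * k.1) hF.ana.d1 hF.ana'.d1 ?_ ?_
  · intro i s hs k
    obtain ⟨r, M, hr, h⟩ := hF.ana
    rw [(h (i, ⟨s, hs⟩)).fc_d1 hr]
  · intro i s hs k
    obtain ⟨r, M, hr, h⟩ := hF.ana'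
    rw [(h (i, ⟨s, hs⟩)).fc_d1 hr]

theorem UT.d2 (hF : UT T F F') : UT T (fun i s => d2 (F i s)) (fun i s => d2 (F' i s)) := by
  refine hF.of_multiplier (fun k => Real.pi * Complex.I * k.2) hF.ana.d2 hF.ana'.d2 ?_ ?_
  · intro i s hs k
    obtain ⟨r, M, hr, h⟩ := hF.ana
    rw [(h (i, ⟨s, hs⟩)).fc_d2 hr]
  · intro i s hs k
    obtain ⟨r, M, hr, h⟩ := hF.ana'
    rw [(h (i, ⟨s, hs⟩)).fc_d2 hr]

theorem UT.antideriv (hF : UT T F F') (h0 : ∀ i, ∀ s ∈ Icc (-T) T, ZeroMean (F i s))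
    (h0' : ∀ i, ∀ s ∈ Icc (-T) T, ZeroMean (F' i s)) :
    UT T (fun i s => antideriv (F i s)) (fun i s => antideriv (F' i s)) := by
  refine hF.of_multiplier (fun k => (Real.pi * Complex.I * k.1)⁻¹)
    (hF.ana.antideriv fun p => h0 _ _ p.2.2) (hF.ana'.antideriv fun p => h0' _ _ p.2.2) ?_ ?_
  · intro i s hs k
    obtain ⟨r, M, hr, h⟩ := hF.ana
    rw [(h (i, ⟨s, hs⟩)).fc_antideriv hr (h0 i s hs), divFst, div_eq_inv_mul]
  · intro i s hs k
    obtain ⟨r, M, hr, h⟩ := hF.ana'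
    rw [(h (i, ⟨s, hs⟩)).fc_antideriv hr (h0' i s hs), divFst, div_eq_inv_mul]

/-- The derivative along a moving frame. -/
theorem UT.hasDerivWithinAt_moving (hF : UT T F F') (i : ι) {ε : ℝ} (hε : 0 < ε) (c : ℝ) {t : ℝ}
    (ht : t ∈ Icc (-(T / ε)) (T / ε)) (y₁ y₂ : ℝ) :
    HasDerivWithinAt (fun t => F i (ε * t) (y₁ + c * t) y₂)
      (ε * F' i (ε * t) (y₁ + c * t) y₂ + c * ETL.d1 (F i (ε * t)) (y₁ + c * t) y₂)
      (Icc (-(T / ε)) (T / ε)) t := by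
  obtain ⟨r, M, hr, h⟩ := hF.ana
  obtain ⟨r', M', hr', h'⟩ := hF.ana'
  have hmaps : ∀ x ∈ Icc (-(T / ε)) (T / ε), ε * x ∈ Icc (-T) T := by
    intro x hx
    rw [← neg_div, mem_Icc, div_le_iff₀ hε, le_div_iff₀ hε] at hx
    constructor <;> nlinarith [hx.1, hx.2]
  have hb1 : ∀ s ∈ Icc (-T) T, ∀ k, ‖(Real.pi : ℂ) * Complex.I * k.1 * fc (F i s) k‖ ≤
      Real.pi * (2 / r) * M * wt (r / 2) k := fun s hs =>
    norm_mul_fst_le hr (h (i, ⟨s, hs⟩)).bound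
  -- No joint differentiability in time and space is assumed. Each term is a coefficient depending
  -- on time times a character on a moving point, so the product rule applies term by term.
  have key : HasDerivWithinAt (fun t => fsum (fc (F i (ε * t))) (y₁ + c * t) y₂)
      (∑' k, (ε * fc (F' i (ε * t)) k +
        c * ((Real.pi : ℂ) * Complex.I * k.1 * fc (F i (ε * t)) k)) * char2 k (y₁ + c * t) y₂)
      (Icc (-(T / ε)) (T / ε)) t := by
    unfold fsum
    refine hasDerivWithinAt_tsum (convex_Icc _ _)
      (((summable_wt hr').mul_left (ε * M')).add
        ((summable_wt (half_pos hr)).mul_left (|c| * (Real.pi * (2 / r) * M))))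
      (a' := fun t k => (ε * fc (F' i (ε * t)) k +
        c * ((Real.pi : ℂ) * Complex.I * k.1 * fc (F i (ε * t)) k)) * char2 k (y₁ + c * t) y₂)
      (fun x hx k => ?_) (fun x hx k => ?_) (fun x hx => ?_) ht
    · have h1 : HasDerivWithinAt (fun t : ℝ => ε * t) ε (Icc (-(T / ε)) (T / ε)) x := by
        simpa using ((hasDerivAt_id x).const_mul ε).hasDerivWithinAt
      have h2 := (hF.hasDerivWithinAt_fc i (hmaps x hx) k).scomp x h1 hmaps
      have h3 : HasDerivAt (fun t : ℝ => y₁ + c * t) c x := by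
        simpa using ((hasDerivAt_id x).const_mul c).const_add y₁
      have h4 := ((hasDerivAt_char1 k.1 (y₁ + c * x)).scomp x h3).mul_const (char1 k.2 y₂)
      have h5 := h2.mul h4.hasDerivWithinAt
      refine h5.congr_deriv ?_
      simp only [Function.comp_apply, Complex.real_smul, char2]
      ring
    · rw [norm_mul, norm_char2, mul_one]
      refine (norm_add_le _ _).trans (add_le_add ?_ ?_)
      · rw [norm_mul, Complex.norm_real, Real.norm_eq_abs, abs_of_pos hε, mul_assoc]
        exact mul_le_mul_of_nonneg_left ((h' (i, ⟨_, hmaps x hx⟩)).bound k) hε.le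
      · rw [norm_mul, Complex.norm_real, Real.norm_eq_abs, mul_assoc |c|]
        exact mul_le_mul_of_nonneg_left (hb1 _ (hmaps x hx) k) (abs_nonneg c)
    · exact summable_fsum ((h (i, ⟨_, hmaps x hx⟩)).summable hr) _ y₂
  have e : ∀ x ∈ Icc (-(T / ε)) (T / ε), F i (ε * x) (y₁ + c * x) y₂ =
      (fsum (fc (F i (ε * x))) (y₁ + c * x) y₂).re := fun x hx => by
    rw [← (h (i, ⟨_, hmaps x hx⟩)).eq, Complex.ofReal_re]
  have hA := h (i, ⟨_, hmaps t ht⟩)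
  have hA' := h' (i, ⟨_, hmaps t ht⟩)
  have e2 : (∑' k, (ε * fc (F' i (ε * t)) k +
        c * ((Real.pi : ℂ) * Complex.I * k.1 * fc (F i (ε * t)) k)) * char2 k (y₁ + c * t) y₂) =
      ((ε * F' i (ε * t) (y₁ + c * t) y₂ + c * ETL.d1 (F i (ε * t)) (y₁ + c * t) y₂ : ℝ) : ℂ) := by
    have e3 : ∀ k, ε * fc (F' i (ε * t)) k +
        c * ((Real.pi : ℂ) * Complex.I * k.1 * fc (F i (ε * t)) k) =
        (fun k => ε * fc (F' i (ε * t)) k) k + (fun k => c * fc (ETL.d1 (F i (ε * t))) k) k := by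
      intro k
      have := congrFun (hA.fc_d1 hr) k
      simp only at this
      simp only [this]
    simp only [e3]
    have e4 := fsum_add (a := fun k => ε * fc (F' i (ε * t)) k)
      (b := fun k => c * fc (ETL.d1 (F i (ε * t))) k)
      (by simpa [norm_mul] using (hA'.summable hr').mul_left |ε|)
      (by simpa [norm_mul] using ((hA.d1 hr).summable (half_pos hr)).mul_left |c|)
      (y₁ + c * t) y₂
    refine Eq.trans e4 ?_
    rw [fsum_const_mul, fsum_const_mul, ← hA'.eq, ← (hA.d1 hr).eq]
    push_cast
    ring
  rw [e2] at key
  have key2 := (Complex.reCLM.hasFDerivAt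
    (x := fsum (fc (F i (ε * t))) (y₁ + c * t) y₂)).comp_hasDerivWithinAt t key
  simp only [Complex.reCLM_apply, Complex.ofReal_re] at key2
  exact key2.congr e (e t ht)

end UT

/-! ### Solutions of the KP equation in spaces of analytic functions -/

theorem modeNorm_nonneg (k : ℤ × ℤ) : 0 ≤ modeNorm k := Real.sqrt_nonneg _

theorem abs_add_abs_le_two_mul_modeNorm (k : ℤ × ℤ) :
    |(k.1 : ℝ)| + |(k.2 : ℝ)| ≤ 2 * modeNorm k := by
  have h1 : |(k.1 : ℝ)| ≤ modeNorm k := Real.abs_le_sqrt (by nlinarith [sq_nonneg (k.2 : ℝ)])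
  have h2 : |(k.2 : ℝ)| ≤ modeNorm k := Real.abs_le_sqrt (by nlinarith [sq_nonneg (k.1 : ℝ)])
  linarith

theorem one_le_modeNorm {k : ℤ × ℤ} (hk : k ≠ 0) : 1 ≤ modeNorm k := by
  unfold modeNorm
  rw [Real.one_le_sqrt]
  have h : (1 : ℤ) ≤ k.1 ^ 2 + k.2 ^ 2 := by
    by_contra h
    have h1 : k.1 = 0 := by nlinarith [sq_nonneg k.1, sq_nonneg k.2]
    have h2 : k.2 = 0 := by nlinarith [sq_nonneg k.1, sq_nonneg k.2]
    exact hk (Prod.ext h1 h2)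
  exact_mod_cast h

/-- A single term of the norm is at most R², and its factor |k|^(2n) is at least 1. Since |k₁| +
|k₂| ≤ 2|k|, the decay exp(-ρ|k|) becomes the weight of radius ρ/2. The mode k = 0, absent from the
norm, vanishes by the zero mean. -/
theorem norm_fourierCoef_le {ρ n R : ℝ} (hρ : 0 < ρ) (hn : 0 ≤ n) {f : ℝ → ℝ → ℝ}
    (h0 : ZeroMean f) (hs : Summable (normTerm ρ n f)) (hR : ∑' k, normTerm ρ n f k ≤ R ^ 2)
    (hR0 : 0 ≤ R) (k : ℤ × ℤ) : ‖fourierCoef f k‖ ≤ R * wt (ρ / 2) k := by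
  by_cases hk : k = 0
  · have h1 : fourierCoef f k = 0 := by
      have := h0 0
      rw [fc, div_eq_zero_iff] at this
      rw [hk]
      exact this.resolve_right two_ne_zero
    rw [h1, norm_zero]
    exact mul_nonneg hR0 (wt_pos _ _).le
  · have hnn : ∀ k, 0 ≤ normTerm ρ n f k := fun k =>
      mul_nonneg (by positivity) (Real.rpow_nonneg (modeNorm_nonneg _) _)
    have h1 : normTerm ρ n f ⟨k, hk⟩ ≤ R ^ 2 := (hs.le_tsum _ fun j _ => hnn j).trans hR
    unfold normTerm at h1
    have h2 : 1 ≤ modeNorm k ^ (2 * n) := Real.one_le_rpow (one_le_modeNorm hk) (by linarith)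
    have h3 : ‖fourierCoef f k‖ ^ 2 * Real.exp (2 * ρ * modeNorm k) ≤ R ^ 2 := by
      refine le_trans ?_ h1
      exact le_mul_of_one_le_right (by positivity) h2
    have h4 : (‖fourierCoef f k‖ * Real.exp (ρ * modeNorm k)) ^ 2 ≤ R ^ 2 := by
      rw [mul_pow, ← Real.exp_nat_mul]
      convert h3 using 3
      push_cast
      ring
    have h5 := abs_le_of_sq_le_sq h4 hR0
    have h6 : ‖fourierCoef f k‖ * Real.exp (ρ * modeNorm k) ≤ R := (abs_le.1 h5).2
    have h7 : Real.exp (-(ρ * modeNorm k)) ≤ wt (ρ / 2) k := by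
      unfold wt
      rw [Real.exp_le_exp]
      nlinarith [abs_add_abs_le_two_mul_modeNorm k]
    calc ‖fourierCoef f k‖ = ‖fourierCoef f k‖ * Real.exp (ρ * modeNorm k) *
          Real.exp (-(ρ * modeNorm k)) := by
            rw [mul_assoc, ← Real.exp_add, add_neg_cancel, Real.exp_zero, mul_one]
      _ ≤ R * wt (ρ / 2) k := mul_le_mul h6 h7 (Real.exp_pos _).le hR0

theorem IsZeroMeanPeriodic.continuous {f : ℝ → ℝ → ℝ} (hf : IsZeroMeanPeriodic f) :
    Continuous fun y : ℝ × ℝ => f y.1 y.2 := hf.smooth.continuous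

theorem IsZeroMeanPeriodic.zeroMean {f : ℝ → ℝ → ℝ} (hf : IsZeroMeanPeriodic f) : ZeroMean f :=
  zeroMean_of_integral hf.continuous hf.zero_mean

theorem IsZeroMeanPeriodic.ana {ρ n R : ℝ} (hρ : 0 < ρ) (hn : 0 ≤ n) {f : ℝ → ℝ → ℝ}
    (hf : IsZeroMeanPeriodic f) (hs : Summable (normTerm ρ n f))
    (hR : ∑' k, normTerm ρ n f k ≤ R ^ 2) (hR0 : 0 ≤ R) : Ana (ρ / 2) R f := by
  have hb : ∀ k, ‖fc f k‖ ≤ R * wt (ρ / 2) k := fun k => by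
    have h1 := norm_fourierCoef_le hρ hn hf.zeroMean hs hR hR0 k
    have h2 : ‖fc f k‖ = ‖fourierCoef f k‖ / 2 := by simp [fc]
    have h3 := norm_nonneg (fourierCoef f k)
    linarith
  exact ⟨hb, fsum_fc_of_continuous hf.continuous hf.periodic_fst hf.periodic_snd
    (summable_of_wt (half_pos hρ) hb)⟩

theorem tsum_normTerm_le {ρ n R : ℝ} {f g : ℝ → ℝ → ℝ} (hR : 0 ≤ R) (h : normH ρ n f g ≤ R) :
    ∑' k, normTerm ρ n f k ≤ R ^ 2 ∧ ∑' k, normTerm ρ n g k ≤ R ^ 2 := by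
  have hnn : ∀ f : ℝ → ℝ → ℝ, 0 ≤ ∑' k, normTerm ρ n f k := fun f => tsum_nonneg fun k =>
    mul_nonneg (by positivity) (Real.rpow_nonneg (modeNorm_nonneg _) _)
  unfold normH at h
  rw [Real.sqrt_le_left hR] at h
  constructor <;> linarith [hnn f, hnn g]

theorem kpField_eq (α : ℝ) (f : ℝ → ℝ → ℝ) : kpField α f = fun y₁ y₂ =>
    -(1 / 24) * d1 (d1 (d1 f)) y₁ y₂ + (-(1 / 2) * antideriv (d2 (d2 f)) y₁ y₂ +
      -(α / (2 * Real.sqrt 2)) * d1 (fun y₁ y₂ => f y₁ y₂ * f y₁ y₂) y₁ y₂) := by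
  funext y₁ y₂
  have e1 : iteratedDeriv 3 (fun x => f x y₂) y₁ = d1 (d1 (d1 f)) y₁ y₂ := by
    rw [iteratedDeriv_eq_iterate]
    rfl
  have e2 : (fun z₁ z₂ => iteratedDeriv 2 (fun w => f z₁ w) z₂) = d2 (d2 f) := by
    funext z₁ z₂
    rw [iteratedDeriv_eq_iterate]
    rfl
  have e3 : deriv (fun x => f x y₂ ^ 2) y₁ = d1 (fun y₁ y₂ => f y₁ y₂ * f y₁ y₂) y₁ y₂ := by
    unfold d1
    simp only [sq]
  unfold kpField
  rw [e1, e2, e3]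
  ring

section

variable {ι : Type*} {T : ℝ} {F F' : ι → ℝ → ℝ → ℝ → ℝ}

/-- The coefficients with k₁ = 0 are identically zero in time, and derivatives within an interval of
positive length are unique. -/
theorem UT.zeroMean_deriv (hF : UT T F F') (hT : 0 < T)
    (h0 : ∀ i, ∀ s ∈ Icc (-T) T, ZeroMean (F i s)) : ∀ i, ∀ s ∈ Icc (-T) T, ZeroMean (F' i s) := by
  intro i s hs n
  have h1 := hF.hasDerivWithinAt_fc i hs (0, n)
  have h2 : HasDerivWithinAt (fun r => fc (F i r) (0, n)) 0 (Icc (-T) T) s :=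
    (hasDerivWithinAt_const s _ (0 : ℂ)).congr (fun x hx => h0 i x hx n) (h0 i s hs n)
  exact UniqueDiffWithinAt.eq_deriv _ (uniqueDiffOn_Icc (by linarith) s hs) h1 h2

/-- The hypotheses on a family of solutions of a KP equation, with sign `c`. -/
structure KPFamily (α T c : ℝ) (F : ι → ℝ → ℝ → ℝ → ℝ) : Prop where
  pos : 0 < T
  ana : UA fun p : ι × Icc (-T) T => F p.1 p.2
  zeroMean : ∀ i, ∀ s ∈ Icc (-T) T, ZeroMean (F i s)
  deriv : ∀ i, ∀ s ∈ Icc (-T) T, ∀ y₁ y₂,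
    HasDerivWithinAt (fun r => F i r y₁ y₂) (c * kpField α (F i s) y₁ y₂) (Icc (-T) T) s

variable {α c : ℝ}

theorem UA.kpField {κ : Type*} {F : κ → ℝ → ℝ → ℝ} (hF : UA F) (h0 : ∀ i, ZeroMean (F i)) (α : ℝ) :
    UA fun i => kpField α (F i) := by
  have h1 : UA fun i => ETL.antideriv (ETL.d2 (ETL.d2 (F i))) := by
    refine hF.d2.d2.antideriv fun i => ?_
    obtain ⟨r, M, hr, h⟩ := hF
    exact ((h i).d2 hr).zeroMean_d2 (half_pos hr) ((h i).zeroMean_d2 hr (h0 i))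
  simp only [kpField_eq]
  exact (hF.d1.d1.d1.const_mul _).add ((h1.const_mul _).add ((hF.mul hF).d1.const_mul _))

theorem KPFamily.ut (hF : KPFamily α T c F) : UT T F fun i s y₁ y₂ => c * kpField α (F i s) y₁ y₂ :=
  ⟨hF.ana, (hF.ana.kpField (fun p => hF.zeroMean _ _ p.2.2) α).const_mul c, hF.deriv⟩

/-- The KP field is built from `F` by operations that preserve `UT`, so it can be differentiated in
time again. This second time derivative enters the derivative of the correctors. -/
theorem KPFamily.exists_ut_field (hF : KPFamily α T c F) :
    ∃ F'' : ι → ℝ → ℝ → ℝ → ℝ, UT T (fun i s y₁ y₂ => c * kpField α (F i s) y₁ y₂) F'' := by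
  have h := hF.ut
  have h0 := h.zeroMean_deriv hF.pos hF.zeroMean
  have hz : ∀ {κ : Type _} {G : κ → ℝ → ℝ → ℝ}, UA G → (∀ i, ZeroMean (G i)) →
      ∀ i, ZeroMean (ETL.d2 (ETL.d2 (G i))) := by
    intro κ G hG h0 i
    obtain ⟨r, M, hr, h⟩ := hG
    exact ((h i).d2 hr).zeroMean_d2 (half_pos hr) ((h i).zeroMean_d2 hr (h0 i))
  have h1 := h.d2.d2.antideriv
    (fun i s hs => hz h.ana (fun p => hF.zeroMean _ _ p.2.2) (i, ⟨s, hs⟩))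
    (fun i s hs => hz h.ana' (fun p => h0 _ _ p.2.2) (i, ⟨s, hs⟩))
  have h2 := ((h.d1.d1.d1.const_mul (-(1 / 24))).add ((h1.const_mul (-(1 / 2))).add
    ((h.mul h).d1.const_mul (-(α / (2 * Real.sqrt 2)))))).const_mul c
  simp only [kpField_eq]
  exact ⟨_, h2⟩

end

theorem Ana.periodic_fst {r M : ℝ} {f : ℝ → ℝ → ℝ} (hf : Ana r M f) (y₁ y₂ : ℝ) :
    f (y₁ + 2) y₂ = f y₁ y₂ := by
  have h1 := hf.eq (y₁ + 2) y₂
  rw [← fsum_shift_fst] at h1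
  simp only [char1_two, one_mul] at h1
  rw [← hf.eq] at h1
  exact_mod_cast h1

theorem Ana.periodic_snd {r M : ℝ} {f : ℝ → ℝ → ℝ} (hf : Ana r M f) (y₁ y₂ : ℝ) :
    f y₁ (y₂ + 2) = f y₁ y₂ := by
  have h1 := hf.eq y₁ (y₂ + 2)
  unfold fsum char2 at h1
  simp only [char1_add_right, char1_two, mul_one] at h1
  have h2 := hf.eq y₁ y₂
  unfold fsum char2 at h2
  rw [← h2] at h1
  exact_mod_cast h1

/-! ### Waves in moving frames and uniform bounds for their correctors -/

section

variable {ι : Type*} {α T c : ℝ}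

/-- A solution `F` of a KP equation with sign `c`, its `y₁`-primitive `X`, its time derivative `K`,
and the first two time derivatives `J`, `J'` of `X`. -/
structure Wave (α T c : ℝ) (F X K J J' : ι → ℝ → ℝ → ℝ → ℝ) : Prop where
  utX : UT T X J
  utF : UT T F K
  utJ : UT T J J'
  d1X : ∀ i, ∀ s ∈ Icc (-T) T, d1 (X i s) = F i s
  d1J : ∀ i, ∀ s ∈ Icc (-T) T, d1 (J i s) = K i s
  field : ∀ i, ∀ s ∈ Icc (-T) T, ∀ y₁ y₂, K i s y₁ y₂ =
    c * (-(1 / 24) * d1 (d1 (d1 (F i s))) y₁ y₂ - 1 / 2 * d2 (d2 (X i s)) y₁ y₂ -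
      α / Real.sqrt 2 * (F i s y₁ y₂ * d1 (F i s) y₁ y₂))

/-- The primitive commutes with time differentiation and with ∂₂², so `J` is the primitive of the
field and ∂₁⁻¹∂₂² acting on `F` becomes ∂₂² acting on the primitive, the form in which the discrete
Laplacian produces it. -/
theorem KPFamily.exists_wave {F : ι → ℝ → ℝ → ℝ → ℝ} (hF : KPFamily α T c F) :
    ∃ K J J' : ι → ℝ → ℝ → ℝ → ℝ, Wave α T c F (fun i s => antideriv (F i s)) K J J' := by
  obtain ⟨F'', hF''⟩ := hF.exists_ut_field
  have h1 := hF.ut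
  have h01 := h1.zeroMean_deriv hF.pos hF.zeroMean
  have h02 := hF''.zeroMean_deriv hF.pos h01
  refine ⟨_, fun i s => antideriv fun y₁ y₂ => c * kpField α (F i s) y₁ y₂,
    fun i s => antideriv (F'' i s), h1.antideriv hF.zeroMean h01, h1, hF''.antideriv h01 h02,
    fun i s hs => ?_, fun i s hs => ?_, fun i s hs y₁ y₂ => ?_⟩
  · obtain ⟨r, M, hr, h⟩ := h1.ana
    exact (h (i, ⟨s, hs⟩)).d1_antideriv hr (hF.zeroMean i s hs)
  · obtain ⟨r, M, hr, h⟩ := h1.ana'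
    exact (h (i, ⟨s, hs⟩)).d1_antideriv hr (h01 i s hs)
  · obtain ⟨r, M, hr, h⟩ := h1.ana
    have hA : Ana r M (F i s) := h (i, ⟨s, hs⟩)
    have h0 := hF.zeroMean i s hs
    have e1 : antideriv (d2 (d2 (F i s))) = d2 (d2 (antideriv (F i s))) := by
      rw [(hA.d2 hr).antideriv_d2 (half_pos hr) (hA.zeroMean_d2 hr h0), hA.antideriv_d2 hr h0]
    have e2 : d1 (fun y₁ y₂ => F i s y₁ y₂ * F i s y₁ y₂) y₁ y₂ =
        2 * (F i s y₁ y₂ * d1 (F i s) y₁ y₂) := by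
      have := ((hA.hasDerivAt_fst hr y₁ y₂).mul (hA.hasDerivAt_fst hr y₁ y₂)).deriv
      unfold d1 at this ⊢
      refine Eq.trans this ?_
      ring
    rw [kpField_eq]
    simp only [e1, e2]
    have h2 : Real.sqrt 2 ≠ 0 := by positivity
    field_simp
    ring

/-- The correction of the velocity potential. -/
def corrP (α x f y g : ℝ) : ℝ := α / 4 * (x * g - f * y)

/-- The correction of the displacement. -/
def corrQ (α x j f f' y h g g' : ℝ) : ℝ :=
  -(1 / Real.sqrt 2) * (j - h) - α / 2 * ((f + g) * (f + g)) -
    α / 4 * (x * g' - 2 * (f * g) + f' * y)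

variable {F X K J J' G Y L H H' : ι → ℝ → ℝ → ℝ → ℝ}

/-- The displacements of the two frames are made independent parameters of the family. Bounds are
thus uniform in them before they are set to -mt and mt. -/
theorem UA.shift_left {κ : Type*} {E : κ → ℝ → ℝ → ℝ} (hE : UA E) :
    UA fun (p : κ × ℝ × ℝ) y₁ y₂ => E p.1 (y₁ + p.2.1) y₂ :=
  (hE.comp Prod.fst).shift fun p : κ × ℝ × ℝ => p.2.1

theorem UA.shift_right {κ : Type*} {E : κ → ℝ → ℝ → ℝ} (hE : UA E) :
    UA fun (p : κ × ℝ × ℝ) y₁ y₂ => E p.1 (y₁ + p.2.2) y₂ :=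
  (hE.comp Prod.fst).shift fun p : κ × ℝ × ℝ => p.2.2

theorem Wave.ua_corrP (hx : Wave α T 1 F X K J J') (hy : Wave α T (-1) G Y L H H') :
    UA fun (p : (ι × Icc (-T) T) × ℝ × ℝ) y₁ y₂ =>
      corrP α (X p.1.1 p.1.2 (y₁ + p.2.1) y₂) (F p.1.1 p.1.2 (y₁ + p.2.1) y₂)
        (Y p.1.1 p.1.2 (y₁ + p.2.2) y₂) (G p.1.1 p.1.2 (y₁ + p.2.2) y₂) := by
  exact (((UA.shift_left hx.utX.ana).mul (UA.shift_right hy.utF.ana)).sub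
    ((UA.shift_left hx.utF.ana).mul (UA.shift_right hy.utX.ana))).const_mul (α / 4)

/-- The time derivative of `corrP` in a moving frame, up to the slow variable. -/
def corrPSlow (α x j f k y h g l : ℝ) : ℝ := α / 4 * (j * g + x * l - (k * y + f * h))

/-- The part of the time derivative of `corrQ` that comes from the slow variable. -/
def corrQSlow (α x j j' f f' k k' y h h' g g' l l' : ℝ) : ℝ :=
  -(1 / Real.sqrt 2) * (j' - h') - α / 2 * (2 * ((f + g) * (k + l))) -
    α / 4 * (j * g' + x * l' - 2 * (k * g + f * l) + (k' * y + f' * h))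

theorem Wave.ua_corrPSlow (hx : Wave α T 1 F X K J J') (hy : Wave α T (-1) G Y L H H') :
    UA fun (p : (ι × Icc (-T) T) × ℝ × ℝ) y₁ y₂ =>
      corrPSlow α (X p.1.1 p.1.2 (y₁ + p.2.1) y₂) (J p.1.1 p.1.2 (y₁ + p.2.1) y₂)
        (F p.1.1 p.1.2 (y₁ + p.2.1) y₂) (K p.1.1 p.1.2 (y₁ + p.2.1) y₂)
        (Y p.1.1 p.1.2 (y₁ + p.2.2) y₂) (H p.1.1 p.1.2 (y₁ + p.2.2) y₂)
        (G p.1.1 p.1.2 (y₁ + p.2.2) y₂) (L p.1.1 p.1.2 (y₁ + p.2.2) y₂) := by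
  exact ((((UA.shift_left hx.utX.ana').mul (UA.shift_right hy.utF.ana)).add ((UA.shift_left hx.utX.ana).mul (UA.shift_right hy.utF.ana'))).sub
    (((UA.shift_left hx.utF.ana').mul (UA.shift_right hy.utX.ana)).add
      ((UA.shift_left hx.utF.ana).mul (UA.shift_right hy.utX.ana')))).const_mul (α / 4)

theorem Wave.ua_corrQ (hx : Wave α T 1 F X K J J') (hy : Wave α T (-1) G Y L H H') :
    UA fun (p : (ι × Icc (-T) T) × ℝ × ℝ) y₁ y₂ =>
      corrQ α (X p.1.1 p.1.2 (y₁ + p.2.1) y₂) (J p.1.1 p.1.2 (y₁ + p.2.1) y₂)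
        (F p.1.1 p.1.2 (y₁ + p.2.1) y₂) (d1 (F p.1.1 p.1.2) (y₁ + p.2.1) y₂)
        (Y p.1.1 p.1.2 (y₁ + p.2.2) y₂) (H p.1.1 p.1.2 (y₁ + p.2.2) y₂)
        (G p.1.1 p.1.2 (y₁ + p.2.2) y₂) (d1 (G p.1.1 p.1.2) (y₁ + p.2.2) y₂) := by
  have hfg := (UA.shift_left hx.utF.ana).add (UA.shift_right hy.utF.ana)
  exact ((((UA.shift_left hx.utX.ana').sub (UA.shift_right hy.utX.ana')).const_mul _).sub
    ((hfg.mul hfg).const_mul _)).sub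
    ((((UA.shift_left hx.utX.ana).mul (UA.shift_right hy.utF.d1.ana)).sub
      (((UA.shift_left hx.utF.ana).mul (UA.shift_right hy.utF.ana)).const_mul 2)).add
      ((UA.shift_left hx.utF.d1.ana).mul (UA.shift_right hy.utX.ana)) |>.const_mul (α / 4))

theorem Wave.ua_corrQSlow (hx : Wave α T 1 F X K J J') (hy : Wave α T (-1) G Y L H H') :
    UA fun (p : (ι × Icc (-T) T) × ℝ × ℝ) y₁ y₂ =>
      corrQSlow α (X p.1.1 p.1.2 (y₁ + p.2.1) y₂) (J p.1.1 p.1.2 (y₁ + p.2.1) y₂)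
        (J' p.1.1 p.1.2 (y₁ + p.2.1) y₂)
        (F p.1.1 p.1.2 (y₁ + p.2.1) y₂) (d1 (F p.1.1 p.1.2) (y₁ + p.2.1) y₂)
        (K p.1.1 p.1.2 (y₁ + p.2.1) y₂) (d1 (K p.1.1 p.1.2) (y₁ + p.2.1) y₂)
        (Y p.1.1 p.1.2 (y₁ + p.2.2) y₂) (H p.1.1 p.1.2 (y₁ + p.2.2) y₂)
        (H' p.1.1 p.1.2 (y₁ + p.2.2) y₂)
        (G p.1.1 p.1.2 (y₁ + p.2.2) y₂) (d1 (G p.1.1 p.1.2) (y₁ + p.2.2) y₂)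
        (L p.1.1 p.1.2 (y₁ + p.2.2) y₂) (d1 (L p.1.1 p.1.2) (y₁ + p.2.2) y₂) := by
  have hfg := (UA.shift_left hx.utF.ana).add (UA.shift_right hy.utF.ana)
  have hkl := (UA.shift_left hx.utF.ana').add (UA.shift_right hy.utF.ana')
  exact ((((UA.shift_left hx.utJ.ana').sub (UA.shift_right hy.utJ.ana')).const_mul _).sub
    (((hfg.mul hkl).const_mul 2).const_mul _)).sub
    (((((UA.shift_left hx.utX.ana').mul (UA.shift_right hy.utF.d1.ana)).add
      ((UA.shift_left hx.utX.ana).mul (UA.shift_right hy.utF.d1.ana'))).sub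
      ((((UA.shift_left hx.utF.ana').mul (UA.shift_right hy.utF.ana)).add
        ((UA.shift_left hx.utF.ana).mul (UA.shift_right hy.utF.ana'))).const_mul 2)).add
      (((UA.shift_left hx.utF.d1.ana').mul (UA.shift_right hy.utX.ana)).add
        ((UA.shift_left hx.utF.d1.ana).mul (UA.shift_right hy.utX.ana'))) |>.const_mul (α / 4))

/-- The remainder in the second lattice equation. -/
def remP (α β m b a q : ℝ) : ℝ :=
  b + α * (2 * (a * q) + m ^ 2 * (q * q)) +
    β * ((a + m ^ 2 * q) * ((a + m ^ 2 * q) * (a + m ^ 2 * q)))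

theorem UA.remP {κ : Type*} {B A Q : κ → ℝ → ℝ → ℝ} (hB : UA B) (hA : UA A) (hQ : UA Q) (α β : ℝ) :
    UA fun (p : κ × Icc (0 : ℝ) 1) y₁ y₂ =>
      remP α β p.2 (B p.1 y₁ y₂) (A p.1 y₁ y₂) (Q p.1 y₁ y₂) := by
  have hm : ∀ p : κ × Icc (0 : ℝ) 1, |(p.2 : ℝ) ^ 2| ≤ 1 := by
    intro p
    rw [abs_of_nonneg (sq_nonneg _)]
    exact pow_le_one₀ p.2.2.1 p.2.2.2
  have hB' : UA fun p : κ × Icc (0 : ℝ) 1 => B p.1 := hB.comp Prod.fst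
  have hA' : UA fun p : κ × Icc (0 : ℝ) 1 => A p.1 := hA.comp Prod.fst
  have hQ' : UA fun p : κ × Icc (0 : ℝ) 1 => Q p.1 := hQ.comp Prod.fst
  have h1 := hA'.add (hQ'.smul hm)
  exact (hB'.add ((((hA'.mul hQ').const_mul 2).add ((hQ'.mul hQ').smul hm)).const_mul α)).add
    ((h1.mul (h1.mul h1)).const_mul β)

end

/-! ### Consistency: residuals of the corrected ansatz -/

/-- The restoring force `V'(x) = x + α x² + β x³`. -/
def force (α β x : ℝ) : ℝ := x + α * x ^ 2 + β * x ^ 3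

/-- `(Qt, Pt)` is an approximate lattice solution for `|t| ≤ T`, with time derivative `(dQ, dP)`,
close to `(Qa, Pa)`. -/
structure ApproxSol (N₁ N₂ : ℕ) (α β T C : ℝ) (Qa Pa Qt Pt dQ dP : ℝ → ℤ × ℤ → ℝ) : Prop where
  periodic_Q : ∀ t ∈ Icc (-T) T, IsLatticePeriodic N₁ N₂ (Qt t)
  periodic_P : ∀ t ∈ Icc (-T) T, IsLatticePeriodic N₁ N₂ (Pt t)
  deriv_Q : ∀ t ∈ Icc (-T) T, ∀ j, HasDerivWithinAt (fun r => Qt r j) (dQ t j) (Icc (-T) T) t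
  deriv_P : ∀ t ∈ Icc (-T) T, ∀ j, HasDerivWithinAt (fun r => Pt r j) (dP t j) (Icc (-T) T) t
  abs_Q : ∀ t ∈ Icc (-T) T, ∀ j, |Qt t j| ≤ C * mesh N₁ ^ 2
  abs_dQ : ∀ t ∈ Icc (-T) T, ∀ j, |dQ t j| ≤ C * mesh N₁ ^ 3
  res_Q : ∀ t ∈ Icc (-T) T, ∀ j, |dQ t j + laplacian (Pt t) j| ≤ C * mesh N₁ ^ 7
  res_P : ∀ t ∈ Icc (-T) T, ∀ j, |dP t j + force α β (Qt t j)| ≤ C * mesh N₁ ^ 6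
  res_P_fst : ∀ t ∈ Icc (-T) T, ∀ j : ℤ × ℤ,
    |(dP t (j.1 + 1, j.2) + force α β (Qt t (j.1 + 1, j.2))) - (dP t j + force α β (Qt t j))| ≤
      C * mesh N₁ ^ 7
  res_P_snd : ∀ t ∈ Icc (-T) T, ∀ j : ℤ × ℤ,
    |(dP t (j.1, j.2 + 1) + force α β (Qt t (j.1, j.2 + 1))) - (dP t j + force α β (Qt t j))| ≤
      C * mesh N₁ ^ 7
  diff_Q : ∀ t ∈ Icc (-T) T, ∀ j, |Qt t j - Qa t j| ≤ C * mesh N₁ ^ 4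
  diff_P : ∀ t ∈ Icc (-T) T, ∀ j, |Pt t j - Pa t j| ≤ C * mesh N₁ ^ 3
  diff_P_fst : ∀ t ∈ Icc (-T) T, ∀ j : ℤ × ℤ,
    |(Pt t (j.1 + 1, j.2) - Pa t (j.1 + 1, j.2)) - (Pt t j - Pa t j)| ≤ C * mesh N₁ ^ 4
  diff_P_snd : ∀ t ∈ Icc (-T) T, ∀ j : ℤ × ℤ,
    |(Pt t (j.1, j.2 + 1) - Pa t (j.1, j.2 + 1)) - (Pt t j - Pa t j)| ≤ C * mesh N₁ ^ 4

theorem mesh_pos (N : ℕ) : 0 < mesh N := by unfold mesh; positivity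

theorem mesh_mul (N : ℕ) : mesh N * (2 * (N : ℝ) + 1) = 2 := by
  unfold mesh
  have : 2 * (N : ℝ) + 1 ≠ 0 := by positivity
  field_simp

theorem hasDerivWithinAt_corrP {α : ℝ} {x f y g : ℝ → ℝ} {x' f' y' g' : ℝ} {S : Set ℝ} {t : ℝ}
    (hx : HasDerivWithinAt x x' S t) (hf : HasDerivWithinAt f f' S t)
    (hy : HasDerivWithinAt y y' S t) (hg : HasDerivWithinAt g g' S t) :
    HasDerivWithinAt (fun t => corrP α (x t) (f t) (y t) (g t))
      (corrPSlow α (x t) x' (f t) f' (y t) y' (g t) g') S t :=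
  (((hx.mul hg).sub (hf.mul hy)).const_mul (α / 4)).congr_deriv (by unfold corrPSlow; ring)

theorem hasDerivWithinAt_corrQ {α : ℝ} {x j f d y h g e : ℝ → ℝ} {x' j' f' d' y' h' g' e' : ℝ}
    {S : Set ℝ} {t : ℝ}
    (hx : HasDerivWithinAt x x' S t) (hj : HasDerivWithinAt j j' S t)
    (hf : HasDerivWithinAt f f' S t) (hd : HasDerivWithinAt d d' S t)
    (hy : HasDerivWithinAt y y' S t) (hh : HasDerivWithinAt h h' S t)
    (hg : HasDerivWithinAt g g' S t) (he : HasDerivWithinAt e e' S t) :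
    HasDerivWithinAt (fun t => corrQ α (x t) (j t) (f t) (d t) (y t) (h t) (g t) (e t))
      (corrQSlow α (x t) x' j' (f t) (d t) f' d' (y t) y' h' (g t) (e t) g' e') S t :=
  ((((hj.sub hh).const_mul (-(1 / Real.sqrt 2))).sub
    (((hf.add hg).mul (hf.add hg)).const_mul (α / 2))).sub
    ((((hx.mul he).sub ((hf.mul hg).const_mul 2)).add (hd.mul hy)).const_mul (α / 4))).congr_deriv
    (by unfold corrQSlow; simp only [Pi.add_apply]; ring)

/-- Here the KP equations and both correctors are tested. At order m³ the fast derivative of f + g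
cancels the leading part of the Laplacian. At order m⁵ the term `j - h` of `corrQ` contributes a
second copy of k + l, so that 2k and 2l meet f4/12 + xyy and g4/12 + yyy with opposite signs; this
and the square in `corrQ` explain the coefficients 1/24, 1/2 and α/√2 of the field. The square also
produces α(f2 g - f g2), cancelled by the fast derivative of the last part of `corrQ` together with
∂₁² of `corrP`. The right side collects the Taylor remainders, the mismatch n² - m⁴ and the slow
derivatives. -/
theorem displacement_residual_identity {m n r α x j j' f f2 f3 f4 k k2 y h h' g g2 g3 g4 l l2 xyy yyy byy
    e1x e2x e1y e2y e1b e2b : ℝ} (hr : r = 1 / Real.sqrt 2)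
    (hk : k = 1 * (-(1 / 24) * f4 - 1 / 2 * xyy - α / Real.sqrt 2 * (f * f2)))
    (hl : l = -1 * (-(1 / 24) * g4 - 1 / 2 * yyy - α / Real.sqrt 2 * (g * g2))) :
    m ^ 2 * (r * ((m ^ 3 * k + (-m) * f2) + (m ^ 3 * l + m * g2)) +
      m ^ 2 * corrQSlow α x (m ^ 3 * j + (-m) * f) (m ^ 3 * j' + (-m) * k) f f2
        (m ^ 3 * k + (-m) * f2) (m ^ 3 * k2 + (-m) * f3)
        y (m ^ 3 * h + m * g) (m ^ 3 * h' + m * l) g g2 (m ^ 3 * l + m * g2) (m ^ 3 * l2 + m * g3)) +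
      m * (r * ((m ^ 2 * f2 + m ^ 4 / 12 * f4 + e1x + n ^ 2 * xyy + e2x) -
          (m ^ 2 * g2 + m ^ 4 / 12 * g4 + e1y + n ^ 2 * yyy + e2y)) +
        m ^ 2 * (m ^ 2 * (α / 4 * (x * g3 + f * g2 - f2 * g - f3 * y)) + e1b + n ^ 2 * byy + e2b)) =
    m * (r * (e1x + e2x - e1y - e2y)) + m * (r * ((n ^ 2 - m ^ 4) * (xyy - yyy))) +
      m ^ 3 * (e1b + n ^ 2 * byy + e2b) +
      m ^ 7 * corrQSlow α x j j' f f2 k k2 y h h' g g2 l l2 := by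
  have h2 : r ^ 2 = 1 / 2 := by
    rw [hr, div_pow, Real.sq_sqrt (by norm_num)]
    norm_num
  rw [show α / Real.sqrt 2 = α * r by rw [hr]; ring] at hk hl
  unfold corrQSlow
  rw [← hr, hk, hl]
  linear_combination (-2 * m ^ 5 * α * (f * f2 - g * g2)) * h2

/-- The first terms of `corrQ` cancel the slow derivative of the leading potential and the square of
the leading displacement; its last term cancels the fast derivative of `corrP`. All orders below m⁶
disappear, and `remP` is what remains. -/
theorem potential_residual_identity {m r α β x j f f2 k y h g g2 l : ℝ} (hr : r = 1 / Real.sqrt 2) :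
    m * (r * ((m ^ 3 * j + (-m) * f) - (m ^ 3 * h + m * g)) +
      m ^ 2 * corrPSlow α x (m ^ 3 * j + (-m) * f) f (m ^ 3 * k + (-m) * f2) y (m ^ 3 * h + m * g)
        g (m ^ 3 * l + m * g2)) +
      force α β (m ^ 2 * (r * (f + g) + m ^ 2 * corrQ α x j f f2 y h g g2)) =
    m ^ 6 * remP α β m (corrPSlow α x j f k y h g l) (r * (f + g))
      (corrQ α x j f f2 y h g g2) := by
  have h2 : r ^ 2 = 1 / 2 := by
    rw [hr, div_pow, Real.sq_sqrt (by norm_num)]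
    norm_num
  unfold force remP corrPSlow corrQ
  rw [← hr]
  linear_combination (m ^ 4 * α * (f + g) ^ 2) * h2

/-- In ∂₁(xg - fy) the two products fg cancel, because x and y are primitives of f and g. -/
theorem d1_d1_corrP {α c₁ c₂ : ℝ} {X F Y G : ℝ → ℝ → ℝ} {r M : ℝ} (hr : 0 < r)
    (hX : Ana r M X) (hF : Ana r M F) (hY : Ana r M Y) (hG : Ana r M G)
    (hXF : d1 X = F) (hYG : d1 Y = G) (y₁ y₂ : ℝ) :
    d1 (d1 fun y₁ y₂ => corrP α (X (y₁ + c₁) y₂) (F (y₁ + c₁) y₂) (Y (y₁ + c₂) y₂)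
      (G (y₁ + c₂) y₂)) y₁ y₂ =
    α / 4 * (X (y₁ + c₁) y₂ * d1 (d1 G) (y₁ + c₂) y₂ + F (y₁ + c₁) y₂ * d1 G (y₁ + c₂) y₂ -
      d1 F (y₁ + c₁) y₂ * G (y₁ + c₂) y₂ - d1 (d1 F) (y₁ + c₁) y₂ * Y (y₁ + c₂) y₂) := by
  have sh : ∀ {E : ℝ → ℝ → ℝ} {r M : ℝ} (_ : 0 < r) (_ : Ana r M E) (c y₁ y₂ : ℝ),
      HasDerivAt (fun y => E (y + c) y₂) (d1 E (y₁ + c) y₂) y₁ := fun hr hE c y₁ y₂ =>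
    (hE.hasDerivAt_fst hr (y₁ + c) y₂).comp_add_const y₁ c
  have e : (d1 fun y₁ y₂ => corrP α (X (y₁ + c₁) y₂) (F (y₁ + c₁) y₂) (Y (y₁ + c₂) y₂)
      (G (y₁ + c₂) y₂)) = fun y₁ y₂ => α / 4 * (X (y₁ + c₁) y₂ * d1 G (y₁ + c₂) y₂ -
        d1 F (y₁ + c₁) y₂ * Y (y₁ + c₂) y₂) := by
    funext y₁ y₂
    have h1 := (((sh hr hX c₁ y₁ y₂).mul (sh hr hG c₂ y₁ y₂)).sub
      ((sh hr hF c₁ y₁ y₂).mul (sh hr hY c₂ y₁ y₂))).const_mul (α / 4)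
    have h2 := h1.deriv
    rw [hXF, hYG] at h2
    refine Eq.trans h2 ?_
    ring
  rw [e]
  have hr' := half_pos hr
  have h1 := (((sh hr hX c₁ y₁ y₂).mul (sh hr' (hG.d1 hr) c₂ y₁ y₂)).sub
      ((sh hr' (hF.d1 hr) c₁ y₁ y₂).mul (sh hr hY c₂ y₁ y₂))).const_mul (α / 4)
  have h2 := h1.deriv
  rw [hXF, hYG] at h2
  refine Eq.trans h2 ?_
  ring

/-- The mesh itself becomes a parameter in [0, 1], so the corrected profiles form one family with
constants independent of the lattice. -/
theorem UA.add_sq_smul {κ : Type*} {A B : κ → ℝ → ℝ → ℝ} (hA : UA A) (hB : UA B) :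
    UA fun (p : κ × Icc (0 : ℝ) 1) y₁ y₂ => A p.1 y₁ y₂ + (p.2 : ℝ) ^ 2 * B p.1 y₁ y₂ := by
  have hm : ∀ p : κ × Icc (0 : ℝ) 1, |(p.2 : ℝ) ^ 2| ≤ 1 := by
    intro p
    rw [abs_of_nonneg (sq_nonneg _)]
    exact pow_le_one₀ p.2.2.1 p.2.2.2
  exact UA.add (hA.comp Prod.fst) (UA.smul (hB.comp Prod.fst) hm)

theorem UA.abs_symm_diff_le {κ : Type*} {F : κ → ℝ → ℝ → ℝ} (hF : UA F) :
    ∃ C : ℝ, 0 < C ∧ ∀ i y₁ y₂ h k,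
      |(F i (y₁ + h) y₂ + F i (y₁ - h) y₂ - 2 * F i y₁ y₂) +
        (F i y₁ (y₂ + k) + F i y₁ (y₂ - k) - 2 * F i y₁ y₂)| ≤ C * (|h| ^ 2 + |k| ^ 2) := by
  obtain ⟨C, hC, hb⟩ := hF.d1.d1.bound
  obtain ⟨C', hC', hb'⟩ := hF.d2.d2.bound
  refine ⟨2 * (C + C'), by linarith, fun i y₁ y₂ h k => ?_⟩
  have h1 := ETL.abs_symm_diff_le (g := fun x => F i x y₂) hC.le
    (fun t => hF.hasDerivAt_fst i t y₂) (fun t => hF.d1.hasDerivAt_fst i t y₂)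
    (fun t => hb i t y₂) y₁ h
  have h2 := ETL.abs_symm_diff_le (g := fun x => F i y₁ x) hC'.le
    (fun t => hF.hasDerivAt_snd i y₁ t) (fun t => hF.d2.hasDerivAt_snd i y₁ t)
    (fun t => hb' i y₁ t) y₂ k
  refine (abs_add_le _ _).trans ((add_le_add h1 h2).trans ?_)
  nlinarith [mul_nonneg hC.le (sq_nonneg |k|), mul_nonneg hC'.le (sq_nonneg |h|)]

theorem laplacian_sample (g : ℝ → ℝ → ℝ) (m n : ℝ) (j : ℤ × ℤ) :
    laplacian (fun j => g (m * j.1) (n * j.2)) j =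
      (g (m * j.1 + m) (n * j.2) + g (m * j.1 - m) (n * j.2) - 2 * g (m * j.1) (n * j.2)) +
      (g (m * j.1) (n * j.2 + n) + g (m * j.1) (n * j.2 - n) - 2 * g (m * j.1) (n * j.2)) := by
  unfold laplacian
  simp only [Int.cast_add, Int.cast_sub, Int.cast_one, mul_add, mul_sub, mul_one]
  ring

/-- The corrected displacement, divided by `m²`. -/
def dispPol (α m : ℝ) (X J F Y H G : ℝ → ℝ → ℝ) (c₁ c₂ y₁ y₂ : ℝ) : ℝ :=
  1 / Real.sqrt 2 * (F (y₁ + c₁) y₂ + G (y₁ + c₂) y₂) +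
    m ^ 2 * corrQ α (X (y₁ + c₁) y₂) (J (y₁ + c₁) y₂) (F (y₁ + c₁) y₂) (d1 F (y₁ + c₁) y₂)
      (Y (y₁ + c₂) y₂) (H (y₁ + c₂) y₂) (G (y₁ + c₂) y₂) (d1 G (y₁ + c₂) y₂)

/-- The corrected potential, divided by `m`. -/
def potPol (α m : ℝ) (X F Y G : ℝ → ℝ → ℝ) (c₁ c₂ y₁ y₂ : ℝ) : ℝ :=
  1 / Real.sqrt 2 * (X (y₁ + c₁) y₂ - Y (y₁ + c₂) y₂) +
    m ^ 2 * corrP α (X (y₁ + c₁) y₂) (F (y₁ + c₁) y₂) (Y (y₁ + c₂) y₂) (G (y₁ + c₂) y₂)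

/-- The time derivative of the corrected displacement. -/
def dispDeriv (α m : ℝ) (X J J' F K Y H H' G L : ℝ → ℝ → ℝ) (c₁ c₂ y₁ y₂ : ℝ) : ℝ :=
  m ^ 2 * (1 / Real.sqrt 2 * ((m ^ 3 * K (y₁ + c₁) y₂ + (-m) * d1 F (y₁ + c₁) y₂) +
      (m ^ 3 * L (y₁ + c₂) y₂ + m * d1 G (y₁ + c₂) y₂)) +
    m ^ 2 * corrQSlow α (X (y₁ + c₁) y₂) (m ^ 3 * J (y₁ + c₁) y₂ + (-m) * F (y₁ + c₁) y₂)
      (m ^ 3 * J' (y₁ + c₁) y₂ + (-m) * K (y₁ + c₁) y₂) (F (y₁ + c₁) y₂) (d1 F (y₁ + c₁) y₂)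
      (m ^ 3 * K (y₁ + c₁) y₂ + (-m) * d1 F (y₁ + c₁) y₂)
      (m ^ 3 * d1 K (y₁ + c₁) y₂ + (-m) * d1 (d1 F) (y₁ + c₁) y₂)
      (Y (y₁ + c₂) y₂) (m ^ 3 * H (y₁ + c₂) y₂ + m * G (y₁ + c₂) y₂)
      (m ^ 3 * H' (y₁ + c₂) y₂ + m * L (y₁ + c₂) y₂) (G (y₁ + c₂) y₂) (d1 G (y₁ + c₂) y₂)
      (m ^ 3 * L (y₁ + c₂) y₂ + m * d1 G (y₁ + c₂) y₂)
      (m ^ 3 * d1 L (y₁ + c₂) y₂ + m * d1 (d1 G) (y₁ + c₂) y₂))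

/-- The time derivative of the corrected potential. -/
def potDeriv (α m : ℝ) (X J F K Y H G L : ℝ → ℝ → ℝ) (c₁ c₂ y₁ y₂ : ℝ) : ℝ :=
  m * (1 / Real.sqrt 2 * ((m ^ 3 * J (y₁ + c₁) y₂ + (-m) * F (y₁ + c₁) y₂) -
      (m ^ 3 * H (y₁ + c₂) y₂ + m * G (y₁ + c₂) y₂)) +
    m ^ 2 * corrPSlow α (X (y₁ + c₁) y₂) (m ^ 3 * J (y₁ + c₁) y₂ + (-m) * F (y₁ + c₁) y₂)
      (F (y₁ + c₁) y₂) (m ^ 3 * K (y₁ + c₁) y₂ + (-m) * d1 F (y₁ + c₁) y₂)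
      (Y (y₁ + c₂) y₂) (m ^ 3 * H (y₁ + c₂) y₂ + m * G (y₁ + c₂) y₂)
      (G (y₁ + c₂) y₂) (m ^ 3 * L (y₁ + c₂) y₂ + m * d1 G (y₁ + c₂) y₂))

theorem abs_mul_le_mul_abs {a b A B : ℝ} (ha : |a| ≤ A) (hb : |b| ≤ B) : |a * b| ≤ A * B := by
  rw [abs_mul]
  exact mul_le_mul ha hb (abs_nonneg b) ((abs_nonneg a).trans ha)

theorem abs_inv_sqrt_two_le : |1 / Real.sqrt 2| ≤ 1 := by
  rw [abs_of_nonneg (by positivity), div_le_one (by positivity)]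
  exact Real.one_le_sqrt.2 (by norm_num)

/-- Every group of remainders is at least of order m⁷: |n| ≤ 3m² turns |n|⁴ into 81m⁸, and n² - m⁴ =
(n - m²)(n + m²) is at most 8m⁶. The last bound is where the closeness of σ to 2 is needed. -/
theorem displacement_residual_bound {m n r xyy yyy byy e1x e2x e1y e2y e1b e2b q
    c1 c2 c3 c4 c5 c6 c7 c8 c9 c10 : ℝ} (hm : 0 < m) (hm1 : m ≤ 1) (hn : |n| ≤ 3 * m ^ 2)
    (hnm : |n - m ^ 2| ≤ 2 * m ^ 4) (hr : |r| ≤ 1) (h1 : |e1x| ≤ c1 * m ^ 6)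
    (h2 : |e2x| ≤ c2 * |n| ^ 4) (h3 : |e1y| ≤ c3 * m ^ 6) (h4 : |e2y| ≤ c4 * |n| ^ 4)
    (h5 : |xyy| ≤ c5) (h6 : |yyy| ≤ c6) (h7 : |e1b| ≤ c7 * m ^ 4) (h8 : |byy| ≤ c8)
    (h9 : |e2b| ≤ c9 * |n| ^ 4) (h10 : |q| ≤ c10) (hc2 : 0 ≤ c2) (hc4 : 0 ≤ c4) (hc9 : 0 ≤ c9) :
    |m * (r * (e1x + e2x - e1y - e2y)) + m * (r * ((n ^ 2 - m ^ 4) * (xyy - yyy))) +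
      m ^ 3 * (e1b + n ^ 2 * byy + e2b) + m ^ 7 * q| ≤
    (c1 + 81 * c2 + c3 + 81 * c4 + 8 * (c5 + c6) + c7 + 9 * c8 + 81 * c9 + c10) * m ^ 7 := by
  have hn4 : |n| ^ 4 ≤ 81 * m ^ 8 := by
    calc |n| ^ 4 ≤ (3 * m ^ 2) ^ 4 := pow_le_pow_left₀ (abs_nonneg _) hn 4
      _ = _ := by ring
  have hm86 : m ^ 8 ≤ m ^ 6 := pow_le_pow_of_le_one hm.le hm1 (by norm_num)
  have hm84 : m ^ 8 ≤ m ^ 4 := pow_le_pow_of_le_one hm.le hm1 (by norm_num)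
  have hn46 : |n| ^ 4 ≤ 81 * m ^ 6 := by linarith
  have hn44 : |n| ^ 4 ≤ 81 * m ^ 4 := by linarith
  have h2' : |e2x| ≤ 81 * c2 * m ^ 6 := h2.trans (by nlinarith)
  have h4' : |e2y| ≤ 81 * c4 * m ^ 6 := h4.trans (by nlinarith)
  have h9' : |e2b| ≤ 81 * c9 * m ^ 4 := h9.trans (by nlinarith)
  have hn2 : |n ^ 2| ≤ 9 * m ^ 4 := by
    rw [abs_pow]
    calc |n| ^ 2 ≤ (3 * m ^ 2) ^ 2 := pow_le_pow_left₀ (abs_nonneg _) hn 2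
      _ = _ := by ring
  have hnm2 : |n ^ 2 - m ^ 4| ≤ 8 * m ^ 6 := by
    have e : n ^ 2 - m ^ 4 = (n - m ^ 2) * (n + m ^ 2) := by ring
    have : |n + m ^ 2| ≤ 4 * m ^ 2 := by
      refine (abs_add_le _ _).trans ?_
      rw [abs_of_pos (pow_pos hm 2)]
      linarith
    rw [e]
    refine (abs_mul_le_mul_abs hnm this).trans (le_of_eq ?_)
    ring
  have a1 : |e1x + e2x - e1y - e2y| ≤ (c1 + 81 * c2 + c3 + 81 * c4) * m ^ 6 := by
    rw [abs_le] at *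
    constructor <;> linarith [h1.1, h1.2, h2'.1, h2'.2, h3.1, h3.2, h4'.1, h4'.2]
  have a2 : |xyy - yyy| ≤ c5 + c6 := (abs_sub _ _).trans (add_le_add h5 h6)
  have a3 : |e1b + n ^ 2 * byy + e2b| ≤ (c7 + 9 * c8 + 81 * c9) * m ^ 4 := by
    have a := abs_mul_le_mul_abs hn2 h8
    rw [abs_le] at h7 h9' a ⊢
    constructor <;> linarith [h7.1, h7.2, h9'.1, h9'.2, a.1, a.2]
  have hma : |m| ≤ m := (abs_of_pos hm).le
  have hm3 : |m ^ 3| ≤ m ^ 3 := (abs_of_pos (pow_pos hm 3)).le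
  have hm7 : |m ^ 7| ≤ m ^ 7 := (abs_of_pos (pow_pos hm 7)).le
  have b1 := abs_mul_le_mul_abs hma (abs_mul_le_mul_abs hr a1)
  have b2 := abs_mul_le_mul_abs hma (abs_mul_le_mul_abs hr (abs_mul_le_mul_abs hnm2 a2))
  have b3 := abs_mul_le_mul_abs hm3 a3
  have b4 := abs_mul_le_mul_abs hm7 h10
  refine (abs_add_le _ _).trans ((add_le_add ((abs_add_le _ _).trans
    (add_le_add ((abs_add_le _ _).trans (add_le_add b1 b2)) b3)) b4).trans (le_of_eq ?_))
  ring

theorem isLatticePeriodic_sample {N₁ N₂ : ℕ} {g : ℝ → ℝ → ℝ}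
    (h₁ : ∀ y₁ y₂, g (y₁ + 2) y₂ = g y₁ y₂) (h₂ : ∀ y₁ y₂, g y₁ (y₂ + 2) = g y₁ y₂) :
    IsLatticePeriodic N₁ N₂ fun j => g (mesh N₁ * j.1) (mesh N₂ * j.2) := by
  intro j
  constructor
  · have e : mesh N₁ * ((j.1 + (2 * (N₁ : ℤ) + 1) : ℤ) : ℝ) = mesh N₁ * j.1 + 2 := by
      rw [← mesh_mul N₁]
      push_cast
      ring
    simp only [e, h₁]
  · have e : mesh N₂ * ((j.2 + (2 * (N₂ : ℤ) + 1) : ℤ) : ℝ) = mesh N₂ * j.2 + 2 := by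
      rw [← mesh_mul N₂]
      push_cast
      ring
    simp only [e, h₂]

section

variable {ι : Type*} {α T : ℝ} {F X K J J' G Y L H H' : ι → ℝ → ℝ → ℝ → ℝ}

theorem Wave.ua_dispPol (hx : Wave α T 1 F X K J J') (hy : Wave α T (-1) G Y L H H') :
    UA fun (p : ((ι × Icc (-T) T) × ℝ × ℝ) × Icc (0 : ℝ) 1) =>
      dispPol α p.2 (X p.1.1.1 p.1.1.2) (J p.1.1.1 p.1.1.2) (F p.1.1.1 p.1.1.2)
        (Y p.1.1.1 p.1.1.2) (H p.1.1.1 p.1.1.2) (G p.1.1.1 p.1.1.2) p.1.2.1 p.1.2.2 :=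
  UA.add_sq_smul (((UA.shift_left hx.utF.ana).add (UA.shift_right hy.utF.ana)).const_mul
    (1 / Real.sqrt 2)) (hx.ua_corrQ hy)

theorem Wave.ua_potPol (hx : Wave α T 1 F X K J J') (hy : Wave α T (-1) G Y L H H') :
    UA fun (p : ((ι × Icc (-T) T) × ℝ × ℝ) × Icc (0 : ℝ) 1) =>
      potPol α p.2 (X p.1.1.1 p.1.1.2) (F p.1.1.1 p.1.1.2)
        (Y p.1.1.1 p.1.1.2) (G p.1.1.1 p.1.1.2) p.1.2.1 p.1.2.2 :=
  UA.add_sq_smul (((UA.shift_left hx.utX.ana).sub (UA.shift_right hy.utX.ana)).const_mul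
    (1 / Real.sqrt 2)) (hx.ua_corrP hy)

theorem Wave.hasDerivWithinAt_disp (hx : Wave α T 1 F X K J J') (hy : Wave α T (-1) G Y L H H')
    (i : ι) {m : ℝ} (hm : 0 < m) {t : ℝ} (ht : t ∈ Icc (-(T / m ^ 3)) (T / m ^ 3)) (y₁ y₂ : ℝ) :
    HasDerivWithinAt (fun t => m ^ 2 * dispPol α m (X i (m ^ 3 * t)) (J i (m ^ 3 * t))
      (F i (m ^ 3 * t)) (Y i (m ^ 3 * t)) (H i (m ^ 3 * t)) (G i (m ^ 3 * t))
      (-m * t) (m * t) y₁ y₂)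
      (dispDeriv α m (X i (m ^ 3 * t)) (J i (m ^ 3 * t)) (J' i (m ^ 3 * t)) (F i (m ^ 3 * t))
        (K i (m ^ 3 * t)) (Y i (m ^ 3 * t)) (H i (m ^ 3 * t)) (H' i (m ^ 3 * t)) (G i (m ^ 3 * t))
        (L i (m ^ 3 * t)) (-m * t) (m * t) y₁ y₂) (Icc (-(T / m ^ 3)) (T / m ^ 3)) t := by
  have hm3 := pow_pos hm 3
  have hs : m ^ 3 * t ∈ Icc (-T) T := by
    rw [← neg_div, mem_Icc, div_le_iff₀ hm3, le_div_iff₀ hm3] at ht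
    constructor <;> nlinarith [ht.1, ht.2]
  have dX := hx.utX.hasDerivWithinAt_moving i hm3 (-m) ht y₁ y₂
  have dJ := hx.utJ.hasDerivWithinAt_moving i hm3 (-m) ht y₁ y₂
  have dF := hx.utF.hasDerivWithinAt_moving i hm3 (-m) ht y₁ y₂
  have dF1 := hx.utF.d1.hasDerivWithinAt_moving i hm3 (-m) ht y₁ y₂
  have dY := hy.utX.hasDerivWithinAt_moving i hm3 m ht y₁ y₂
  have dH := hy.utJ.hasDerivWithinAt_moving i hm3 m ht y₁ y₂
  have dG := hy.utF.hasDerivWithinAt_moving i hm3 m ht y₁ y₂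
  have dG1 := hy.utF.d1.hasDerivWithinAt_moving i hm3 m ht y₁ y₂
  rw [hx.d1X i _ hs] at dX
  rw [hx.d1J i _ hs] at dJ
  rw [hy.d1X i _ hs] at dY
  rw [hy.d1J i _ hs] at dH
  exact (((dF.add dG).const_mul (1 / Real.sqrt 2)).add
    ((hasDerivWithinAt_corrQ dX dJ dF dF1 dY dH dG dG1).const_mul (m ^ 2))).const_mul (m ^ 2)

theorem Wave.hasDerivWithinAt_pot (hx : Wave α T 1 F X K J J') (hy : Wave α T (-1) G Y L H H')
    (i : ι) {m : ℝ} (hm : 0 < m) {t : ℝ} (ht : t ∈ Icc (-(T / m ^ 3)) (T / m ^ 3)) (y₁ y₂ : ℝ) :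
    HasDerivWithinAt (fun t => m * potPol α m (X i (m ^ 3 * t))
      (F i (m ^ 3 * t)) (Y i (m ^ 3 * t)) (G i (m ^ 3 * t)) (-m * t) (m * t) y₁ y₂)
      (potDeriv α m (X i (m ^ 3 * t)) (J i (m ^ 3 * t)) (F i (m ^ 3 * t))
        (K i (m ^ 3 * t)) (Y i (m ^ 3 * t)) (H i (m ^ 3 * t)) (G i (m ^ 3 * t))
        (L i (m ^ 3 * t)) (-m * t) (m * t) y₁ y₂) (Icc (-(T / m ^ 3)) (T / m ^ 3)) t := by
  have hm3 := pow_pos hm 3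
  have hs : m ^ 3 * t ∈ Icc (-T) T := by
    rw [← neg_div, mem_Icc, div_le_iff₀ hm3, le_div_iff₀ hm3] at ht
    constructor <;> nlinarith [ht.1, ht.2]
  have dX := hx.utX.hasDerivWithinAt_moving i hm3 (-m) ht y₁ y₂
  have dF := hx.utF.hasDerivWithinAt_moving i hm3 (-m) ht y₁ y₂
  have dY := hy.utX.hasDerivWithinAt_moving i hm3 m ht y₁ y₂
  have dG := hy.utF.hasDerivWithinAt_moving i hm3 m ht y₁ y₂
  rw [hx.d1X i _ hs] at dX
  rw [hy.d1X i _ hs] at dY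
  exact (((dX.sub dY).const_mul (1 / Real.sqrt 2)).add
    ((hasDerivWithinAt_corrP dX dF dY dG).const_mul (m ^ 2))).const_mul m

/-- The residual of the corrected approximation in the first lattice equation. -/
theorem Wave.exists_residual_bound (hx : Wave α T 1 F X K J J')
    (hy : Wave α T (-1) G Y L H H') :
    ∃ C : ℝ, 0 < C ∧ ∀ i, ∀ s ∈ Icc (-T) T, ∀ m n : ℝ, 0 < m → m ≤ 1 → |n| ≤ 3 * m ^ 2 →
      |n - m ^ 2| ≤ 2 * m ^ 4 → ∀ c₁ c₂ (j : ℤ × ℤ),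
      |dispDeriv α m (X i s) (J i s) (J' i s) (F i s) (K i s) (Y i s) (H i s) (H' i s) (G i s)
        (L i s) c₁ c₂ (m * j.1) (n * j.2) + laplacian (fun j => m * potPol α m (X i s) (F i s)
          (Y i s) (G i s) c₁ c₂ (m * j.1) (n * j.2)) j| ≤ C * m ^ 7 := by
  obtain ⟨c1, hc1, b1⟩ := hx.utX.ana.symm_diff_fst_six
  obtain ⟨c2, hc2, b2⟩ := hx.utX.ana.symm_diff_snd
  obtain ⟨c3, hc3, b3⟩ := hy.utX.ana.symm_diff_fst_six
  obtain ⟨c4, hc4, b4⟩ := hy.utX.ana.symm_diff_snd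
  obtain ⟨c5, hc5, b5⟩ := hx.utX.ana.d2.d2.bound
  obtain ⟨c6, hc6, b6⟩ := hy.utX.ana.d2.d2.bound
  obtain ⟨c7, hc7, b7⟩ := (hx.ua_corrP hy).symm_diff_fst
  obtain ⟨c8, hc8, b8⟩ := (hx.ua_corrP hy).d2.d2.bound
  obtain ⟨c9, hc9, b9⟩ := (hx.ua_corrP hy).symm_diff_snd
  obtain ⟨c10, hc10, b10⟩ := (hx.ua_corrQSlow hy).bound
  refine ⟨c1 + 81 * c2 + c3 + 81 * c4 + 8 * (c5 + c6) + c7 + 9 * c8 + 81 * c9 + c10,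
    by positivity, ?_⟩
  intro i s hs m n hm hm1 hn hnm c₁ c₂ j
  let p : ι × Icc (-T) T := (i, ⟨s, hs⟩)
  set y₁ : ℝ := m * j.1 with hy₁
  set y₂ : ℝ := n * j.2 with hy₂
  have B1 := b1 p (y₁ + c₁) y₂ m
  have B2 := b2 p (y₁ + c₁) y₂ n
  have B3 := b3 p (y₁ + c₂) y₂ m
  have B4 := b4 p (y₁ + c₂) y₂ n
  have B5 := b5 p (y₁ + c₁) y₂
  have B6 := b6 p (y₁ + c₂) y₂
  have B7 := b7 (p, c₁, c₂) y₁ y₂ m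
  have B8 := b8 (p, c₁, c₂) y₁ y₂
  have B9 := b9 (p, c₁, c₂) y₁ y₂ n
  have B10 := b10 (p, c₁, c₂) y₁ y₂
  obtain ⟨r, M, hr, hXF⟩ := hx.utX.ana.common hx.utF.ana
  obtain ⟨r', M', hr', hYG⟩ := hy.utX.ana.common hy.utF.ana
  have hXF' := hXF p
  have hYG' := hYG p
  have hdd := d1_d1_corrP (α := α) (c₁ := c₁) (c₂ := c₂) (r := min r r') (M := max M M')
    (lt_min hr hr')
    (hXF'.1.mono (min_le_left _ _) (le_max_left _ _))
    (hXF'.2.mono (min_le_left _ _) (le_max_left _ _))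
    (hYG'.1.mono (min_le_right _ _) (le_max_right _ _))
    (hYG'.2.mono (min_le_right _ _) (le_max_right _ _)) (hx.d1X i s hs) (hy.d1X i s hs) y₁ y₂
  simp only [p] at B1 B2 B3 B4 B5 B6 B7 B8 B9 B10 hdd
  rw [hx.d1X i s hs, abs_of_pos hm] at B1
  rw [hy.d1X i s hs, abs_of_pos hm] at B3
  rw [hdd, abs_of_pos hm] at B7
  have key := displacement_residual_bound hm hm1 hn hnm abs_inv_sqrt_two_le B1 B2 B3 B4 B5 B6 B7
    B8 B9 B10 hc2.le hc4.le hc9.le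
  refine Eq.trans_le (congrArg abs ?_) key
  -- The third-order values f3, g3 occur only on the left of the identity, where they cancel, so
  -- they must be supplied by hand.
  rw [← displacement_residual_identity rfl (hx.field i s hs (y₁ + c₁) y₂)
    (hy.field i s hs (y₁ + c₂) y₂) (f3 := d1 (d1 (F i s)) (y₁ + c₁) y₂)
    (g3 := d1 (d1 (G i s)) (y₁ + c₂) y₂)]
  rw [laplacian_sample (fun y₁ y₂ => m * potPol α m (X i s) (F i s) (Y i s) (G i s) c₁ c₂ y₁ y₂)]
  simp only [← hy₁, ← hy₂]
  unfold dispDeriv potPol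
  rw [show y₁ + m + c₁ = y₁ + c₁ + m by ring, show y₁ + m + c₂ = y₁ + c₂ + m by ring,
    show y₁ - m + c₁ = y₁ + c₁ - m by ring, show y₁ - m + c₂ = y₁ + c₂ - m by ring]
  ring

end

theorem approxQ_eq (N₁ N₂ : ℕ) (ξ η : ℝ → ℝ → ℝ → ℝ) (t : ℝ) (j : ℤ × ℤ) :
    approxQ N₁ N₂ ξ η t j = mesh N₁ ^ 2 * (1 / Real.sqrt 2 *
      (ξ (mesh N₁ ^ 3 * t) (mesh N₁ * j.1 + -mesh N₁ * t) (mesh N₂ * j.2) +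
        η (mesh N₁ ^ 3 * t) (mesh N₁ * j.1 + mesh N₁ * t) (mesh N₂ * j.2))) := by
  unfold approxQ
  rw [show mesh N₁ ^ 2 * (mesh N₁ * t) = mesh N₁ ^ 3 * t by ring,
    show mesh N₁ * (j.1 : ℝ) - mesh N₁ * t = mesh N₁ * j.1 + -mesh N₁ * t by ring]
  ring

theorem approxP_eq (N₁ N₂ : ℕ) (ξ η : ℝ → ℝ → ℝ → ℝ) (t : ℝ) (j : ℤ × ℤ) :
    approxP N₁ N₂ ξ η t j = mesh N₁ * (1 / Real.sqrt 2 *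
      (antideriv (ξ (mesh N₁ ^ 3 * t)) (mesh N₁ * j.1 + -mesh N₁ * t) (mesh N₂ * j.2) -
        antideriv (η (mesh N₁ ^ 3 * t)) (mesh N₁ * j.1 + mesh N₁ * t) (mesh N₂ * j.2))) := by
  unfold approxP
  rw [show mesh N₁ ^ 2 * (mesh N₁ * t) = mesh N₁ ^ 3 * t by ring,
    show mesh N₁ * (j.1 : ℝ) - mesh N₁ * t = mesh N₁ * j.1 + -mesh N₁ * t by ring]
  ring

theorem abs_le_add_of_abs_add_le {a b A B : ℝ} (h : |a + b| ≤ A) (hb : |b| ≤ B) : |a| ≤ A + B := by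
  rw [abs_le] at *
  constructor <;> linarith [h.1, h.2, hb.1, hb.2]

theorem pow_mul_le_pow_mul {m c d : ℝ} {a b : ℕ} (hm : 0 < m) (hm1 : m ≤ 1) (hab : b ≤ a)
    (hc : 0 ≤ c) (hcd : c ≤ d) : c * m ^ a ≤ d * m ^ b :=
  mul_le_mul hcd (pow_le_pow_of_le_one hm.le hm1 hab) (pow_nonneg hm.le _) (hc.trans hcd)

theorem UA.periodic {κ : Type*} {F : κ → ℝ → ℝ → ℝ} (hF : UA F) (i : κ) :
    (∀ y₁ y₂, F i (y₁ + 2) y₂ = F i y₁ y₂) ∧ ∀ y₁ y₂, F i y₁ (y₂ + 2) = F i y₁ y₂ := by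
  obtain ⟨r, M, hr, h⟩ := hF
  exact ⟨(h i).periodic_fst, (h i).periodic_snd⟩

section

variable {ι : Type*} {α T : ℝ} {F X K J J' G Y L H H' : ι → ℝ → ℝ → ℝ → ℝ}

set_option maxHeartbeats 1600000 in
/-- The corrected approximate solution of the lattice equations. -/
theorem Wave.exists_approxSol (hx : Wave α T 1 F X K J J') (hy : Wave α T (-1) G Y L H H')
    (hX : ∀ i s, X i s = antideriv (F i s)) (hY : ∀ i s, Y i s = antideriv (G i s)) (β : ℝ) :
    ∃ C : ℝ, 0 < C ∧ ∀ i, ∀ N₁ N₂ : ℕ, mesh N₁ ≤ 1 →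
      |mesh N₂ - mesh N₁ ^ 2| ≤ 2 * mesh N₁ ^ 4 → ∃ Qt Pt dQ dP : ℝ → ℤ × ℤ → ℝ,
        ApproxSol N₁ N₂ α β (T / mesh N₁ ^ 3) C (approxQ N₁ N₂ (F i) (G i))
          (approxP N₁ N₂ (F i) (G i)) Qt Pt dQ dP := by
  obtain ⟨cr, hcr, br⟩ := hx.exists_residual_bound hy
  obtain ⟨cq, hcq, bq⟩ := (hx.ua_dispPol hy).bound
  obtain ⟨cp, hcp, bp⟩ := (hx.ua_potPol hy).abs_symm_diff_le
  have hZ := (hx.ua_corrPSlow hy).remP (((UA.shift_left hx.utF.ana).add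
    (UA.shift_right hy.utF.ana)).const_mul (1 / Real.sqrt 2)) (hx.ua_corrQ hy) α β
  obtain ⟨cz, hcz, bz⟩ := hZ.bound
  obtain ⟨cz1, hcz1, bz1⟩ := hZ.lipschitz_fst
  obtain ⟨cz2, hcz2, bz2⟩ := hZ.lipschitz_snd
  obtain ⟨ca, hca, ba⟩ := (hx.ua_corrQ hy).bound
  obtain ⟨cb, hcb, bb⟩ := (hx.ua_corrP hy).bound
  obtain ⟨cb1, hcb1, bb1⟩ := (hx.ua_corrP hy).lipschitz_fst
  obtain ⟨cb2, hcb2, bb2⟩ := (hx.ua_corrP hy).lipschitz_snd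
  -- One constant for all the requirements; the factors 3 and 10 come from n ≤ 3m² and from m² + n²
  -- ≤ 10m².
  obtain ⟨C, hC, kr, kq, kz, kz1, kz2, ka, kb, kb1, kb2⟩ : ∃ C : ℝ, 0 < C ∧ cr + 10 * cp ≤ C ∧
      cq ≤ C ∧ cz ≤ C ∧ cz1 ≤ C ∧ 3 * cz2 ≤ C ∧ ca ≤ C ∧ cb ≤ C ∧ cb1 ≤ C ∧ 3 * cb2 ≤ C := by
    refine ⟨cr + cq + 10 * cp + cz + cz1 + 3 * cz2 + ca + cb + cb1 + 3 * cb2, by positivity,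
      ?_, ?_, ?_, ?_, ?_, ?_, ?_, ?_, ?_⟩ <;> linarith
  have kr' : cr ≤ C := by linarith
  refine ⟨C, hC, ?_⟩
  intro i N₁ N₂ hm1 hnm
  set m := mesh N₁ with hm_def
  set n := mesh N₂ with hn_def
  have hm : 0 < m := mesh_pos _
  have hn : 0 < n := mesh_pos _
  have hn3 : n ≤ 3 * m ^ 2 := by
    have h1 := (abs_le.1 hnm).2
    have h2 : m ^ 4 ≤ m ^ 2 := pow_le_pow_of_le_one hm.le hm1 (by norm_num)
    linarith
  have hn3' : |n| ≤ 3 * m ^ 2 := by rwa [abs_of_pos hn]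
  have hmem : ∀ t ∈ Icc (-(T / m ^ 3)) (T / m ^ 3), m ^ 3 * t ∈ Icc (-T) T := by
    intro t ht
    have hm3 := pow_pos hm 3
    rw [← neg_div, mem_Icc, div_le_iff₀ hm3, le_div_iff₀ hm3] at ht
    constructor <;> nlinarith [ht.1, ht.2]
  -- The index at which the uniform bounds are used: solution, slow time m³t, shifts -mt and mt, and
  -- mesh m.
  let p : ∀ t ∈ Icc (-(T / m ^ 3)) (T / m ^ 3), ((ι × Icc (-T) T) × ℝ × ℝ) × Icc (0 : ℝ) 1 :=
    fun t ht => (((i, ⟨m ^ 3 * t, hmem t ht⟩), (-m * t, m * t)), ⟨m, hm.le, hm1⟩)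
  have cast1 : ∀ a : ℤ, m * ((a + 1 : ℤ) : ℝ) = m * a + m := fun a => by push_cast; ring
  have cast2 : ∀ a : ℤ, n * ((a + 1 : ℤ) : ℝ) = n * a + n := fun a => by push_cast; ring
  have hres : ∀ t j, m ^ 6 * remP α β m
      (corrPSlow α (X i (m ^ 3 * t) (m * (j : ℤ × ℤ).1 + -m * t) (n * j.2))
        (J i (m ^ 3 * t) (m * j.1 + -m * t) (n * j.2))
        (F i (m ^ 3 * t) (m * j.1 + -m * t) (n * j.2))
        (K i (m ^ 3 * t) (m * j.1 + -m * t) (n * j.2))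
        (Y i (m ^ 3 * t) (m * j.1 + m * t) (n * j.2))
        (H i (m ^ 3 * t) (m * j.1 + m * t) (n * j.2))
        (G i (m ^ 3 * t) (m * j.1 + m * t) (n * j.2))
        (L i (m ^ 3 * t) (m * j.1 + m * t) (n * j.2)))
      (1 / Real.sqrt 2 * (F i (m ^ 3 * t) (m * j.1 + -m * t) (n * j.2) +
        G i (m ^ 3 * t) (m * j.1 + m * t) (n * j.2)))
      (corrQ α (X i (m ^ 3 * t) (m * j.1 + -m * t) (n * j.2))
        (J i (m ^ 3 * t) (m * j.1 + -m * t) (n * j.2))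
        (F i (m ^ 3 * t) (m * j.1 + -m * t) (n * j.2))
        (d1 (F i (m ^ 3 * t)) (m * j.1 + -m * t) (n * j.2))
        (Y i (m ^ 3 * t) (m * j.1 + m * t) (n * j.2))
        (H i (m ^ 3 * t) (m * j.1 + m * t) (n * j.2))
        (G i (m ^ 3 * t) (m * j.1 + m * t) (n * j.2))
        (d1 (G i (m ^ 3 * t)) (m * j.1 + m * t) (n * j.2))) =
      potDeriv α m (X i (m ^ 3 * t)) (J i (m ^ 3 * t)) (F i (m ^ 3 * t))
        (K i (m ^ 3 * t)) (Y i (m ^ 3 * t)) (H i (m ^ 3 * t)) (G i (m ^ 3 * t))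
        (L i (m ^ 3 * t)) (-m * t) (m * t) (m * j.1) (n * j.2) +
      force α β (m ^ 2 * dispPol α m (X i (m ^ 3 * t)) (J i (m ^ 3 * t))
        (F i (m ^ 3 * t)) (Y i (m ^ 3 * t)) (H i (m ^ 3 * t)) (G i (m ^ 3 * t))
        (-m * t) (m * t) (m * j.1) (n * j.2)) :=
    fun t j => (potential_residual_identity rfl).symm
  have h6 : |m ^ 6| ≤ m ^ 6 := (abs_of_pos (pow_pos hm 6)).le
  have h4 : |m ^ 4| ≤ m ^ 4 := (abs_of_pos (pow_pos hm 4)).le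
  have h3 : |m ^ 3| ≤ m ^ 3 := (abs_of_pos (pow_pos hm 3)).le
  have h2 : |m ^ 2| ≤ m ^ 2 := (abs_of_pos (pow_pos hm 2)).le
  have h1 : |m| ≤ m := (abs_of_pos hm).le
  have hresQ : ∀ t ∈ Icc (-(T / m ^ 3)) (T / m ^ 3), ∀ j : ℤ × ℤ, _ := fun t ht j =>
    br i (m ^ 3 * t) (hmem t ht) m n hm hm1 hn3' hnm (-m * t) (m * t) j
  refine ⟨fun t j => m ^ 2 * dispPol α m (X i (m ^ 3 * t)) (J i (m ^ 3 * t))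
      (F i (m ^ 3 * t)) (Y i (m ^ 3 * t)) (H i (m ^ 3 * t)) (G i (m ^ 3 * t))
      (-m * t) (m * t) (m * j.1) (n * j.2),
    fun t j => m * potPol α m (X i (m ^ 3 * t))
      (F i (m ^ 3 * t)) (Y i (m ^ 3 * t)) (G i (m ^ 3 * t)) (-m * t) (m * t) (m * j.1) (n * j.2),
    fun t j => dispDeriv α m (X i (m ^ 3 * t)) (J i (m ^ 3 * t)) (J' i (m ^ 3 * t))
      (F i (m ^ 3 * t)) (K i (m ^ 3 * t)) (Y i (m ^ 3 * t)) (H i (m ^ 3 * t)) (H' i (m ^ 3 * t))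
      (G i (m ^ 3 * t)) (L i (m ^ 3 * t)) (-m * t) (m * t) (m * j.1) (n * j.2),
    fun t j => potDeriv α m (X i (m ^ 3 * t)) (J i (m ^ 3 * t)) (F i (m ^ 3 * t))
      (K i (m ^ 3 * t)) (Y i (m ^ 3 * t)) (H i (m ^ 3 * t)) (G i (m ^ 3 * t))
      (L i (m ^ 3 * t)) (-m * t) (m * t) (m * j.1) (n * j.2), ?_⟩
  constructor
  · intro t ht
    have hp := (hx.ua_dispPol hy).periodic (p t ht)
    simp only [p] at hp
    refine isLatticePeriodic_sample (g := fun y₁ y₂ => m ^ 2 * dispPol α m (X i (m ^ 3 * t))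
      (J i (m ^ 3 * t)) (F i (m ^ 3 * t)) (Y i (m ^ 3 * t)) (H i (m ^ 3 * t)) (G i (m ^ 3 * t))
      (-m * t) (m * t) y₁ y₂) (fun y₁ y₂ => ?_) (fun y₁ y₂ => ?_)
    · simp only [hp.1]
    · simp only [hp.2]
  · intro t ht
    have hp := (hx.ua_potPol hy).periodic (p t ht)
    simp only [p] at hp
    refine isLatticePeriodic_sample (g := fun y₁ y₂ => m * potPol α m (X i (m ^ 3 * t))
      (F i (m ^ 3 * t)) (Y i (m ^ 3 * t)) (G i (m ^ 3 * t))
      (-m * t) (m * t) y₁ y₂) (fun y₁ y₂ => ?_) (fun y₁ y₂ => ?_)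
    · simp only [hp.1]
    · simp only [hp.2]
  · intro t ht j
    exact hx.hasDerivWithinAt_disp hy i hm ht _ _
  · intro t ht j
    exact hx.hasDerivWithinAt_pot hy i hm ht _ _
  · intro t ht j
    have h := abs_mul_le_mul_abs h2 (bq (p t ht) (m * j.1) (n * j.2))
    exact h.trans ((mul_comm _ _).trans_le (mul_le_mul_of_nonneg_right kq (pow_nonneg hm.le _)))
  · intro t ht j
    -- The velocity is not estimated from its formula: it is minus the Laplacian of the potential up
    -- to the residual, and that Laplacian is O(m · m²).
    have ha := hresQ t ht j
    have hb := bp (p t ht) (m * j.1) (n * j.2) m n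
    have hlap := laplacian_sample (fun y₁ y₂ => m * potPol α m (X i (m ^ 3 * t))
      (F i (m ^ 3 * t)) (Y i (m ^ 3 * t)) (G i (m ^ 3 * t)) (-m * t) (m * t) y₁ y₂) m n j
    simp only [p] at hb
    have hb2 : |laplacian (fun j => m * potPol α m (X i (m ^ 3 * t))
      (F i (m ^ 3 * t)) (Y i (m ^ 3 * t)) (G i (m ^ 3 * t)) (-m * t) (m * t)
        (m * j.1) (n * j.2)) j| ≤ 10 * cp * m ^ 3 := by
      rw [hlap]
      refine Eq.trans_le (congrArg abs ?_) ((abs_mul_le_mul_abs h1 hb).trans ?_)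
      · ring
      · rw [abs_of_pos hm, abs_of_pos hn]
        have hn2 : n ^ 2 ≤ 9 * m ^ 2 := by
          calc n ^ 2 ≤ (3 * m ^ 2) ^ 2 := pow_le_pow_left₀ hn.le hn3 2
            _ = 9 * m ^ 4 := by ring
            _ ≤ 9 * m ^ 2 := by
              have := pow_le_pow_of_le_one hm.le hm1 (show 2 ≤ 4 by norm_num)
              linarith
        have hmc := mul_pos hm hcp
        nlinarith
    have hb3 : cr * m ^ 7 ≤ cr * m ^ 3 := pow_mul_le_pow_mul hm hm1 (by norm_num) hcr.le le_rfl
    have hb4 := mul_le_mul_of_nonneg_right kr (pow_nonneg hm.le 3)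
    have hb5 := abs_le_add_of_abs_add_le ha hb2
    refine hb5.trans (le_trans ?_ hb4)
    rw [add_mul]
    exact add_le_add hb3 le_rfl
  · intro t ht j
    exact (hresQ t ht j).trans (mul_le_mul_of_nonneg_right kr' (pow_nonneg hm.le _))
  · intro t ht j
    have h := abs_mul_le_mul_abs h6 (bz (p t ht) (m * j.1) (n * j.2))
    simp only [p] at h
    rw [hres] at h
    exact h.trans ((mul_comm _ _).trans_le (mul_le_mul_of_nonneg_right kz (pow_nonneg hm.le _)))
  · intro t ht j
    -- The residual is m⁶ times the samples of a smooth function, so one lattice step gains the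
    -- mesh; in the second direction it gains n = O(m²).
    have h := abs_mul_le_mul_abs h6 (bz1 (p t ht) (m * j.1) (n * j.2)
      (m * ((j.1 + 1 : ℤ) : ℝ)))
    simp only [p] at h
    rw [mul_sub, hres t j, hres t (j.1 + 1, j.2), cast1, add_sub_cancel_left, abs_of_pos hm] at h
    simp only [← cast1] at h
    refine h.trans (le_trans (le_of_eq (?_ : _ = cz1 * m ^ 7))
      (mul_le_mul_of_nonneg_right kz1 (pow_nonneg hm.le _)))
    ring
  · intro t ht j
    have h := abs_mul_le_mul_abs h6 (bz2 (p t ht) (m * j.1) (n * j.2)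
      (n * ((j.2 + 1 : ℤ) : ℝ)))
    simp only [p] at h
    rw [mul_sub, hres t j, hres t (j.1, j.2 + 1), cast2, add_sub_cancel_left, abs_of_pos hn] at h
    simp only [← cast2] at h
    refine h.trans (le_trans (?_ : _ ≤ (3 * cz2) * m ^ 8)
      (pow_mul_le_pow_mul hm hm1 (by norm_num) (mul_nonneg (by norm_num) hcz2.le) kz2))
    exact (mul_assoc _ _ _).symm.trans_le
      ((mul_le_mul_of_nonneg_left hn3 (mul_pos (pow_pos hm 6) hcz2).le).trans_eq (by ring))
  · intro t ht j
    have h := abs_mul_le_mul_abs h4 (ba (p t ht).1 (m * j.1) (n * j.2))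
    simp only [p] at h
    rw [approxQ_eq, ← hm_def, ← hn_def]
    refine Eq.trans_le (congrArg abs ?_) (h.trans ?_)
    · unfold dispPol
      ring
    · exact (mul_comm _ _).trans_le (mul_le_mul_of_nonneg_right ka (pow_nonneg hm.le _))
  · intro t ht j
    have h := abs_mul_le_mul_abs h3 (bb (p t ht).1 (m * j.1) (n * j.2))
    simp only [p] at h
    rw [approxP_eq, ← hm_def, ← hn_def, ← hX, ← hY]
    refine Eq.trans_le (congrArg abs ?_) (h.trans ?_)
    · unfold potPol
      ring
    · exact (mul_comm _ _).trans_le (mul_le_mul_of_nonneg_right kb (pow_nonneg hm.le _))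
  · intro t ht j
    have h := abs_mul_le_mul_abs h3 (bb1 (p t ht).1 (m * j.1) (n * j.2)
      (m * ((j.1 + 1 : ℤ) : ℝ)))
    simp only [p] at h
    rw [approxP_eq, approxP_eq, ← hm_def, ← hn_def, ← hX, ← hY]
    refine Eq.trans_le (congrArg abs ?_) (h.trans ?_)
    · unfold potPol
      ring
    · rw [cast1, add_sub_cancel_left, abs_of_pos hm]
      refine le_trans (le_of_eq (?_ : _ = cb1 * m ^ 4))
        (mul_le_mul_of_nonneg_right kb1 (pow_nonneg hm.le _))
      ring
  · intro t ht j
    have h := abs_mul_le_mul_abs h3 (bb2 (p t ht).1 (m * j.1) (n * j.2)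
      (n * ((j.2 + 1 : ℤ) : ℝ)))
    simp only [p] at h
    rw [approxP_eq, approxP_eq, ← hm_def, ← hn_def, ← hX, ← hY]
    refine Eq.trans_le (congrArg abs ?_) (h.trans ?_)
    · unfold potPol
      ring
    · rw [cast2, add_sub_cancel_left, abs_of_pos hn]
      refine le_trans (?_ : _ ≤ (3 * cb2) * m ^ 5)
        (pow_mul_le_pow_mul hm hm1 (by norm_num) (mul_nonneg (by norm_num) hcb2.le) kb2)
      exact (mul_assoc _ _ _).symm.trans_le
        ((mul_le_mul_of_nonneg_left hn3 (mul_pos (pow_pos hm 3) hcb2).le).trans_eq (by ring))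

end

/-! ### Sums over the periodic box -/

/-- The shift is a cyclic permutation of the 2N + 1 indices: N goes to -N, where periodicity
identifies the values. -/
theorem sum_Icc_shift {M : Type*} [AddCommMonoid M] (N : ℕ) {g : ℤ → M}
    (hg : g (-(N : ℤ) + (2 * (N : ℤ) + 1)) = g (-(N : ℤ))) :
    ∑ a ∈ Finset.Icc (-(N : ℤ)) N, g (a + 1) = ∑ a ∈ Finset.Icc (-(N : ℤ)) N, g a := by
  refine Finset.sum_nbij' (fun a => if a = N then -(N : ℤ) else a + 1)
    (fun a => if a = -(N : ℤ) then (N : ℤ) else a - 1) ?_ ?_ ?_ ?_ ?_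
  · intro a ha
    rw [Finset.mem_Icc] at ha ⊢
    split_ifs <;> omega
  · intro a ha
    rw [Finset.mem_Icc] at ha ⊢
    split_ifs <;> omega
  · intro a ha
    rw [Finset.mem_Icc] at ha
    split_ifs <;> omega
  · intro a ha
    rw [Finset.mem_Icc] at ha
    split_ifs <;> omega
  · intro a ha
    split_ifs with h
    · rw [← hg, h]
      congr 1
      ring
    · rfl

section Sums

variable {M : Type*} [AddCommMonoid M] {N₁ N₂ : ℕ}

theorem sum_box_shift_fst {f : ℤ × ℤ → M}
    (hf : ∀ j : ℤ × ℤ, f (j.1 + (2 * (N₁ : ℤ) + 1), j.2) = f j) :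
    ∑ j ∈ box N₁ N₂, f (j.1 + 1, j.2) = ∑ j ∈ box N₁ N₂, f j := by
  unfold box
  rw [Finset.sum_product_right, Finset.sum_product_right]
  refine Finset.sum_congr rfl fun b _ => ?_
  exact sum_Icc_shift N₁ (g := fun a => f (a, b)) (hf (_, b))

theorem sum_box_shift_snd {f : ℤ × ℤ → M}
    (hf : ∀ j : ℤ × ℤ, f (j.1, j.2 + (2 * (N₂ : ℤ) + 1)) = f j) :
    ∑ j ∈ box N₁ N₂, f (j.1, j.2 + 1) = ∑ j ∈ box N₁ N₂, f j := by
  unfold box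
  rw [Finset.sum_product, Finset.sum_product]
  refine Finset.sum_congr rfl fun a _ => ?_
  exact sum_Icc_shift N₂ (g := fun b => f (a, b)) (hf (a, _))

end Sums

theorem card_box (N₁ N₂ : ℕ) : ((box N₁ N₂).card : ℝ) = (2 * (N₁ : ℝ) + 1) * (2 * (N₂ : ℝ) + 1) := by
  unfold box
  rw [Finset.card_product, Int.card_Icc, Int.card_Icc]
  have h : ∀ N : ℕ, ((N : ℤ) + 1 - -(N : ℤ)).toNat = 2 * N + 1 := fun N => by omega
  rw [h, h]
  push_cast
  ring

/-- The scalar product of the discrete gradients. -/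
def gradMul (p g : ℤ × ℤ → ℝ) (j : ℤ × ℤ) : ℝ :=
  (p (j.1 + 1, j.2) - p j) * (g (j.1 + 1, j.2) - g j) +
    (p (j.1, j.2 + 1) - p j) * (g (j.1, j.2 + 1) - g j)

section

variable {N₁ N₂ : ℕ} {p g : ℤ × ℤ → ℝ}

theorem IsLatticePeriodic.sub (hp : IsLatticePeriodic N₁ N₂ p) (hg : IsLatticePeriodic N₁ N₂ g) :
    IsLatticePeriodic N₁ N₂ fun j => p j - g j := fun j => by
  simp only [(hp j).1, (hp j).2, (hg j).1, (hg j).2, and_self]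

/-- Summation by parts. Products in which both factors, or the backward neighbour, are shifted are
moved back by periodicity. -/
theorem sum_gradMul (hp : IsLatticePeriodic N₁ N₂ p) (hg : IsLatticePeriodic N₁ N₂ g) :
    ∑ j ∈ box N₁ N₂, gradMul p g j = -∑ j ∈ box N₁ N₂, laplacian p j * g j := by
  have h1 := sum_box_shift_fst (N₁ := N₁) (N₂ := N₂) (f := fun j => p j * g j)
    (fun j => by simp only [(hp j).1, (hg j).1])
  have h2 := sum_box_shift_snd (N₁ := N₁) (N₂ := N₂) (f := fun j => p j * g j)
    (fun j => by simp only [(hp j).2, (hg j).2])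
  have h3 := sum_box_shift_fst (N₁ := N₁) (N₂ := N₂) (f := fun j => p (j.1 - 1, j.2) * g j)
    (fun j => by
      have := (hp (j.1 - 1, j.2)).1
      simp only [sub_add_eq_add_sub] at this
      simp only [this, (hg j).1])
  have h4 := sum_box_shift_snd (N₁ := N₁) (N₂ := N₂) (f := fun j => p (j.1, j.2 - 1) * g j)
    (fun j => by
      have := (hp (j.1, j.2 - 1)).2
      simp only [sub_add_eq_add_sub] at this
      simp only [this, (hg j).2])
  simp only [add_sub_cancel_right] at h3 h4
  have e1 : ∀ j, gradMul p g j = (p (j.1 + 1, j.2) * g (j.1 + 1, j.2) - p j * g (j.1 + 1, j.2)) +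
      (p (j.1, j.2 + 1) * g (j.1, j.2 + 1) - p j * g (j.1, j.2 + 1)) +
      (-(p (j.1 + 1, j.2) * g j) - p (j.1, j.2 + 1) * g j + 2 * (p j * g j)) := fun j => by
    unfold gradMul
    ring
  have e2 : ∀ j, laplacian p j * g j = (p (j.1 - 1, j.2) * g j - p j * g j) +
      (p (j.1, j.2 - 1) * g j - p j * g j) -
      (-(p (j.1 + 1, j.2) * g j) - p (j.1, j.2 + 1) * g j + 2 * (p j * g j)) := fun j => by
    unfold laplacian
    ring
  simp only [e1, e2, Finset.sum_add_distrib, Finset.sum_sub_distrib] at *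
  rw [h1, h2, h3, h4]
  ring

theorem laplacian_sub (p g : ℤ × ℤ → ℝ) (j : ℤ × ℤ) :
    laplacian (fun j => p j - g j) j = laplacian p j - laplacian g j := by
  unfold laplacian
  ring

theorem abs_sub_le_sum_Icc (N : ℕ) (g : ℤ → ℝ) {a b : ℤ} (ha : a ∈ Finset.Icc (-(N : ℤ)) N)
    (hb : b ∈ Finset.Icc (-(N : ℤ)) N) :
    |g a - g b| ≤ ∑ i ∈ Finset.Icc (-(N : ℤ)) N, |g (i + 1) - g i| := by
  have key : ∀ (n : ℕ) (a b : ℤ), a ∈ Finset.Icc (-(N : ℤ)) N → b ∈ Finset.Icc (-(N : ℤ)) N →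
      b = a + n → |g b - g a| ≤ ∑ i ∈ Finset.Ico a b, |g (i + 1) - g i| := by
    intro n
    induction n with
    | zero =>
      intro a b _ _ hab
      rw [hab]
      simp
    | succ n ih =>
      intro a b ha hb hab
      rw [Finset.mem_Icc] at ha hb
      have h1 := ih a (b - 1) (Finset.mem_Icc.2 ha) (Finset.mem_Icc.2 (by omega)) (by omega)
      have h2 : Finset.Ico a b = insert (b - 1) (Finset.Ico a (b - 1)) := by
        ext x
        simp only [Finset.mem_insert, Finset.mem_Ico]
        omega
      rw [h2, Finset.sum_insert (by simp), sub_add_cancel]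
      have h3 := abs_add_le (g b - g (b - 1)) (g (b - 1) - g a)
      rw [sub_add_sub_cancel] at h3
      linarith
  have mono : ∀ a b : ℤ, a ∈ Finset.Icc (-(N : ℤ)) N → b ∈ Finset.Icc (-(N : ℤ)) N →
      ∑ i ∈ Finset.Ico a b, |g (i + 1) - g i| ≤
        ∑ i ∈ Finset.Icc (-(N : ℤ)) N, |g (i + 1) - g i| := by
    intro a b ha hb
    refine Finset.sum_le_sum_of_subset_of_nonneg (fun x hx => ?_) (fun _ _ _ => abs_nonneg _)
    rw [Finset.mem_Icc] at *
    rw [Finset.mem_Ico] at hx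
    omega
  rcases le_total a b with h | h
  · rw [abs_sub_comm]
    exact (key (b - a).toNat a b ha hb (by omega)).trans (mono a b ha hb)
  · exact (key (a - b).toNat b a hb ha (by omega)).trans (mono b a hb ha)

/-- A Poincaré-type estimate on the box. -/
theorem abs_mul_sub_sum_le (p : ℤ × ℤ → ℝ) {j : ℤ × ℤ} (hj : j ∈ box N₁ N₂) :
    |(2 * (N₁ : ℝ) + 1) * (2 * (N₂ : ℝ) + 1) * p j - ∑ k ∈ box N₁ N₂, p k| ≤
      (2 * (N₁ : ℝ) + 1) * (2 * (N₂ : ℝ) + 1) *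
        (∑ a ∈ Finset.Icc (-(N₁ : ℤ)) N₁, |p (a + 1, j.2) - p (a, j.2)|) +
      (2 * (N₂ : ℝ) + 1) * ∑ k ∈ box N₁ N₂, |p (k.1, k.2 + 1) - p k| := by
  have hj' := Finset.mem_product.1 hj
  have h1 : (2 * (N₁ : ℝ) + 1) * (2 * (N₂ : ℝ) + 1) * p j - ∑ k ∈ box N₁ N₂, p k =
      ∑ k ∈ box N₁ N₂, (p j - p k) := by
    rw [Finset.sum_sub_distrib, Finset.sum_const, nsmul_eq_mul, card_box]
  have h2 : ∑ k ∈ box N₁ N₂, ∑ b ∈ Finset.Icc (-(N₂ : ℤ)) N₂, |p (k.1, b + 1) - p (k.1, b)| =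
      (2 * (N₂ : ℝ) + 1) * ∑ k ∈ box N₁ N₂, |p (k.1, k.2 + 1) - p k| := by
    unfold box
    rw [Finset.sum_product, Finset.sum_product, Finset.mul_sum]
    refine Finset.sum_congr rfl fun a _ => ?_
    dsimp only
    rw [Finset.sum_const, nsmul_eq_mul, Int.card_Icc,
      show ((N₂ : ℤ) + 1 - -(N₂ : ℤ)).toNat = 2 * N₂ + 1 by omega]
    push_cast
    ring
  rw [h1, ← h2, ← card_box, ← nsmul_eq_mul, ← Finset.sum_const, ← Finset.sum_add_distrib]
  refine (Finset.abs_sum_le_sum_abs _ _).trans (Finset.sum_le_sum fun k hk => ?_)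
  have hk' := Finset.mem_product.1 hk
  -- Path from j to k along the row of j and then along the column of k. The row part keeps a single
  -- row, so Cauchy–Schwarz will later cost only 2N₁ + 1 sites there; the column part is averaged
  -- over all columns.
  have e : p j - p k = (p (j.1, j.2) - p (k.1, j.2)) + (p (k.1, j.2) - p (k.1, k.2)) := by ring
  rw [e]
  refine (abs_add_le _ _).trans (add_le_add ?_ ?_)
  · exact abs_sub_le_sum_Icc N₁ (fun a => p (a, j.2)) hj'.1 hk'.1
  · exact abs_sub_le_sum_Icc N₂ (fun b => p (k.1, b)) hj'.2 hk'.2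

end

/-! ### Truncation of the restoring force -/

/-- The projection of the line on `[-c, c]`. -/
def clamp (c x : ℝ) : ℝ := max (-c) (min c x)

theorem abs_clamp_le {c : ℝ} (hc : 0 ≤ c) (x : ℝ) : |clamp c x| ≤ c := by
  unfold clamp
  rw [abs_le]
  exact ⟨le_max_left _ _, max_le (by linarith) (min_le_left _ _)⟩

theorem clamp_eq {c x : ℝ} (h : |x| ≤ c) : clamp c x = x := by
  unfold clamp
  rw [abs_le] at h
  rw [min_eq_right h.2, max_eq_right h.1]

theorem abs_clamp_sub_le (c x y : ℝ) : |clamp c x - clamp c y| ≤ |x - y| := by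
  unfold clamp
  refine (abs_max_sub_max_le_max _ _ _ _).trans ?_
  rw [sub_self, abs_zero]
  refine max_le (abs_nonneg _) ((abs_min_sub_min_le_max _ _ _ _).trans ?_)
  rw [sub_self, abs_zero]
  exact max_le (abs_nonneg _) le_rfl

theorem abs_clamp_le_abs {c : ℝ} (hc : 0 ≤ c) (x : ℝ) : |clamp c x| ≤ |x| := by
  have h := abs_clamp_sub_le c x 0
  rwa [clamp_eq (x := 0) (by simpa using hc), sub_zero, sub_zero] at h

/-- The threshold of the truncation. -/
def cutoff (α β : ℝ) : ℝ := 1 / (16 * (1 + |α| + |β|))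

theorem cutoff_pos (α β : ℝ) : 0 < cutoff α β := by unfold cutoff; positivity

/-- Up to the threshold the nonlinear part of the force has slope at most 1/4. This makes the
truncated force globally Lipschitz and strictly monotone. -/
theorem cutoff_bound (α β : ℝ) : |α| * (2 * cutoff α β) + |β| * (3 * cutoff α β ^ 2) ≤ 1 / 4 := by
  have h0 := cutoff_pos α β
  have h1 : cutoff α β * (1 + |α| + |β|) = 1 / 16 := by
    unfold cutoff
    have : 1 + |α| + |β| ≠ 0 := by positivity
    field_simp
  have ha := abs_nonneg α
  have hb := abs_nonneg β
  have h2 : cutoff α β ≤ 1 / 16 := by nlinarith [mul_nonneg h0.le ha, mul_nonneg h0.le hb]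
  have h3 : |α| * cutoff α β ≤ 1 / 16 := by nlinarith [mul_nonneg h0.le hb]
  have h4 : |β| * cutoff α β ≤ 1 / 16 := by nlinarith [mul_nonneg h0.le ha]
  have h5 : |β| * cutoff α β * cutoff α β ≤ 1 / 16 * (1 / 16) :=
    mul_le_mul h4 h2 h0.le (by norm_num)
  nlinarith

/-- The nonlinear part of the truncated force. -/
def truncNl (α β x : ℝ) : ℝ :=
  α * clamp (cutoff α β) x ^ 2 + β * clamp (cutoff α β) x ^ 3

/-- The truncated force. -/
def truncForce (α β x : ℝ) : ℝ := x + truncNl α β x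

theorem truncForce_eq {α β x : ℝ} (h : |x| ≤ cutoff α β) : truncForce α β x = force α β x := by
  unfold truncForce truncNl force
  rw [clamp_eq h]
  ring

theorem abs_truncNl_sub_le (α β x y : ℝ) : |truncNl α β x - truncNl α β y| ≤ 1 / 4 * |x - y| := by
  set c := cutoff α β with hc
  have hc0 : 0 < c := cutoff_pos α β
  set u := clamp c x
  set v := clamp c y
  have hu : |u| ≤ c := abs_clamp_le hc0.le x
  have hv : |v| ≤ c := abs_clamp_le hc0.le y
  have e : truncNl α β x - truncNl α β y =
      (α * (u + v) + β * (u * u + u * v + v * v)) * (u - v) := by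
    unfold truncNl
    ring
  have h1 : |u + v| ≤ 2 * c := (abs_add_le _ _).trans (by linarith)
  have h2 : |u * u + u * v + v * v| ≤ 3 * c ^ 2 := by
    refine (abs_add_three _ _ _).trans ?_
    rw [abs_mul, abs_mul, abs_mul]
    nlinarith [abs_nonneg u, abs_nonneg v]
  rw [e]
  refine abs_mul_le_mul_abs ((abs_add_le _ _).trans ((add_le_add
    (abs_mul_le_mul_abs le_rfl h1) (abs_mul_le_mul_abs le_rfl h2)).trans (cutoff_bound α β)))
    (abs_clamp_sub_le _ _ _)

theorem continuous_truncNl (α β : ℝ) : Continuous (truncNl α β) := by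
  unfold truncNl clamp
  fun_prop

/-- The relative potential energy of the truncated force. -/
def relEnergy (α β a b : ℝ) : ℝ :=
  (∫ x in (0 : ℝ)..b, truncForce α β x) - (∫ x in (0 : ℝ)..a, truncForce α β x) -
    truncForce α β a * (b - a)

theorem continuous_truncForce (α β : ℝ) : Continuous (truncForce α β) :=
  continuous_id.add (continuous_truncNl α β)

/-- The linear force contributes exactly (b - a)²/2 and the nonlinear part at most (b - a)²/4. Hence
the relative energy controls the error of Q from above and below, without any smallness of `b`. -/
theorem relEnergy_bounds (α β a b : ℝ) :
    1 / 4 * (b - a) ^ 2 ≤ relEnergy α β a b ∧ relEnergy α β a b ≤ 3 / 4 * (b - a) ^ 2 := by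
  have hc := continuous_truncForce α β
  have hn := continuous_truncNl α β
  have e : relEnergy α β a b = (b - a) ^ 2 / 2 +
      ∫ x in a..b, (truncNl α β x - truncNl α β a) := by
    unfold relEnergy
    rw [intervalIntegral.integral_interval_sub_left (hc.intervalIntegrable _ _)
      (hc.intervalIntegrable _ _)]
    unfold truncForce
    rw [intervalIntegral.integral_add (continuous_id'.intervalIntegrable _ _)
      (hn.intervalIntegrable _ _), intervalIntegral.integral_sub (hn.intervalIntegrable _ _)
      intervalIntegrable_const, integral_id, intervalIntegral.integral_const, smul_eq_mul]
    ring
  have h := intervalIntegral.norm_integral_le_of_norm_le_const (a := a) (b := b)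
    (f := fun x => truncNl α β x - truncNl α β a) (C := 1 / 4 * |b - a|) (fun x hx => by
      refine (abs_truncNl_sub_le α β x a).trans ?_
      have := abs_sub_left_of_mem_uIcc (uIoc_subset_uIcc hx)
      linarith)
  rw [Real.norm_eq_abs, mul_assoc, abs_mul_abs_self, abs_le] at h
  rw [e]
  constructor <;> nlinarith [h.1, h.2]

/-- The derivative of the force. -/
def forceDeriv (α β x : ℝ) : ℝ := 1 + 2 * α * x + 3 * β * x ^ 2

theorem hasDerivAt_truncForce {α β a : ℝ} (ha : |a| < cutoff α β) :
    HasDerivAt (truncForce α β) (forceDeriv α β a) a := by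
  have h1 : HasDerivAt (force α β) (forceDeriv α β a) a := by
    have := ((hasDerivAt_id a).add ((hasDerivAt_pow 2 a).const_mul α)).add
      ((hasDerivAt_pow 3 a).const_mul β)
    refine this.congr_deriv ?_
    unfold forceDeriv
    push_cast
    ring
  refine h1.congr_of_eventuallyEq ?_
  have h2 : ∀ᶠ x in 𝓝 a, |x| < cutoff α β :=
    (continuous_abs.tendsto a).eventually (gt_mem_nhds ha)
  filter_upwards [h2] with x hx
  exact truncForce_eq hx.le

theorem hasDerivWithinAt_relEnergy {α β : ℝ} {a b : ℝ → ℝ} {a' b' t : ℝ} {S : Set ℝ}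
    (ha : HasDerivWithinAt a a' S t) (hb : HasDerivWithinAt b b' S t)
    (h : |a t| < cutoff α β) :
    HasDerivWithinAt (fun t => relEnergy α β (a t) (b t))
      ((truncForce α β (b t) - truncForce α β (a t)) * b' -
        forceDeriv α β (a t) * (b t - a t) * a') S t := by
  have hc := continuous_truncForce α β
  have hV : ∀ x, HasDerivAt (fun x => ∫ x in (0 : ℝ)..x, truncForce α β x) (truncForce α β x) x :=
    fun x => intervalIntegral.integral_hasDerivAt_right (hc.intervalIntegrable _ _)
      (hc.stronglyMeasurableAtFilter _ _) hc.continuousAt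
  have h1 := (((hV (b t)).comp_hasDerivWithinAt t hb).sub
    ((hV (a t)).comp_hasDerivWithinAt t ha)).sub
    (((hasDerivAt_truncForce h).comp_hasDerivWithinAt t ha).mul (hb.sub ha))
  refine h1.congr_deriv ?_
  simp only [Pi.sub_apply, Function.comp_apply]
  ring

/-- The constant in the quadratic Taylor estimate of the truncated force. -/
def taylorConst (α β : ℝ) : ℝ := |α| + 3 * |β| * cutoff α β + 1 / cutoff α β

/-- For |b| below the threshold this is Taylor's formula of the cubic. Beyond it |b - a| is at least
half the threshold c, so the linear bound |b - a|/2 is itself at most (b - a)²/c; this is the term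
1/c of `taylorConst`. -/
theorem abs_truncForce_taylor_le {α β a b : ℝ} (ha : |a| ≤ cutoff α β / 2) :
    |truncForce α β b - truncForce α β a - forceDeriv α β a * (b - a)| ≤
      taylorConst α β * (b - a) ^ 2 := by
  have hc0 := cutoff_pos α β
  set c := cutoff α β with hc
  have hca : |a| ≤ c := by linarith
  have hcut := cutoff_bound α β
  rw [← hc] at hcut
  have hnn : 0 ≤ |α| + 3 * |β| * c := by positivity
  have hnn2 : 0 ≤ 1 / c := by positivity
  by_cases hb : |b| ≤ c
  · rw [truncForce_eq hb, truncForce_eq hca]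
    have e : force α β b - force α β a - forceDeriv α β a * (b - a) =
        (α + β * (b + 2 * a)) * (b - a) ^ 2 := by
      unfold force forceDeriv
      ring
    rw [e]
    have h1 : |b + 2 * a| ≤ 3 * c := by
      refine (abs_add_le _ _).trans ?_
      rw [abs_mul, abs_two]
      linarith
    have h2 : |α + β * (b + 2 * a)| ≤ |α| + |β| * (3 * c) :=
      (abs_add_le _ _).trans (add_le_add le_rfl (abs_mul_le_mul_abs le_rfl h1))
    refine (abs_mul_le_mul_abs h2 (abs_of_nonneg (sq_nonneg (b - a))).le).trans ?_
    refine mul_le_mul_of_nonneg_right ?_ (sq_nonneg _)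
    unfold taylorConst
    linarith
  · push Not at hb
    have h1 : c / 2 ≤ |b - a| := by
      have := abs_sub_abs_le_abs_sub b a
      linarith
    have e : truncForce α β b - truncForce α β a - forceDeriv α β a * (b - a) =
        (truncNl α β b - truncNl α β a) - (2 * α * a + 3 * β * a ^ 2) * (b - a) := by
      unfold truncForce forceDeriv
      ring
    have h2 : |2 * α * a + 3 * β * a ^ 2| ≤ 1 / 4 := by
      refine (abs_add_le _ _).trans ?_
      rw [abs_mul, abs_mul, abs_mul, abs_mul, abs_pow, abs_two, abs_of_pos (three_pos : (0 : ℝ) < 3)]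
      have h3 : |a| ^ 2 ≤ c ^ 2 := pow_le_pow_left₀ (abs_nonneg a) hca 2
      nlinarith [abs_nonneg α, abs_nonneg β, abs_nonneg a]
    have h3 : |truncForce α β b - truncForce α β a - forceDeriv α β a * (b - a)| ≤
        1 / 2 * |b - a| := by
      rw [e]
      refine (abs_sub _ _).trans ((add_le_add (abs_truncNl_sub_le α β b a)
        (abs_mul_le_mul_abs h2 le_rfl)).trans (le_of_eq ?_))
      ring
    have h4 : 1 / 2 * |b - a| ≤ 1 / c * (b - a) ^ 2 := by
      rw [← sq_abs, show 1 / c * |b - a| ^ 2 = |b - a| ^ 2 / c by ring, le_div_iff₀ hc0]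
      nlinarith [abs_nonneg (b - a)]
    refine h3.trans (h4.trans ?_)
    refine mul_le_mul_of_nonneg_right ?_ (sq_nonneg _)
    unfold taylorConst
    linarith

theorem abs_truncForce_sub_le (α β x y : ℝ) :
    |truncForce α β x - truncForce α β y| ≤ 5 / 4 * |x - y| := by
  have e : truncForce α β x - truncForce α β y = (x - y) + (truncNl α β x - truncNl α β y) := by
    unfold truncForce
    ring
  rw [e]
  refine (abs_add_le _ _).trans ?_
  linarith [abs_truncNl_sub_le α β x y]

/-! ### Differential equations on a symmetric interval -/

section ODE

variable {E : Type*} [NormedAddCommGroup E] [NormedSpace ℝ E]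

/-- A form without division by `K`, valid also for `K = 0`, a case used for the mean of P. -/
theorem gronwallBound_le {δ K ε t : ℝ} (hK : 0 ≤ K) (hε : 0 ≤ ε) :
    gronwallBound δ K ε t ≤ (δ + ε * t) * Real.exp (K * t) := by
  rcases hK.eq_or_lt with rfl | hK'
  · rw [gronwallBound_K0]
    simp
  · rw [gronwallBound_of_K_ne_0 hK'.ne']
    have h1 : 1 - K * t ≤ Real.exp (-(K * t)) := by
      have := Real.add_one_le_exp (-(K * t))
      linarith
    have h2 : Real.exp (K * t) - 1 ≤ K * t * Real.exp (K * t) := by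
      have h3 := mul_le_mul_of_nonneg_right h1 (Real.exp_pos (K * t)).le
      rw [← Real.exp_add, neg_add_cancel, Real.exp_zero] at h3
      linarith
    have h4 := mul_le_mul_of_nonneg_left h2 (div_nonneg hε hK)
    have h5 : ε / K * (K * t * Real.exp (K * t)) = ε * t * Real.exp (K * t) := by
      field_simp
    rw [h5] at h4
    linarith

theorem norm_le_of_norm_deriv_le {x x' : ℝ → E} {δ K ε T : ℝ}
    (hd : ∀ t ∈ Icc (-T) T, HasDerivWithinAt x (x' t) (Icc (-T) T) t) (h0 : ‖x 0‖ ≤ δ)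
    (hK : 0 ≤ K) (hε : 0 ≤ ε) (hb : ∀ t ∈ Icc (-T) T, ‖x' t‖ ≤ K * ‖x t‖ + ε) :
    ∀ t ∈ Icc (-T) T, ‖x t‖ ≤ (δ + ε * T) * Real.exp (K * T) := by
  have key : ∀ {y y' : ℝ → E}, (∀ t ∈ Icc (-T) T, HasDerivWithinAt y (y' t) (Icc (-T) T) t) →
      ‖y 0‖ ≤ δ → (∀ t ∈ Icc (-T) T, ‖y' t‖ ≤ K * ‖y t‖ + ε) →
      ∀ t ∈ Icc 0 T, ‖y t‖ ≤ (δ + ε * T) * Real.exp (K * T) := by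
    intro y y' hd h0 hb t ht
    have hT : 0 ≤ T := ht.1.trans ht.2
    have hsub : Icc 0 T ⊆ Icc (-T) T := Icc_subset_Icc_left (by linarith)
    have hmem : ∀ t ∈ Ico 0 T, t ∈ Icc (-T) T := fun t ht => hsub (Ico_subset_Icc_self ht)
    have hδ : 0 ≤ δ := (norm_nonneg _).trans h0
    have h := norm_le_gronwallBound_of_norm_deriv_right_le (f := y) (f' := y') (a := 0) (b := T)
      (fun t ht => (hd t (hsub ht)).continuousWithinAt.mono hsub)
      (fun t ht => (hd t (hmem t ht)).mono_of_mem_nhdsWithin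
        (mem_of_superset (Icc_mem_nhdsGE_of_mem ht) hsub))
      h0 (fun t ht => hb t (hmem t ht)) t ht
    rw [sub_zero] at h
    refine h.trans ((gronwallBound_mono hδ hε hK ht.2).trans (gronwallBound_le hK hε))
  intro t ht
  rcases le_total 0 t with h | h
  · exact key hd h0 hb t ⟨h, ht.2⟩
  -- Negative times follow from the forward estimate for the reflected curve.
  · have hneg : ∀ t ∈ Icc (-T) T, -t ∈ Icc (-T) T := fun t ht =>
      ⟨neg_le_neg ht.2, by linarith [ht.1]⟩
    have h2 := key (y := fun t => x (-t)) (y' := fun t => -x' (-t)) (fun t ht => by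
      have h3 := (hd (-t) (hneg t ht)).scomp t ((hasDerivAt_neg t).hasDerivWithinAt)
        (fun s hs => hneg s hs)
      rw [neg_one_smul] at h3
      exact h3) (by simpa using h0) (fun t ht => by
        rw [norm_neg]
        exact hb (-t) (hneg t ht)) (-t) ⟨by linarith, by linarith [ht.1]⟩
    simpa using h2

/-- Clamping the coordinates at `M` makes the field bounded, so Picard–Lindelöf applies at once on
the whole interval. Since clamping does not increase the norm, Gronwall bounds the solution by that
same `M`, and the clamp is inactive. -/
theorem exists_solution_of_lipschitzWith {ι : Type*} [Fintype ι] {f : (ι → ℝ) → ι → ℝ} {K : NNReal}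
    (hf : LipschitzWith K f) {T : ℝ} (hT : 0 ≤ T) (x₀ : ι → ℝ) :
    ∃ x : ℝ → ι → ℝ, x 0 = x₀ ∧
      ∀ t ∈ Icc (-T) T, HasDerivWithinAt x (f (x t)) (Icc (-T) T) t := by
  set M : ℝ := (‖x₀‖ + ‖f 0‖ * T) * Real.exp (K * T) with hM
  have hM0 : 0 ≤ M := by positivity
  set c : (ι → ℝ) → ι → ℝ := fun x i => clamp M (x i) with hc
  have hcl : LipschitzWith 1 c := by
    refine LipschitzWith.of_dist_le_mul fun x y => ?_
    rw [NNReal.coe_one, one_mul, dist_pi_le_iff dist_nonneg]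
    intro i
    exact (abs_clamp_sub_le M (x i) (y i)).trans (dist_le_pi_dist x y i)
  have hcM : ∀ x, ‖c x‖ ≤ M := fun x =>
    (pi_norm_le_iff_of_nonneg hM0).2 fun i => abs_clamp_le hM0 _
  have hcx : ∀ x, ‖c x‖ ≤ ‖x‖ := fun x =>
    (pi_norm_le_iff_of_nonneg (norm_nonneg x)).2 fun i =>
      (abs_clamp_le_abs hM0 _).trans (norm_le_pi_norm x i)
  have hfn : ∀ x, ‖f x‖ ≤ K * ‖x‖ + ‖f 0‖ := fun x => by
    have h1 := hf.dist_le_mul x 0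
    rw [dist_zero_right, dist_eq_norm] at h1
    have h2 := norm_sub_norm_le (f x) (f 0)
    linarith
  have hg : LipschitzWith K (f ∘ c) := by simpa using hf.comp hcl
  obtain ⟨x, hx0, hx⟩ := IsPicardLindelof.exists_eq_forall_mem_Icc_hasDerivWithinAt₀
    (f := fun _ => f ∘ c) (tmin := -T) (tmax := T) (t₀ := ⟨0, by constructor <;> linarith⟩)
    (x₀ := x₀) (a := ⟨(K * M + ‖f 0‖) * T, by positivity⟩) (L := ⟨K * M + ‖f 0‖, by positivity⟩)
    (K := K)
    { lipschitzOnWith := fun t _ => hg.lipschitzOnWith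
      continuousOn := fun x _ => continuousOn_const
      norm_le := fun t _ x _ => by
        refine (hfn (c x)).trans ?_
        change _ ≤ K * M + ‖f 0‖
        have := mul_le_mul_of_nonneg_left (hcM x) K.coe_nonneg
        linarith
      mul_max_le := by
        simp only [sub_zero, zero_sub, neg_neg, max_self, NNReal.coe_zero]
        exact le_rfl }
  have hbd := norm_le_of_norm_deriv_le hx (show ‖x 0‖ ≤ ‖x₀‖ from (congrArg norm hx0).le)
    K.coe_nonneg (norm_nonneg (f 0)) (fun t _ => by
      refine (hfn (c (x t))).trans ?_
      have := mul_le_mul_of_nonneg_left (hcx (x t)) K.coe_nonneg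
      linarith)
  refine ⟨x, hx0, fun t ht => ?_⟩
  have h1 : c (x t) = x t := by
    funext i
    exact clamp_eq ((norm_le_pi_norm (x t) i).trans (hbd t ht))
  have h2 := hx t ht
  simp only [Function.comp_apply] at h2
  rwa [h1] at h2

end ODE

/-! ### Lattice equations with a general force -/

section Lattice

variable {N₁ N₂ : ℕ}

/-- The fundamental domain of the periodic lattice. -/
abbrev Cell (N₁ N₂ : ℕ) : Type := ZMod (2 * N₁ + 1) × ZMod (2 * N₂ + 1)

/-- The restriction of a function to the fundamental domain. -/
def toCell (N₁ N₂ : ℕ) (f : ℤ × ℤ → ℝ) (s : Cell N₁ N₂) : ℝ := f ((s.1.val : ℤ), (s.2.val : ℤ))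

/-- The periodic extension of a function on the fundamental domain. -/
def ofCell (x : Cell N₁ N₂ → ℝ) (j : ℤ × ℤ) : ℝ := x ((j.1 : ZMod _), (j.2 : ZMod _))

theorem isLatticePeriodic_ofCell (x : Cell N₁ N₂ → ℝ) : IsLatticePeriodic N₁ N₂ (ofCell x) := by
  intro j
  have h : ∀ (N : ℕ) (a : ℤ), ((a + (2 * (N : ℤ) + 1) : ℤ) : ZMod (2 * N + 1)) = a := fun N a => by
    have h1 : ((2 * (N : ℤ) + 1 : ℤ) : ZMod (2 * N + 1)) = ((2 * N + 1 : ℕ) : ZMod (2 * N + 1)) := by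
      push_cast
      rfl
    rw [Int.cast_add, h1, ZMod.natCast_self, add_zero]
  unfold ofCell
  rw [h, h]
  exact ⟨rfl, rfl⟩

theorem IsLatticePeriodic.toCell_cast {f : ℤ × ℤ → ℝ} (hf : IsLatticePeriodic N₁ N₂ f)
    (j : ℤ × ℤ) : toCell N₁ N₂ f ((j.1 : ZMod _), (j.2 : ZMod _)) = f j := by
  unfold toCell
  simp only [ZMod.val_intCast]
  have h1 : ∀ b, Function.Periodic (fun a => f (a, b)) (2 * (N₁ : ℤ) + 1) := fun b a => (hf (a, b)).1
  have h2 : ∀ a, Function.Periodic (fun b => f (a, b)) (2 * (N₂ : ℤ) + 1) := fun a b => (hf (a, b)).2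
  push_cast
  have mod : ∀ {g : ℤ → ℝ} {n : ℤ}, Function.Periodic g n → ∀ a, g (a % n) = g a := by
    intro g n hg a
    rw [Int.emod_def, mul_comm]
    exact hg.sub_zsmul_eq (a / n)
  exact (mod (h1 _) j.1).trans (mod (h2 _) j.2)

theorem isLatticePeriodic_laplacian {p : ℤ × ℤ → ℝ} (hp : IsLatticePeriodic N₁ N₂ p) :
    IsLatticePeriodic N₁ N₂ (laplacian p) := by
  intro j
  unfold laplacian
  have h1 : ∀ a b, p (a + (2 * (N₁ : ℤ) + 1), b) = p (a, b) := fun a b => (hp (a, b)).1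
  have h2 : ∀ a b, p (a, b + (2 * (N₂ : ℤ) + 1)) = p (a, b) := fun a b => (hp (a, b)).2
  constructor
  · simp only [add_right_comm _ (2 * (N₁ : ℤ) + 1), add_sub_right_comm _ (2 * (N₁ : ℤ) + 1), h1]
  · simp only [add_right_comm _ (2 * (N₂ : ℤ) + 1), add_sub_right_comm _ (2 * (N₂ : ℤ) + 1), h2]

theorem abs_laplacian_le {p : ℤ × ℤ → ℝ} {B : ℝ} (h : ∀ j, |p j| ≤ B) (j : ℤ × ℤ) :
    |laplacian p j| ≤ 8 * B := by
  unfold laplacian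
  have h0 := abs_le.1 (h j)
  have h1 := abs_le.1 (h (j.1 + 1, j.2))
  have h2 := abs_le.1 (h (j.1 - 1, j.2))
  have h3 := abs_le.1 (h (j.1, j.2 + 1))
  have h4 := abs_le.1 (h (j.1, j.2 - 1))
  rw [abs_le]
  constructor <;> linarith [h0.1, h0.2, h1.1, h1.2, h2.1, h2.2, h3.1, h3.2, h4.1, h4.2]

/-- The lattice equations with the force `g`. -/
structure LatticeEq (N₁ N₂ : ℕ) (g : ℝ → ℝ) (T : ℝ) (Q P : ℝ → ℤ × ℤ → ℝ) : Prop where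
  periodic_Q : ∀ t ∈ Icc (-T) T, IsLatticePeriodic N₁ N₂ (Q t)
  periodic_P : ∀ t ∈ Icc (-T) T, IsLatticePeriodic N₁ N₂ (P t)
  deriv_Q : ∀ t ∈ Icc (-T) T, ∀ j : ℤ × ℤ,
    HasDerivWithinAt (fun r => Q r j) (-laplacian (P t) j) (Icc (-T) T) t
  deriv_P : ∀ t ∈ Icc (-T) T, ∀ j : ℤ × ℤ,
    HasDerivWithinAt (fun r => P r j) (-g (Q t j)) (Icc (-T) T) t

theorem isLatticeSolution_iff {α β T : ℝ} {Q P : ℝ → ℤ × ℤ → ℝ} :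
    IsLatticeSolution N₁ N₂ α β T Q P ↔ LatticeEq N₁ N₂ (force α β) T Q P :=
  ⟨fun h => ⟨h.1, h.2, h.3, h.4⟩, fun h => ⟨h.1, h.2, h.3, h.4⟩⟩

/-- Periodic states are functions on a finite product of cyclic groups, so the lattice is an ODE in
a finite-dimensional sup-normed space. The constant 8 bounds the norm of the discrete Laplacian. -/
theorem exists_latticeEq {g : ℝ → ℝ} {K : ℝ} (hK : 0 ≤ K) (hg : ∀ x y, |g x - g y| ≤ K * |x - y|)
    {T : ℝ} (hT : 0 ≤ T) {Q₀ P₀ : ℤ × ℤ → ℝ} (hQ : IsLatticePeriodic N₁ N₂ Q₀)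
    (hP : IsLatticePeriodic N₁ N₂ P₀) :
    ∃ Q P, LatticeEq N₁ N₂ g T Q P ∧ Q 0 = Q₀ ∧ P 0 = P₀ := by
  set f : (Cell N₁ N₂ ⊕ Cell N₁ N₂ → ℝ) → Cell N₁ N₂ ⊕ Cell N₁ N₂ → ℝ := fun x =>
    Sum.elim (toCell N₁ N₂ fun j => -laplacian (ofCell (x ∘ Sum.inr)) j)
      (fun s => -g (x (Sum.inl s))) with hf
  have hlip : LipschitzWith ⟨8 + K, by positivity⟩ f := by
    refine LipschitzWith.of_dist_le_mul fun x y => ?_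
    change _ ≤ (8 + K) * dist x y
    have hd : ∀ i, |x i - y i| ≤ dist x y := fun i => dist_le_pi_dist x y i
    rw [dist_pi_le_iff (by positivity)]
    rintro (s | s)
    · have h1 := abs_laplacian_le (p := fun j => ofCell (x ∘ Sum.inr) j - ofCell (y ∘ Sum.inr) j)
        (fun j => hd (Sum.inr _)) ((s.1.val : ℤ), (s.2.val : ℤ))
      rw [laplacian_sub, abs_sub_comm] at h1
      have h2 : dist (f x (Sum.inl s)) (f y (Sum.inl s)) =
          |laplacian (ofCell (y ∘ Sum.inr)) ((s.1.val : ℤ), (s.2.val : ℤ)) -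
            laplacian (ofCell (x ∘ Sum.inr)) ((s.1.val : ℤ), (s.2.val : ℤ))| := by
        rw [Real.dist_eq]
        simp only [hf, Sum.elim_inl, toCell]
        congr 1
        ring
      rw [h2]
      nlinarith [dist_nonneg (x := x) (y := y)]
    · have h1 := (hg (x (Sum.inl s)) (y (Sum.inl s))).trans
        (mul_le_mul_of_nonneg_left (hd (Sum.inl s)) hK)
      have h2 : dist (f x (Sum.inr s)) (f y (Sum.inr s)) =
          |g (x (Sum.inl s)) - g (y (Sum.inl s))| := by
        rw [Real.dist_eq, ← abs_neg]
        simp only [hf, Sum.elim_inr]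
        congr 1
        ring
      rw [h2]
      nlinarith [dist_nonneg (x := x) (y := y)]
  obtain ⟨x, hx0, hx⟩ := exists_solution_of_lipschitzWith hlip hT
    (Sum.elim (toCell N₁ N₂ Q₀) (toCell N₁ N₂ P₀))
  have hx' := fun t ht i => (hasDerivWithinAt_pi.1 (hx t ht)) i
  refine ⟨fun t => ofCell (x t ∘ Sum.inl), fun t => ofCell (x t ∘ Sum.inr),
    ⟨fun t _ => isLatticePeriodic_ofCell _, fun t _ => isLatticePeriodic_ofCell _,
      fun t ht j => ?_, fun t ht j => ?_⟩, ?_, ?_⟩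
  · have h := hx' t ht (Sum.inl ((j.1 : ZMod _), (j.2 : ZMod _)))
    have hper := isLatticePeriodic_laplacian (isLatticePeriodic_ofCell (x t ∘ Sum.inr))
    have e := hper.toCell_cast j
    refine h.congr_deriv ?_
    rw [← e]
    rfl
  · exact hx' t ht (Sum.inr ((j.1 : ZMod _), (j.2 : ZMod _)))
  · funext j
    simp only [hx0]
    exact hQ.toCell_cast j
  · funext j
    simp only [hx0]
    exact hP.toCell_cast j

/-- Only a local Lipschitz bound is required, as the cubic force has no global one: each solution is
continuous on a compact interval, hence bounded, and Gronwall applies to the difference. -/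
theorem LatticeEq.unique {g : ℝ → ℝ} (hg : ∀ M, ∃ K, ∀ x y, |x| ≤ M → |y| ≤ M →
    |g x - g y| ≤ K * |x - y|) {T : ℝ} {Q P Q' P' : ℝ → ℤ × ℤ → ℝ}
    (h : LatticeEq N₁ N₂ g T Q P) (h' : LatticeEq N₁ N₂ g T Q' P') (hQ : Q 0 = Q' 0)
    (hP : P 0 = P' 0) : ∀ t ∈ Icc (-T) T, Q t = Q' t ∧ P t = P' t := by
  have hbd : ∀ {Q P}, LatticeEq N₁ N₂ g T Q P → ∃ M, ∀ t ∈ Icc (-T) T, ∀ j, |Q t j| ≤ M := by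
    intro Q P h
    have hc : ContinuousOn (fun t => toCell N₁ N₂ (Q t)) (Icc (-T) T) :=
      continuousOn_pi.2 fun s t ht => (h.deriv_Q t ht _).continuousWithinAt
    obtain ⟨M, hM⟩ := isCompact_Icc.exists_bound_of_continuousOn hc
    refine ⟨M, fun t ht j => ?_⟩
    rw [← (h.periodic_Q t ht).toCell_cast j]
    exact (norm_le_pi_norm (toCell N₁ N₂ (Q t)) _).trans (hM t ht)
  obtain ⟨M, hM⟩ := hbd h
  obtain ⟨M', hM'⟩ := hbd h'
  obtain ⟨K, hK⟩ := hg (max M M')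
  set x : ℝ → Cell N₁ N₂ ⊕ Cell N₁ N₂ → ℝ := fun t =>
    Sum.elim (toCell N₁ N₂ fun j => Q t j - Q' t j) (toCell N₁ N₂ fun j => P t j - P' t j) with hx
  set x' : ℝ → Cell N₁ N₂ ⊕ Cell N₁ N₂ → ℝ := fun t =>
    Sum.elim (toCell N₁ N₂ fun j => -laplacian (P t) j - -laplacian (P' t) j)
      (toCell N₁ N₂ fun j => -g (Q t j) - -g (Q' t j)) with hx'
  have hq : ∀ t ∈ Icc (-T) T, ∀ j, |Q t j - Q' t j| ≤ ‖x t‖ := fun t ht j => by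
    rw [← ((h.periodic_Q t ht).sub (h'.periodic_Q t ht)).toCell_cast j]
    exact norm_le_pi_norm (x t) (Sum.inl _)
  have hp : ∀ t ∈ Icc (-T) T, ∀ j, |P t j - P' t j| ≤ ‖x t‖ := fun t ht j => by
    rw [← ((h.periodic_P t ht).sub (h'.periodic_P t ht)).toCell_cast j]
    exact norm_le_pi_norm (x t) (Sum.inr _)
  have key := norm_le_of_norm_deriv_le (x := x) (x' := x') (δ := 0) (K := 8 + |K|) (ε := 0) (T := T)
    (fun t ht => hasDerivWithinAt_pi.2 fun i => by
      rcases i with s | s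
      · exact (h.deriv_Q t ht _).sub (h'.deriv_Q t ht _)
      · exact (h.deriv_P t ht _).sub (h'.deriv_P t ht _))
    (by
      refine (pi_norm_le_iff_of_nonneg le_rfl).2 fun i => ?_
      rcases i with s | s
      · simp [hx, toCell, hQ]
      · simp [hx, toCell, hP])
    (by positivity) le_rfl (fun t ht => by
      rw [add_zero]
      refine (pi_norm_le_iff_of_nonneg (by positivity)).2 fun i => ?_
      have hn := norm_nonneg (x t)
      rcases i with s | s
      · have h1 := abs_laplacian_le (hp t ht) ((s.1.val : ℤ), (s.2.val : ℤ))
        rw [laplacian_sub, abs_sub_comm] at h1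
        simp only [hx', Sum.elim_inl, toCell, Real.norm_eq_abs, sub_neg_eq_add,
          neg_add_eq_sub]
        nlinarith [abs_nonneg K]
      · have h1 := hK _ _ ((hM t ht ((s.1.val : ℤ), (s.2.val : ℤ))).trans (le_max_left _ _))
          ((hM' t ht ((s.1.val : ℤ), (s.2.val : ℤ))).trans (le_max_right _ _))
        rw [abs_sub_comm] at h1
        have h2 := hq t ht ((s.1.val : ℤ), (s.2.val : ℤ))
        simp only [hx', Sum.elim_inr, toCell, Real.norm_eq_abs, sub_neg_eq_add,
          neg_add_eq_sub]
        refine h1.trans ((mul_le_mul (le_abs_self K) h2 (abs_nonneg _) (abs_nonneg K)).trans ?_)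
        nlinarith [abs_nonneg K])
  intro t ht
  have h0 := key t ht
  rw [zero_mul, add_zero, zero_mul] at h0
  constructor <;> funext j
  · exact sub_eq_zero.1 (abs_nonpos_iff.1 ((hq t ht j).trans h0))
  · exact sub_eq_zero.1 (abs_nonpos_iff.1 ((hp t ht j).trans h0))

theorem force_locally_lipschitz (α β M : ℝ) : ∃ K, ∀ x y, |x| ≤ M → |y| ≤ M →
    |force α β x - force α β y| ≤ K * |x - y| := by
  refine ⟨1 + |α| * (2 * M) + |β| * (3 * M ^ 2), fun x y hx hy => ?_⟩
  have e : force α β x - force α β y =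
      (1 + α * (x + y) + β * (x * x + x * y + y * y)) * (x - y) := by
    unfold force
    ring
  have h1 : |x + y| ≤ 2 * M := (abs_add_le _ _).trans (by linarith)
  have h2 : |x * x + x * y + y * y| ≤ 3 * M ^ 2 := by
    refine (abs_add_three _ _ _).trans ?_
    rw [abs_mul, abs_mul, abs_mul]
    nlinarith [abs_nonneg x, abs_nonneg y]
  rw [e]
  refine abs_mul_le_mul_abs ((abs_add_three _ _ _).trans ?_) le_rfl
  rw [abs_one]
  have := abs_mul_le_mul_abs (le_refl |α|) h1
  have := abs_mul_le_mul_abs (le_refl |β|) h2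
  linarith

end Lattice

/-! ### The energy of the error -/

theorem hasDerivWithinAt_gradMul {p : ℝ → ℤ × ℤ → ℝ} {p' : ℤ × ℤ → ℝ} {S : Set ℝ} {t : ℝ}
    (h : ∀ j, HasDerivWithinAt (fun r => p r j) (p' j) S t) (j : ℤ × ℤ) :
    HasDerivWithinAt (fun r => 1 / 2 * gradMul (p r) (p r) j) (gradMul (p t) p' j) S t := by
  have h1 := (h (j.1 + 1, j.2)).sub (h j)
  have h2 := (h (j.1, j.2 + 1)).sub (h j)
  refine (((h1.mul h1).add (h2.mul h2)).const_mul (1 / 2)).congr_deriv ?_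
  simp only [gradMul, Pi.sub_apply]
  ring

theorem gradMul_self_nonneg (p : ℤ × ℤ → ℝ) (j : ℤ × ℤ) : 0 ≤ gradMul p p j :=
  add_nonneg (mul_self_nonneg _) (mul_self_nonneg _)

/-- Young's inequality with the small factor `k` kept outside. With `k` = m³ the first term has the
admissible growth rate and the second is a source. -/
theorem abs_gradMul_le {p g : ℤ × ℤ → ℝ} {j : ℤ × ℤ} {A k : ℝ} (hk : 0 < k)
    (h₁ : |g (j.1 + 1, j.2) - g j| ≤ A * k) (h₂ : |g (j.1, j.2 + 1) - g j| ≤ A * k) :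
    |gradMul p g j| ≤ k * (1 / 2 * gradMul p p j + A ^ 2) := by
  have key : ∀ x y : ℝ, |y| ≤ A * k → |x * y| ≤ k * (1 / 2 * (x * x) + 1 / 2 * A ^ 2) := by
    intro x y hy
    have h := abs_mul_le_mul_abs (le_refl |x|) hy
    have h3 : |x| * A ≤ 1 / 2 * (x * x) + 1 / 2 * A ^ 2 := by
      nlinarith [sq_nonneg (|x| - A), sq_abs x]
    have := mul_le_mul_of_nonneg_left h3 hk.le
    linarith
  unfold gradMul
  refine (abs_add_le _ _).trans ((add_le_add (key _ _ h₁) (key _ _ h₂)).trans (le_of_eq ?_))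
  ring

/-- The energy of the error. -/
def errEnergy (N₁ N₂ : ℕ) (α β : ℝ) (Qt Pt Q P : ℤ × ℤ → ℝ) : ℝ :=
  ∑ j ∈ box N₁ N₂, (1 / 2 * gradMul (fun j => P j - Pt j) (fun j => P j - Pt j) j +
    relEnergy α β (Qt j) (Q j))

section

variable {N₁ N₂ : ℕ} {α β T C : ℝ} {Qa Pa Qt Pt dQ dP Q P : ℝ → ℤ × ℤ → ℝ}

theorem isLatticePeriodic_truncForce {Q : ℤ × ℤ → ℝ} (hQ : IsLatticePeriodic N₁ N₂ Q) :
    IsLatticePeriodic N₁ N₂ fun j => truncForce α β (Q j) := fun j => by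
  simp only [(hQ j).1, (hQ j).2, and_self]

/-- The Hamiltonian structure cancels the exchange between gradient and potential energy: with p the
error of P and g the difference of the forces, the terms gradMul p g and Δp · g sum to zero over the
box. The surviving terms contain a residual, or a second-order Taylor remainder times the velocity
`dQ`. -/
theorem ApproxSol.hasDerivWithinAt_errEnergy (h : ApproxSol N₁ N₂ α β T C Qa Pa Qt Pt dQ dP)
    (hs : LatticeEq N₁ N₂ (truncForce α β) T Q P) (hc : C * mesh N₁ ^ 2 ≤ cutoff α β / 2)
    {t : ℝ} (ht : t ∈ Icc (-T) T) :
    HasDerivWithinAt (fun r => errEnergy N₁ N₂ α β (Qt r) (Pt r) (Q r) (P r))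
      (∑ j ∈ box N₁ N₂,
        (-gradMul (fun j => P t j - Pt t j) (fun j => dP t j + force α β (Qt t j)) j -
          (truncForce α β (Q t j) - truncForce α β (Qt t j)) * (dQ t j + laplacian (Pt t) j) +
          (truncForce α β (Q t j) - truncForce α β (Qt t j) -
            forceDeriv α β (Qt t j) * (Q t j - Qt t j)) * dQ t j)) (Icc (-T) T) t := by
  have hc0 := cutoff_pos α β
  have hQt : ∀ j, |Qt t j| < cutoff α β := fun j => (h.abs_Q t ht j).trans_lt (by linarith)
  have h1 := HasDerivWithinAt.fun_sum (u := box N₁ N₂) (fun j _ =>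
    (hasDerivWithinAt_gradMul (p := fun r j => P r j - Pt r j)
      (fun j => (hs.deriv_P t ht j).sub (h.deriv_P t ht j)) j).add
    (hasDerivWithinAt_relEnergy (h.deriv_Q t ht j) (hs.deriv_Q t ht j) (hQt j)))
  refine h1.congr_deriv ?_
  set p : ℤ × ℤ → ℝ := fun j => P t j - Pt t j with hp
  set g : ℤ × ℤ → ℝ := fun j => truncForce α β (Q t j) - truncForce α β (Qt t j) with hg
  have hpp : IsLatticePeriodic N₁ N₂ p := (hs.periodic_P t ht).sub (h.periodic_P t ht)
  have hgp : IsLatticePeriodic N₁ N₂ g := (isLatticePeriodic_truncForce (hs.periodic_Q t ht)).sub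
    (isLatticePeriodic_truncForce (h.periodic_Q t ht))
  have hsum := sum_gradMul hpp hgp
  have e1 : ∀ j, gradMul p (fun j => -truncForce α β (Q t j) - dP t j) j =
      -gradMul p g j - gradMul p (fun j => dP t j + force α β (Qt t j)) j := fun j => by
    simp only [gradMul, hg, truncForce_eq (hQt _).le]
    ring
  have e2 : ∀ j, laplacian (P t) j = laplacian p j + laplacian (Pt t) j := fun j => by
    rw [hp, laplacian_sub]
    ring
  rw [← sub_eq_zero, ← Finset.sum_sub_distrib]
  have e3 : ∀ j ∈ box N₁ N₂, (gradMul p (fun j => -truncForce α β (Q t j) - dP t j) j +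
      ((truncForce α β (Q t j) - truncForce α β (Qt t j)) * -laplacian (P t) j -
        forceDeriv α β (Qt t j) * (Q t j - Qt t j) * dQ t j)) -
      (-gradMul p (fun j => dP t j + force α β (Qt t j)) j -
          g j * (dQ t j + laplacian (Pt t) j) +
          (g j - forceDeriv α β (Qt t j) * (Q t j - Qt t j)) * dQ t j) =
      -(gradMul p g j) - laplacian p j * g j := fun j _ => by
    rw [e1, e2]
    simp only [hg]
    ring
  refine (Finset.sum_congr rfl e3).trans ?_
  rw [Finset.sum_sub_distrib, Finset.sum_neg_distrib, hsum]
  ring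

theorem errEnergy_lower (Qt Pt Q P : ℤ × ℤ → ℝ) :
    ∑ j ∈ box N₁ N₂, (1 / 2 * gradMul (fun j => P j - Pt j) (fun j => P j - Pt j) j +
      1 / 4 * (Q j - Qt j) ^ 2) ≤ errEnergy N₁ N₂ α β Qt Pt Q P :=
  Finset.sum_le_sum fun _ _ => add_le_add le_rfl (relEnergy_bounds _ _ _ _).1

theorem errEnergy_upper (Qt Pt Q P : ℤ × ℤ → ℝ) :
    errEnergy N₁ N₂ α β Qt Pt Q P ≤
      ∑ j ∈ box N₁ N₂, (1 / 2 * gradMul (fun j => P j - Pt j) (fun j => P j - Pt j) j +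
      3 / 4 * (Q j - Qt j) ^ 2) :=
  Finset.sum_le_sum fun _ _ => add_le_add le_rfl (relEnergy_bounds _ _ _ _).2

/-- There are at most 8m⁻³ sites, so passing from a pointwise bound to a sum costs three powers of
m. -/
theorem sum_box_le {f : ℤ × ℤ → ℝ} {A m : ℝ} (k : ℕ)
    (hN : (2 * (N₁ : ℝ) + 1) * (2 * (N₂ : ℝ) + 1) * m ^ 3 ≤ 8) (hA : 0 ≤ A) (hm : 0 ≤ m)
    (hf : ∀ j ∈ box N₁ N₂, f j ≤ A * m ^ (k + 3)) : ∑ j ∈ box N₁ N₂, f j ≤ 8 * A * m ^ k := by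
  refine (Finset.sum_le_card_nsmul _ _ _ hf).trans ?_
  rw [nsmul_eq_mul, card_box, pow_add]
  have := mul_le_mul_of_nonneg_right hN (mul_nonneg hA (pow_nonneg hm k))
  linarith

/-- The squared initial error per site is O(m⁸), hence the initial energy is O(m⁵). The source is
O(m⁸) and the rate O(m³), so integration over a time of order m⁻³ keeps m⁵ with a bounded
exponential. -/
theorem ApproxSol.errEnergy_le (h : ApproxSol N₁ N₂ α β T C Qa Pa Qt Pt dQ dP)
    (hs : LatticeEq N₁ N₂ (truncForce α β) T Q P) (hQ₀ : Q 0 = Qa 0) (hP₀ : P 0 = Pa 0)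
    (hc : C * mesh N₁ ^ 2 ≤ cutoff α β / 2) (hC : 0 ≤ C) {T₀ : ℝ} (hT₀ : T * mesh N₁ ^ 3 = T₀)
    (hT : 0 ≤ T)
    (hN : (2 * (N₁ : ℝ) + 1) * (2 * (N₂ : ℝ) + 1) * mesh N₁ ^ 3 ≤ 8) {t : ℝ}
    (ht : t ∈ Icc (-T) T) :
    errEnergy N₁ N₂ α β (Qt t) (Pt t) (Q t) (P t) ≤
      (14 * C ^ 2 + 16 * C ^ 2 * T₀) * Real.exp ((4 + 4 * taylorConst α β * C) * T₀) *
        mesh N₁ ^ 5 := by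
  set m := mesh N₁ with hm_def
  have hm : 0 < m := mesh_pos N₁
  have hc0 := cutoff_pos α β
  have hK : 0 ≤ taylorConst α β := by unfold taylorConst; positivity
  set K := taylorConst α β with hK_def
  have hE : ∀ t, 0 ≤ errEnergy N₁ N₂ α β (Qt t) (Pt t) (Q t) (P t) := fun t =>
    (Finset.sum_nonneg fun j _ => add_nonneg (mul_nonneg (by norm_num) (gradMul_self_nonneg _ _))
      (mul_nonneg (by norm_num) (sq_nonneg _))).trans (errEnergy_lower _ _ _ _)
  have h0 : errEnergy N₁ N₂ α β (Qt 0) (Pt 0) (Q 0) (P 0) ≤ 14 * C ^ 2 * m ^ 5 := by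
    have h0T : (0 : ℝ) ∈ Icc (-T) T := ⟨by linarith, hT⟩
    -- Two gradient squares with weight 1/2 and one displacement square with weight 3/4 give 7/4,
    -- and 8 · 7/4 = 14.
    refine (errEnergy_upper _ _ _ _).trans ((sum_box_le (A := 7 / 4 * C ^ 2) 5 hN (by positivity)
      hm.le fun j _ => ?_).trans (le_of_eq (by ring)))
    rw [hQ₀, hP₀]
    have sq : ∀ {x y : ℝ}, |x - y| ≤ C * m ^ 4 → (y - x) ^ 2 ≤ C ^ 2 * m ^ 8 := fun {x y} h => by
      have h3 := pow_le_pow_left₀ (abs_nonneg _) h 2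
      rw [sq_abs] at h3
      nlinarith
    have h1 := sq (h.diff_Q 0 h0T j)
    have h2 := pow_le_pow_left₀ (abs_nonneg _) (h.diff_P_fst 0 h0T j) 2
    have h3 := pow_le_pow_left₀ (abs_nonneg _) (h.diff_P_snd 0 h0T j) 2
    rw [sq_abs] at h2 h3
    unfold gradMul
    nlinarith
  have key := norm_le_of_norm_deriv_le
    (x := fun r => errEnergy N₁ N₂ α β (Qt r) (Pt r) (Q r) (P r)) (δ := 14 * C ^ 2 * m ^ 5)
    (K := (4 + 4 * K * C) * m ^ 3) (ε := 16 * C ^ 2 * m ^ 8)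
    (fun t ht => h.hasDerivWithinAt_errEnergy hs hc ht)
    (by rwa [Real.norm_of_nonneg (hE 0)]) (by positivity) (by positivity) (fun t ht => by
      rw [Real.norm_of_nonneg (hE t), Real.norm_eq_abs]
      refine (Finset.abs_sum_le_sum_abs _ _).trans ?_
      have hA : ∑ j ∈ box N₁ N₂, 2 * C ^ 2 * m ^ (8 + 3) ≤ 8 * (2 * C ^ 2) * m ^ 8 :=
        sum_box_le 8 hN (by positivity) hm.le fun j _ => le_rfl
      have hB := mul_le_mul_of_nonneg_left
        (errEnergy_lower (N₁ := N₁) (N₂ := N₂) (α := α) (β := β) (Qt t) (Pt t) (Q t) (P t))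
        (show 0 ≤ (4 + 4 * K * C) * m ^ 3 by positivity)
      rw [Finset.mul_sum] at hB
      have hAB := add_le_add hB hA
      rw [← Finset.sum_add_distrib] at hAB
      refine (Finset.sum_le_sum fun j _ => ?_).trans (hAB.trans (le_of_eq (by ring)))
      have hp := gradMul_self_nonneg (fun j => P t j - Pt t j) j
      have h1 := abs_gradMul_le (p := fun j => P t j - Pt t j)
        (g := fun j => dP t j + force α β (Qt t j)) (A := C * m ^ 4) (pow_pos hm 3)
        ((h.res_P_fst t ht j).trans (le_of_eq (by rw [mul_assoc, ← pow_add])))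
        ((h.res_P_snd t ht j).trans (le_of_eq (by rw [mul_assoc, ← pow_add])))
      have h2 : |(truncForce α β (Q t j) - truncForce α β (Qt t j)) *
          (dQ t j + laplacian (Pt t) j)| ≤ m ^ 3 * ((Q t j - Qt t j) ^ 2 + C ^ 2 * m ^ 8) := by
        refine (abs_mul_le_mul_abs (abs_truncForce_sub_le α β _ _) (h.res_Q t ht j)).trans ?_
        rw [← sq_abs (Q t j - Qt t j)]
        have h3 : 5 / 4 * |Q t j - Qt t j| * (C * m ^ 4) ≤
            |Q t j - Qt t j| ^ 2 + C ^ 2 * m ^ 8 := by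
          nlinarith [sq_nonneg (|Q t j - Qt t j| - C * m ^ 4), sq_nonneg (|Q t j - Qt t j|),
            sq_nonneg (C * m ^ 4)]
        have := mul_le_mul_of_nonneg_left h3 (pow_pos hm 3).le
        linarith
      have h4 : |(truncForce α β (Q t j) - truncForce α β (Qt t j) -
          forceDeriv α β (Qt t j) * (Q t j - Qt t j)) * dQ t j| ≤
          K * (Q t j - Qt t j) ^ 2 * (C * m ^ 3) :=
        abs_mul_le_mul_abs (abs_truncForce_taylor_le ((h.abs_Q t ht j).trans hc))
          (h.abs_dQ t ht j)
      refine (abs_add_le _ _).trans (le_trans (add_le_add ((abs_sub _ _).trans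
        (add_le_add ((abs_neg _).trans_le h1) h2)) h4) ?_)
      have h5 : 0 ≤ m ^ 3 * gradMul (fun j => P t j - Pt t j) (fun j => P t j - Pt t j) j :=
        mul_nonneg (pow_pos hm 3).le hp
      have h6 : 0 ≤ K * C *
          (m ^ 3 * gradMul (fun j => P t j - Pt t j) (fun j => P t j - Pt t j) j) :=
        mul_nonneg (mul_nonneg hK hC) h5
      nlinarith) t ht
  rw [Real.norm_of_nonneg (hE t)] at key
  refine key.trans (le_of_eq ?_)
  rw [← hT₀, mul_assoc _ (m ^ 3) T, mul_comm (m ^ 3) T]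
  ring

end

/-! ### Validity of the approximation -/

/-- Cauchy–Schwarz, with the bound given as a square so that no root appears. It is used with `V` a
multiple of 8B + 1, since 8B ≤ (8B + 1)². -/
theorem sum_abs_le_of_card_mul_sum_sq_le {ι : Type*} {s : Finset ι} {f : ι → ℝ} {V : ℝ}
    (hV : 0 ≤ V) (h : (s.card : ℝ) * ∑ i ∈ s, f i ^ 2 ≤ V ^ 2) : ∑ i ∈ s, |f i| ≤ V := by
  have h1 := sq_sum_le_card_mul_sum_sq (s := s) (f := fun i => |f i|)
  simp only [sq_abs] at h1
  exact (le_abs_self _).trans (abs_le_of_sq_le_sq (h1.trans h) hV)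

theorem mesh_box_bounds {N₁ N₂ : ℕ} (hm : mesh N₁ ≤ 1 / 2)
    (hn : |mesh N₂ - mesh N₁ ^ 2| ≤ 2 * mesh N₁ ^ 4) :
    (2 * (N₁ : ℝ) + 1) * (2 * (N₂ : ℝ) + 1) * mesh N₁ ^ 3 ≤ 8 ∧
    1 ≤ (2 * (N₁ : ℝ) + 1) * (2 * (N₂ : ℝ) + 1) * mesh N₁ ^ 3 ∧
    (2 * (N₂ : ℝ) + 1) * mesh N₁ ^ 2 ≤ 4 := by
  have h1 := mesh_mul N₁
  have h2 := mesh_mul N₂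
  have hm0 := mesh_pos N₁
  have hn0 := mesh_pos N₂
  set m := mesh N₁
  set n := mesh N₂
  have hb : 0 < 2 * (N₂ : ℝ) + 1 := by positivity
  have h3 : 2 * m ^ 4 ≤ m ^ 2 / 2 := by nlinarith [pow_pos hm0 2, pow_pos hm0 3]
  rw [abs_le] at hn
  have h4 : m ^ 2 ≤ 2 * n := by linarith [hn.1]
  have h5 : n ≤ 2 * m ^ 2 := by linarith [hn.2]
  have e : (2 * (N₁ : ℝ) + 1) * (2 * (N₂ : ℝ) + 1) * m ^ 3 = 2 * ((2 * (N₂ : ℝ) + 1) * m ^ 2) := by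
    linear_combination (2 * (N₂ : ℝ) + 1) * m ^ 2 * h1
  have h6 := mul_le_mul_of_nonneg_left h4 hb.le
  have h7 := mul_le_mul_of_nonneg_left h5 hb.le
  rw [e]
  refine ⟨?_, ?_, ?_⟩ <;> linarith

section

variable {N₁ N₂ : ℕ} {α β T C : ℝ} {Qa Pa Qt Pt dQ dP Q P : ℝ → ℤ × ℤ → ℝ}

/-- The Poincaré estimate divided by the number of sites. The mean contributes S m; the row of j
gives O(m²), from O(1/m) sites and energy O(m⁵); the columns also give O(m²), from O(m⁻³) sites
after division by 2N₁ + 1. -/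
theorem abs_le_of_sum_le {p : ℤ × ℤ → ℝ} {B S m : ℝ} (hm0 : 0 < m) (hm1 : m ≤ 1) (hB : 0 ≤ B)
    (h₁ : (2 * (N₁ : ℝ) + 1) * m = 2)
    (hN : (2 * (N₁ : ℝ) + 1) * (2 * (N₂ : ℝ) + 1) * m ^ 3 ≤ 8)
    (hN' : 1 ≤ (2 * (N₁ : ℝ) + 1) * (2 * (N₂ : ℝ) + 1) * m ^ 3)
    (h₂ : (2 * (N₂ : ℝ) + 1) * m ^ 2 ≤ 4)
    (hp : ∑ j ∈ box N₁ N₂, gradMul p p j ≤ B * m ^ 5)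
    (hS : m ^ 2 * |∑ j ∈ box N₁ N₂, p j| ≤ S) {j : ℤ × ℤ} (hj : j ∈ box N₁ N₂) :
    |p j| ≤ (S + 12 * (8 * B + 1)) * m := by
  set V := 8 * B + 1 with hV
  have hV0 : 0 ≤ V := by positivity
  have hVB : 8 * B ≤ V ^ 2 := by
    rw [hV]
    nlinarith
  set a := 2 * (N₁ : ℝ) + 1
  set b := 2 * (N₂ : ℝ) + 1
  have ha0 : 0 < a := by positivity
  have hb0 : 0 < b := by positivity
  have h3 : ∑ k ∈ box N₁ N₂, |p (k.1, k.2 + 1) - p k| ≤ V * m := by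
    refine sum_abs_le_of_card_mul_sum_sq_le (by positivity) ?_
    rw [card_box]
    have h4 : ∑ k ∈ box N₁ N₂, (p (k.1, k.2 + 1) - p k) ^ 2 ≤ B * m ^ 5 := by
      refine (Finset.sum_le_sum fun k _ => ?_).trans hp
      unfold gradMul
      nlinarith [mul_self_nonneg (p (k.1 + 1, k.2) - p k)]
    have h5 := mul_le_mul_of_nonneg_left h4 (mul_nonneg ha0.le hb0.le)
    have h6 := mul_le_mul_of_nonneg_right hN (show 0 ≤ B * m ^ 2 by positivity)
    have h7 := mul_le_mul_of_nonneg_right hVB (sq_nonneg m)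
    linarith
  have h4 : ∑ i ∈ Finset.Icc (-(N₁ : ℤ)) N₁, |p (i + 1, j.2) - p (i, j.2)| ≤ V * m ^ 2 := by
    refine sum_abs_le_of_card_mul_sum_sq_le (by positivity) ?_
    have h5 : ∑ i ∈ Finset.Icc (-(N₁ : ℤ)) N₁, (p (i + 1, j.2) - p (i, j.2)) ^ 2 ≤ B * m ^ 5 := by
      refine le_trans ?_ hp
      unfold box
      rw [Finset.sum_product_right]
      refine le_trans ?_ (Finset.single_le_sum (f := fun y => ∑ x ∈ Finset.Icc (-(N₁ : ℤ)) N₁,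
        gradMul p p (x, y)) (fun y _ => Finset.sum_nonneg fun x _ => gradMul_self_nonneg p _)
        (Finset.mem_product.1 hj).2)
      refine Finset.sum_le_sum fun i _ => ?_
      unfold gradMul
      nlinarith [mul_self_nonneg (p (i, j.2 + 1) - p (i, j.2))]
    have hcard : ((Finset.Icc (-(N₁ : ℤ)) N₁).card : ℝ) = a := by
      rw [Int.card_Icc, show ((N₁ : ℤ) + 1 - -(N₁ : ℤ)).toNat = 2 * N₁ + 1 by omega]
      push_cast
      rfl
    rw [hcard]
    have h6 := mul_le_mul_of_nonneg_left h5 ha0.le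
    have e : a * (B * m ^ 5) = 2 * B * m ^ 4 := by
      rw [← h₁]
      ring
    have h7 := mul_le_mul_of_nonneg_right hVB (show 0 ≤ m ^ 4 by positivity)
    have h8 : 0 ≤ B * m ^ 4 := by positivity
    rw [e] at h6
    linarith
  have h5 := abs_mul_sub_sum_le (N₁ := N₁) (N₂ := N₂) p hj
  have h6 := abs_sub_abs_le_abs_sub (a * b * p j) (∑ k ∈ box N₁ N₂, p k)
  rw [abs_mul, abs_of_pos (mul_pos ha0 hb0)] at h6
  have h7 : a * b * |p j| ≤ |∑ k ∈ box N₁ N₂, p k| + a * b * (V * m ^ 2) + b * (V * m) := by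
    have := mul_le_mul_of_nonneg_left h4 (mul_pos ha0 hb0).le
    have := mul_le_mul_of_nonneg_left h3 hb0.le
    linarith
  have h8 := mul_le_mul_of_nonneg_right h7 (pow_pos hm0 3).le
  have h9 := mul_le_mul_of_nonneg_right hN' (abs_nonneg (p j))
  have h10 := mul_le_mul_of_nonneg_right hS hm0.le
  have h11 := mul_le_mul_of_nonneg_right hN (show 0 ≤ V * m ^ 2 by positivity)
  have h12 := mul_le_mul_of_nonneg_right h₂ (show 0 ≤ V * m ^ 2 by positivity)
  have h13 : V * m ^ 2 ≤ V * m := mul_le_mul_of_nonneg_left (by nlinarith) hV0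
  nlinarith

/-- Differences of P do not determine its mean, so the mean is integrated directly. The derivative
of the total error of P is a sum of force differences and residuals, of size O(m) by Cauchy–Schwarz;
over times of order m⁻³ this yields O(m⁻²). -/
theorem ApproxSol.abs_sum_le (h : ApproxSol N₁ N₂ α β T C Qa Pa Qt Pt dQ dP)
    (hs : LatticeEq N₁ N₂ (truncForce α β) T Q P) (hP₀ : P 0 = Pa 0)
    (hc : C * mesh N₁ ^ 2 ≤ cutoff α β / 2) (hC : 0 ≤ C) (hT : 0 ≤ T)
    (hm1 : mesh N₁ ≤ 1) {B : ℝ} (hB : 0 ≤ B)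
    (hN : (2 * (N₁ : ℝ) + 1) * (2 * (N₂ : ℝ) + 1) * mesh N₁ ^ 3 ≤ 8)
    (hq : ∀ t ∈ Icc (-T) T, ∑ j ∈ box N₁ N₂, (Q t j - Qt t j) ^ 2 ≤ B * mesh N₁ ^ 5)
    {t : ℝ} (ht : t ∈ Icc (-T) T) :
    mesh N₁ ^ 2 * |∑ j ∈ box N₁ N₂, (P t j - Pt t j)| ≤
      8 * C + (5 / 4 * (8 * B + 1) + 8 * C) * (T * mesh N₁ ^ 3) := by
  set m := mesh N₁ with hm_def
  have hm : 0 < m := mesh_pos N₁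
  have hc0 := cutoff_pos α β
  have key := norm_le_of_norm_deriv_le (x := fun r => ∑ j ∈ box N₁ N₂, (P r j - Pt r j))
    (x' := fun r => ∑ j ∈ box N₁ N₂, (-truncForce α β (Q r j) - dP r j)) (δ := 8 * C) (K := 0)
    (ε := (5 / 4 * (8 * B + 1) + 8 * C) * m) (T := T)
    (fun t ht => HasDerivWithinAt.fun_sum fun j _ => (hs.deriv_P t ht j).sub (h.deriv_P t ht j))
    (by
      refine (Finset.abs_sum_le_sum_abs _ _).trans ((sum_box_le 0 hN hC hm.le fun j _ => ?_).trans
        (le_of_eq (by ring)))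
      rw [hP₀, abs_sub_comm, zero_add]
      exact h.diff_P 0 ⟨by linarith, hT⟩ j) le_rfl (by positivity) (fun t ht => by
      rw [zero_mul, zero_add]
      have h1 : ∑ j ∈ box N₁ N₂, |Q t j - Qt t j| ≤ (8 * B + 1) * m := by
        refine sum_abs_le_of_card_mul_sum_sq_le (by positivity) ?_
        rw [card_box]
        have h2 := mul_le_mul_of_nonneg_left (hq t ht)
          (show 0 ≤ (2 * (N₁ : ℝ) + 1) * (2 * (N₂ : ℝ) + 1) by positivity)
        have h3 := mul_le_mul_of_nonneg_right hN (show 0 ≤ B * m ^ 2 by positivity)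
        have h4 : 0 ≤ (64 * B ^ 2 + 8 * B + 1) * m ^ 2 := by positivity
        nlinarith
      have h2 : ∑ j ∈ box N₁ N₂, C * m ^ (3 + 3) ≤ 8 * C * m ^ 3 :=
        sum_box_le 3 hN hC hm.le fun _ _ => le_rfl
      have h3 : m ^ 3 ≤ m := by
        have := pow_le_one₀ hm.le hm1 (n := 2)
        nlinarith
      refine (norm_sum_le _ _).trans ?_
      have h4 : ∀ j ∈ box N₁ N₂, ‖-truncForce α β (Q t j) - dP t j‖ ≤
          5 / 4 * |Q t j - Qt t j| + C * m ^ (3 + 3) := fun j _ => by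
        have h5 := abs_truncForce_sub_le α β (Q t j) (Qt t j)
        have h6 := h.res_P t ht j
        rw [← truncForce_eq ((h.abs_Q t ht j).trans (by linarith))] at h6
        rw [Real.norm_eq_abs, show -truncForce α β (Q t j) - dP t j =
          -(truncForce α β (Q t j) - truncForce α β (Qt t j)) -
            (dP t j + truncForce α β (Qt t j)) by ring]
        refine (abs_sub _ _).trans (add_le_add ((abs_neg _).trans_le h5) h6)
      refine (Finset.sum_le_sum h4).trans ?_
      rw [Finset.sum_add_distrib, ← Finset.mul_sum]
      have h7 := mul_le_mul_of_nonneg_left h3 hC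
      linarith) t ht
  rw [zero_mul, Real.exp_zero, mul_one, Real.norm_eq_abs] at key
  have h1 := mul_le_mul_of_nonneg_left key (sq_nonneg m)
  have h2 : m ^ 2 * C ≤ C := mul_le_of_le_one_left hC (pow_le_one₀ hm.le hm1)
  nlinarith

/-- Each site is congruent to its centred remainder in the box, and periodic functions factor
through the residue classes. -/
theorem IsLatticePeriodic.abs_le_of_box {f : ℤ × ℤ → ℝ} {c : ℝ} (hf : IsLatticePeriodic N₁ N₂ f)
    (hc : ∀ j ∈ box N₁ N₂, |f j| ≤ c) (j : ℤ × ℤ) : |f j| ≤ c := by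
  have hmod : ∀ (N : ℕ) (a : ℤ), ((a + N) % (2 * (N : ℤ) + 1)) - N ∈ Finset.Icc (-(N : ℤ)) N := by
    intro N a
    have h1 := Int.emod_nonneg (a + N) (show (2 * (N : ℤ) + 1) ≠ 0 by omega)
    have h2 := Int.emod_lt_of_pos (a + N) (show 0 < (2 * (N : ℤ) + 1) by omega)
    rw [Finset.mem_Icc]
    omega
  have hcast : ∀ (N : ℕ) (a : ℤ),
      ((((a + N) % (2 * (N : ℤ) + 1)) - N : ℤ) : ZMod (2 * N + 1)) = a := by
    intro N a
    have h1 := ZMod.intCast_mod (a + N) (2 * N + 1)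
    push_cast at h1 ⊢
    rw [h1]
    ring
  have h1 := hf.toCell_cast j
  have h2 := hf.toCell_cast
    (((j.1 + N₁) % (2 * (N₁ : ℤ) + 1)) - N₁, ((j.2 + N₂) % (2 * (N₂ : ℤ) + 1)) - N₂)
  simp only [hcast] at h2
  rw [← h1, h2]
  exact hc _ (Finset.mem_product.2 ⟨hmod _ _, hmod _ _⟩)

theorem ApproxSol.sum_sq_sub_le (h : ApproxSol N₁ N₂ α β T C Qa Pa Qt Pt dQ dP)
    (hN : (2 * (N₁ : ℝ) + 1) * (2 * (N₂ : ℝ) + 1) * mesh N₁ ^ 3 ≤ 8) {t : ℝ}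
    (ht : t ∈ Icc (-T) T) (Q : ℤ × ℤ → ℝ) :
    ∑ j ∈ box N₁ N₂, (Q j - Qa t j) ^ 2 ≤
      2 * ∑ j ∈ box N₁ N₂, (Q j - Qt t j) ^ 2 + 16 * C ^ 2 * mesh N₁ ^ 5 := by
  have hm : 0 < mesh N₁ := mesh_pos N₁
  set m := mesh N₁ with hm_def
  have h1 : ∑ j ∈ box N₁ N₂, 2 * C ^ 2 * m ^ (5 + 3) ≤ 8 * (2 * C ^ 2) * m ^ 5 :=
    sum_box_le 5 hN (by positivity) hm.le fun _ _ => le_rfl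
  have h2 : ∑ j ∈ box N₁ N₂, (Q j - Qa t j) ^ 2 ≤
      ∑ j ∈ box N₁ N₂, (2 * (Q j - Qt t j) ^ 2 + 2 * C ^ 2 * m ^ (5 + 3)) := by
    refine Finset.sum_le_sum fun j _ => ?_
    have h3 := pow_le_pow_left₀ (abs_nonneg _) (h.diff_Q t ht j) 2
    rw [sq_abs, ← hm_def] at h3
    simp only [Nat.reduceAdd]
    nlinarith [sq_nonneg ((Q j - Qt t j) - (Qt t j - Qa t j))]
  rw [Finset.sum_add_distrib, ← Finset.mul_sum] at h2
  linarith

theorem ApproxSol.sum_gradMul_sub_le (h : ApproxSol N₁ N₂ α β T C Qa Pa Qt Pt dQ dP)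
    (hN : (2 * (N₁ : ℝ) + 1) * (2 * (N₂ : ℝ) + 1) * mesh N₁ ^ 3 ≤ 8) {t : ℝ}
    (ht : t ∈ Icc (-T) T) (P : ℤ × ℤ → ℝ) :
    ∑ j ∈ box N₁ N₂, gradMul (fun j => P j - Pa t j) (fun j => P j - Pa t j) j ≤
      2 * ∑ j ∈ box N₁ N₂, gradMul (fun j => P j - Pt t j) (fun j => P j - Pt t j) j +
        32 * C ^ 2 * mesh N₁ ^ 5 := by
  have hm : 0 < mesh N₁ := mesh_pos N₁
  set m := mesh N₁ with hm_def
  have h1 : ∑ j ∈ box N₁ N₂, 4 * C ^ 2 * m ^ (5 + 3) ≤ 8 * (4 * C ^ 2) * m ^ 5 :=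
    sum_box_le 5 hN (by positivity) hm.le fun _ _ => le_rfl
  have h2 : ∑ j ∈ box N₁ N₂, gradMul (fun j => P j - Pa t j) (fun j => P j - Pa t j) j ≤
      ∑ j ∈ box N₁ N₂, (2 * gradMul (fun j => P j - Pt t j) (fun j => P j - Pt t j) j +
        4 * C ^ 2 * m ^ (5 + 3)) := by
    refine Finset.sum_le_sum fun j _ => ?_
    have h3 := pow_le_pow_left₀ (abs_nonneg _) (h.diff_P_fst t ht j) 2
    have h4 := pow_le_pow_left₀ (abs_nonneg _) (h.diff_P_snd t ht j) 2
    rw [sq_abs, ← hm_def] at h3 h4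
    have key : ∀ a b c a' b' c' : ℝ, ((b - c) - (b' - c')) ^ 2 ≤ C ^ 2 * m ^ 8 →
        (a - c - (a' - c')) * (a - c - (a' - c')) ≤
          2 * ((a - b - (a' - b')) * (a - b - (a' - b'))) + 2 * C ^ 2 * m ^ 8 := by
      intro a b c a' b' c' h
      nlinarith [sq_nonneg ((a - b - (a' - b')) - (b - c - (b' - c')))]
    have h5 := key (P (j.1 + 1, j.2)) _ _ (P j) _ _ (h3.trans (le_of_eq (by ring)))
    have h6 := key (P (j.1, j.2 + 1)) _ _ (P j) _ _ (h4.trans (le_of_eq (by ring)))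
    simp only [gradMul, Nat.reduceAdd]
    linarith
  rw [Finset.sum_add_distrib, ← Finset.mul_sum] at h2
  linarith

/-- The lattice solutions with the initial datum of the approximate one exist and stay close
to it. -/
theorem exists_shadowing (α β T₀ : ℝ) {C : ℝ} (hC : 0 < C) (hT₀ : 0 < T₀) :
    ∃ μ₀ > 0, ∃ D > 0, ∀ (N₁ N₂ : ℕ) (Qa Pa Qt Pt dQ dP : ℝ → ℤ × ℤ → ℝ), mesh N₁ < μ₀ →
      |mesh N₂ - mesh N₁ ^ 2| ≤ 2 * mesh N₁ ^ 4 →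
      IsLatticePeriodic N₁ N₂ (Qa 0) → IsLatticePeriodic N₁ N₂ (Pa 0) →
      ApproxSol N₁ N₂ α β (T₀ / mesh N₁ ^ 3) C Qa Pa Qt Pt dQ dP →
      (∃ Q P, IsLatticeSolution N₁ N₂ α β (T₀ / mesh N₁ ^ 3) Q P ∧ Q 0 = Qa 0 ∧ P 0 = Pa 0) ∧
      ∀ Q P, IsLatticeSolution N₁ N₂ α β (T₀ / mesh N₁ ^ 3) Q P → Q 0 = Qa 0 → P 0 = Pa 0 →
        ∀ t ∈ Icc (-(T₀ / mesh N₁ ^ 3)) (T₀ / mesh N₁ ^ 3),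
          ∑ j ∈ box N₁ N₂, (Q t j - Qa t j) ^ 2 ≤ D * mesh N₁ ^ 5 ∧
          ∑ j ∈ box N₁ N₂, gradMul (fun j => P t j - Pa t j) (fun j => P t j - Pa t j) j ≤
            D * mesh N₁ ^ 5 ∧
          ∀ j ∈ box N₁ N₂, |P t j - Pa t j| ≤ D * mesh N₁ := by
  set c := cutoff α β with hc_def
  have hc0 : 0 < c := cutoff_pos α β
  have hK : 0 ≤ taylorConst α β := by unfold taylorConst; positivity
  set B := 4 * ((14 * C ^ 2 + 16 * C ^ 2 * T₀) * Real.exp ((4 + 4 * taylorConst α β * C) * T₀))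
    with hB_def
  have hB : 0 < B := by positivity
  set S := 8 * C + (5 / 4 * (8 * B + 1) + 8 * C) * T₀ with hS_def
  have hS : 0 < S := by positivity
  -- The threshold c/(2C) keeps the approximate Q within half the cutoff, and c²/(4B) does the same
  -- for the error.
  refine ⟨min (1 / 2) (min (c / (2 * C)) (c ^ 2 / (4 * B))), by positivity,
    2 * B + 32 * C ^ 2 + (S + 12 * (8 * B + 1)) + C, by positivity, ?_⟩
  intro N₁ N₂ Qa Pa Qt Pt dQ dP hμ hn hQper hPper h
  have hm : 0 < mesh N₁ := mesh_pos N₁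
  have hm12 : mesh N₁ ≤ 1 / 2 := (hμ.trans_le (min_le_left _ _)).le
  obtain ⟨hN, hN', hN₂⟩ := mesh_box_bounds hm12 hn
  have hm1 : mesh N₁ ≤ 1 := by linarith
  have hmm := mesh_mul N₁
  rw [mul_comm] at hmm
  set m := mesh N₁ with hm_def
  have hmc : m ≤ c / (2 * C) :=
    (hμ.trans_le ((min_le_right _ _).trans (min_le_left _ _))).le
  have hmB : m ≤ c ^ 2 / (4 * B) :=
    (hμ.trans_le ((min_le_right _ _).trans (min_le_right _ _))).le
  rw [le_div_iff₀ (by positivity)] at hmc hmB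
  have hCm : C * m ^ 2 ≤ c / 2 := by
    have : m ^ 2 ≤ m := by nlinarith
    nlinarith
  set T := T₀ / m ^ 3 with hT_def
  have hT : 0 < T := by positivity
  have hTm : T * m ^ 3 = T₀ := by rw [hT_def]; field_simp
  obtain ⟨Q, P, hs, hQ₀, hP₀⟩ := exists_latticeEq (K := 5 / 4) (by norm_num)
    (abs_truncForce_sub_le α β) hT.le hQper hPper
  have hE : ∀ t ∈ Icc (-T) T, ∑ j ∈ box N₁ N₂, (Q t j - Qt t j) ^ 2 ≤ B * m ^ 5 ∧
      ∑ j ∈ box N₁ N₂, gradMul (fun j => P t j - Pt t j) (fun j => P t j - Pt t j) j ≤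
        B * m ^ 5 := fun t ht => by
    have h1 := h.errEnergy_le hs hQ₀ hP₀ hCm hC.le hTm hT.le hN ht
    have h2 := (errEnergy_lower _ _ _ _).trans h1
    rw [Finset.sum_add_distrib, ← Finset.mul_sum, ← Finset.mul_sum] at h2
    have h3 : 0 ≤ ∑ j ∈ box N₁ N₂, (Q t j - Qt t j) ^ 2 := Finset.sum_nonneg fun _ _ => sq_nonneg _
    have h4 : 0 ≤ ∑ j ∈ box N₁ N₂,
        gradMul (fun j => P t j - Pt t j) (fun j => P t j - Pt t j) j :=
      Finset.sum_nonneg fun _ _ => gradMul_self_nonneg _ _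
    have h5 : B * m ^ 5 = 4 * ((14 * C ^ 2 + 16 * C ^ 2 * T₀) *
      Real.exp ((4 + 4 * taylorConst α β * C) * T₀) * m ^ 5) := by rw [hB_def]; ring
    rw [h5]
    constructor <;> linarith
  -- End of the bootstrap: one square is at most the whole sum B m⁵ ≤ c²/4, so Q never leaves the
  -- region where the truncated force is the true one.
  have hQc : ∀ t ∈ Icc (-T) T, ∀ j ∈ box N₁ N₂, |Q t j| ≤ c := fun t ht j hj => by
    have h1 := (Finset.single_le_sum (f := fun j => (Q t j - Qt t j) ^ 2)
      (fun _ _ => sq_nonneg _) hj).trans (hE t ht).1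
    have h2 : m ^ 5 ≤ m := by
      have := pow_le_one₀ hm.le hm1 (n := 4)
      nlinarith
    have h3 : |Q t j - Qt t j| ≤ c / 2 := by
      refine abs_le_of_sq_le_sq (h1.trans ?_) (by positivity)
      have := mul_le_mul_of_nonneg_left h2 hB.le
      linarith
    have h4 := h.abs_Q t ht j
    have h5 := abs_add_le (Q t j - Qt t j) (Qt t j)
    rw [sub_add_cancel] at h5
    linarith
  have hQc' : ∀ t ∈ Icc (-T) T, ∀ j, |Q t j| ≤ c := fun t ht j => by
    exact (hs.periodic_Q t ht).abs_le_of_box (hQc t ht) j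
  have hs' : LatticeEq N₁ N₂ (force α β) T Q P := ⟨hs.1, hs.2, hs.3, fun t ht j => by
    rw [← truncForce_eq (hQc' t ht j)]
    exact hs.deriv_P t ht j⟩
  refine ⟨⟨Q, P, isLatticeSolution_iff.2 hs', hQ₀, hP₀⟩, ?_⟩
  intro Q' P' hs'' hQ' hP' t ht
  obtain ⟨eQ, eP⟩ := hs'.unique (force_locally_lipschitz α β) (isLatticeSolution_iff.1 hs'')
    (hQ₀.trans hQ'.symm) (hP₀.trans hP'.symm) t ht
  rw [← eQ, ← eP]
  have hC2 : 0 ≤ C ^ 2 * m ^ 5 := by positivity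
  have hV : 0 ≤ (S + 12 * (8 * B + 1)) * m ^ 5 := by positivity
  have hC5 : 0 ≤ C * m ^ 5 := by positivity
  refine ⟨?_, ?_, fun j hj => ?_⟩
  · have h1 := h.sum_sq_sub_le hN ht (Q t)
    have h2 := (hE t ht).1
    linarith
  · have h1 := h.sum_gradMul_sub_le hN ht (P t)
    have h2 := (hE t ht).2
    linarith
  · have h1 := h.abs_sum_le hs hP₀ hCm hC.le hT.le hm1 hB.le hN (fun t ht => (hE t ht).1) ht
    rw [hTm, ← hS_def] at h1
    have h2 := abs_le_of_sum_le hm hm1 hB.le hmm hN hN' hN₂ (hE t ht).2 h1 hj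
    have h3 := h.diff_P t ht j
    have h4 := abs_add_le (P t j - Pt t j) (Pt t j - Pa t j)
    rw [sub_add_sub_cancel] at h4
    have h5 : m ^ 3 ≤ m := by
      have := pow_le_one₀ hm.le hm1 (n := 2)
      nlinarith
    have h6 := mul_le_mul_of_nonneg_left h5 hC.le
    have h7 : 0 ≤ (2 * B + 32 * C ^ 2) * m := by positivity
    linarith

end

/-! ### Discrete Fourier coefficients -/

/-- The discrete Fourier coefficient, normalized as an average over the lattice. -/
def lcoef (N₁ N₂ : ℕ) (f : ℤ × ℤ → ℂ) (k : ℤ × ℤ) : ℂ :=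
  (∑ j ∈ box N₁ N₂, f j * char2 (-k) (mesh N₁ * j.1) (mesh N₂ * j.2)) /
    ((2 * (N₁ : ℂ) + 1) * (2 * (N₂ : ℂ) + 1))

section

variable {N₁ N₂ : ℕ}

theorem latticeFourier_eq (Q : ℤ × ℤ → ℝ) (k : ℤ × ℤ) :
    latticeFourier N₁ N₂ Q k =
      (Real.sqrt ((2 * (N₁ : ℝ) + 1) * (2 * (N₂ : ℝ) + 1)) : ℂ) *
        lcoef N₁ N₂ (fun j => (Q j : ℂ)) k := by
  have hpos : 0 < (2 * (N₁ : ℝ) + 1) * (2 * (N₂ : ℝ) + 1) := by positivity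
  have hs : ((Real.sqrt ((2 * (N₁ : ℝ) + 1) * (2 * (N₂ : ℝ) + 1)) : ℝ) : ℂ) *
      ((Real.sqrt ((2 * (N₁ : ℝ) + 1) * (2 * (N₂ : ℝ) + 1)) : ℝ) : ℂ) =
      (2 * (N₁ : ℂ) + 1) * (2 * (N₂ : ℂ) + 1) := by
    rw [← Complex.ofReal_mul, Real.mul_self_sqrt hpos.le]
    push_cast
    rfl
  have hne : ((Real.sqrt ((2 * (N₁ : ℝ) + 1) * (2 * (N₂ : ℝ) + 1)) : ℝ) : ℂ) ≠ 0 := by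
    rw [Complex.ofReal_ne_zero]
    exact (Real.sqrt_pos.2 hpos).ne'
  have h1 : ∀ N : ℕ, (2 * (N : ℂ) + 1) ≠ 0 := fun N => by
    have : (2 * (N : ℝ) + 1) ≠ 0 := by positivity
    exact_mod_cast this
  have hsum : ∑ j ∈ box N₁ N₂, (Q j : ℂ) * Complex.exp (-(2 * (Real.pi : ℂ) * Complex.I *
      ((j.1 : ℂ) * (k.1 : ℂ) / (2 * (N₁ : ℂ) + 1) + (j.2 : ℂ) * (k.2 : ℂ) / (2 * (N₂ : ℂ) + 1)))) =
      ∑ j ∈ box N₁ N₂, (Q j : ℂ) * char2 (-k) (mesh N₁ * j.1) (mesh N₂ * j.2) := by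
    refine Finset.sum_congr rfl fun j _ => ?_
    rw [char2_neg_eq]
    congr 3
    unfold mesh
    have := h1 N₁
    have := h1 N₂
    push_cast
    field_simp
  unfold latticeFourier lcoef
  rw [hsum, ← hs]
  field_simp

/-- The squared normalization is the number of sites, four times the divisor of the specific energy;
with the 1/2 of the mode energy this leaves the factor 2. -/
theorem specificEnergy_eq (Q P : ℤ × ℤ → ℝ) {k : ℤ × ℤ} (hk : k ∈ box N₁ N₂) :
    specificEnergy N₁ N₂ Q P (waveVector N₁ N₂ k) =
      2 * (freqSq N₁ N₂ k * ‖lcoef N₁ N₂ (fun j => (P j : ℂ)) k‖ ^ 2 +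
        ‖lcoef N₁ N₂ (fun j => (Q j : ℂ)) k‖ ^ 2) := by
  have hpos : 0 < (2 * (N₁ : ℝ) + 1) * (2 * (N₂ : ℝ) + 1) := by positivity
  have e : ∀ f : ℤ × ℤ → ℝ, ‖latticeFourier N₁ N₂ f k‖ ^ 2 =
      ((2 * (N₁ : ℝ) + 1) * (2 * (N₂ : ℝ) + 1)) * ‖lcoef N₁ N₂ (fun j => (f j : ℂ)) k‖ ^ 2 := by
    intro f
    rw [latticeFourier_eq, norm_mul, mul_pow, Complex.norm_real, Real.norm_eq_abs, sq_abs,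
      Real.sq_sqrt hpos.le]
  rw [specificEnergy_waveVector N₁ N₂ Q P k hk, modeEnergy, e, e]
  have h1 : 2 * (N₁ : ℝ) + 1 ≠ 0 := by positivity
  have h2 : 2 * (N₂ : ℝ) + 1 ≠ 0 := by positivity
  field_simp

theorem lcoef_add (f g : ℤ × ℤ → ℂ) (k : ℤ × ℤ) :
    lcoef N₁ N₂ (fun j => f j + g j) k = lcoef N₁ N₂ f k + lcoef N₁ N₂ g k := by
  unfold lcoef
  rw [← add_div, ← Finset.sum_add_distrib]
  simp only [add_mul]

theorem lcoef_sub (f g : ℤ × ℤ → ℂ) (k : ℤ × ℤ) :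
    lcoef N₁ N₂ (fun j => f j - g j) k = lcoef N₁ N₂ f k - lcoef N₁ N₂ g k := by
  unfold lcoef
  rw [← sub_div, ← Finset.sum_sub_distrib]
  simp only [sub_mul]

theorem lcoef_const_mul (c : ℂ) (f : ℤ × ℤ → ℂ) (k : ℤ × ℤ) :
    lcoef N₁ N₂ (fun j => c * f j) k = c * lcoef N₁ N₂ f k := by
  unfold lcoef
  rw [← mul_div_assoc, Finset.mul_sum]
  simp only [mul_assoc]

theorem norm_card (N₁ N₂ : ℕ) : ‖(2 * (N₁ : ℂ) + 1) * (2 * (N₂ : ℂ) + 1)‖ =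
    (2 * (N₁ : ℝ) + 1) * (2 * (N₂ : ℝ) + 1) := by
  rw [show (2 * (N₁ : ℂ) + 1) * (2 * (N₂ : ℂ) + 1) =
    (((2 * (N₁ : ℝ) + 1) * (2 * (N₂ : ℝ) + 1) : ℝ) : ℂ) by push_cast; rfl, Complex.norm_real,
    Real.norm_of_nonneg (by positivity)]

/-- Cauchy–Schwarz for one coefficient; it turns the energy bound m⁵ into an error O(m⁸) of the
squared coefficient. -/
theorem card_mul_norm_lcoef_sq_le (f : ℤ × ℤ → ℂ) (k : ℤ × ℤ) :
    (2 * (N₁ : ℝ) + 1) * (2 * (N₂ : ℝ) + 1) * ‖lcoef N₁ N₂ f k‖ ^ 2 ≤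
      ∑ j ∈ box N₁ N₂, ‖f j‖ ^ 2 := by
  have hpos : 0 < (2 * (N₁ : ℝ) + 1) * (2 * (N₂ : ℝ) + 1) := by positivity
  have h1 : ‖∑ j ∈ box N₁ N₂, f j * char2 (-k) (mesh N₁ * j.1) (mesh N₂ * j.2)‖ ≤
      ∑ j ∈ box N₁ N₂, ‖f j‖ := by
    refine (norm_sum_le _ _).trans (le_of_eq (Finset.sum_congr rfl fun j _ => ?_))
    rw [norm_mul, norm_char2, mul_one]
  have h2 := sq_sum_le_card_mul_sum_sq (s := box N₁ N₂) (f := fun j => ‖f j‖)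
  rw [card_box] at h2
  have h3 := (pow_le_pow_left₀ (norm_nonneg _) h1 2).trans h2
  unfold lcoef
  rw [norm_div, norm_card, div_pow, sq ((2 * (N₁ : ℝ) + 1) * (2 * (N₂ : ℝ) + 1)), ← mul_div_assoc,
    mul_div_mul_left _ _ hpos.ne', div_le_iff₀ hpos]
  linarith

theorem char2_periodic (k : ℤ × ℤ) (j : ℤ × ℤ) :
    char2 k (mesh N₁ * ((j.1 + (2 * (N₁ : ℤ) + 1) : ℤ) : ℝ)) (mesh N₂ * j.2) =
      char2 k (mesh N₁ * j.1) (mesh N₂ * j.2) ∧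
    char2 k (mesh N₁ * j.1) (mesh N₂ * ((j.2 + (2 * (N₂ : ℤ) + 1) : ℤ) : ℝ)) =
      char2 k (mesh N₁ * j.1) (mesh N₂ * j.2) := by
  have e : ∀ (N : ℕ) (a : ℤ), mesh N * ((a + (2 * (N : ℤ) + 1) : ℤ) : ℝ) = mesh N * a + 2 := by
    intro N a
    rw [← mesh_mul N]
    push_cast
    ring
  constructor <;> rw [e] <;> unfold char2 <;> rw [char1_add_right, char1_two, mul_one]

theorem char2_step (k : ℤ × ℤ) (j : ℤ × ℤ) :
    char2 k (mesh N₁ * ((j.1 + 1 : ℤ) : ℝ)) (mesh N₂ * j.2) =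
      char1 k.1 (mesh N₁) * char2 k (mesh N₁ * j.1) (mesh N₂ * j.2) ∧
    char2 k (mesh N₁ * j.1) (mesh N₂ * ((j.2 + 1 : ℤ) : ℝ)) =
      char1 k.2 (mesh N₂) * char2 k (mesh N₁ * j.1) (mesh N₂ * j.2) := by
  unfold char2
  push_cast
  constructor <;> rw [mul_add, mul_one, char1_add_right] <;> ring

theorem norm_char1_sub_one_sq (n : ℤ) (y : ℝ) :
    ‖char1 n y - 1‖ ^ 2 = 4 * Real.sin (n * (Real.pi * y / 2)) ^ 2 := by
  have e : char1 n y = Complex.exp (((2 * (n * (Real.pi * y / 2)) : ℝ) : ℂ) * Complex.I) := by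
    unfold char1
    congr 1
    push_cast
    ring
  set x : ℝ := n * (Real.pi * y / 2)
  rw [e, ← Complex.normSq_eq_norm_sq, Complex.normSq_apply, Complex.sub_re, Complex.sub_im,
    Complex.exp_ofReal_mul_I_re, Complex.exp_ofReal_mul_I_im, Complex.one_re, Complex.one_im,
    Real.cos_two_mul, Real.sin_two_mul]
  have := Real.sin_sq_add_cos_sq x
  linear_combination (4 * Real.cos x ^ 2 - 4) * this

theorem mul_pi_mesh (N : ℕ) (n : ℤ) :
    (n : ℝ) * (Real.pi * mesh N / 2) = n * Real.pi / (2 * (N : ℝ) + 1) := by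
  unfold mesh
  ring

theorem freqSq_eq (k : ℤ × ℤ) : freqSq N₁ N₂ k =
    ‖char1 k.1 (mesh N₁) - 1‖ ^ 2 + ‖char1 k.2 (mesh N₂) - 1‖ ^ 2 := by
  rw [norm_char1_sub_one_sq, norm_char1_sub_one_sq, mul_pi_mesh, mul_pi_mesh, freqSq]

/-- A lattice step multiplies a coefficient by a character value, and `freqSq` is the squared
modulus of the symbol of the discrete gradient. The gradient energy thus bounds exactly the
combination that occurs in the mode energy. -/
theorem card_mul_freqSq_mul_norm_lcoef_sq_le {p : ℤ × ℤ → ℝ} (hp : IsLatticePeriodic N₁ N₂ p)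
    (k : ℤ × ℤ) :
    (2 * (N₁ : ℝ) + 1) * (2 * (N₂ : ℝ) + 1) *
      (freqSq N₁ N₂ k * ‖lcoef N₁ N₂ (fun j => (p j : ℂ)) k‖ ^ 2) ≤
      ∑ j ∈ box N₁ N₂, gradMul p p j := by
  have hneg : ∀ (n : ℤ) (y : ℝ), char1 n y * char1 (-n) y = 1 := fun n y => by
    rw [← char1_add_left, add_neg_cancel, char1_zero_left]
  have h1 := sum_box_shift_fst (N₁ := N₁) (N₂ := N₂)
    (f := fun j => (p j : ℂ) * char2 (-k) (mesh N₁ * j.1) (mesh N₂ * j.2))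
    (fun j => by simp only [(hp j).1, (char2_periodic (-k) j).1])
  have h2 := sum_box_shift_snd (N₁ := N₁) (N₂ := N₂)
    (f := fun j => (p j : ℂ) * char2 (-k) (mesh N₁ * j.1) (mesh N₂ * j.2))
    (fun j => by simp only [(hp j).2, (char2_periodic (-k) j).2])
  simp only [(char2_step (-k) _).1] at h1
  simp only [(char2_step (-k) _).2] at h2
  have e1 : lcoef N₁ N₂ (fun j => ((p (j.1 + 1, j.2) - p j : ℝ) : ℂ)) k =
      (char1 k.1 (mesh N₁) - 1) * lcoef N₁ N₂ (fun j => (p j : ℂ)) k := by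
    simp only [Complex.ofReal_sub]
    rw [lcoef_sub, sub_mul, one_mul]
    congr 1
    unfold lcoef
    rw [← h1, ← mul_div_assoc, Finset.mul_sum]
    congr 1
    refine Finset.sum_congr rfl fun j _ => ?_
    linear_combination (-(p (j.1 + 1, j.2) : ℂ) *
      char2 (-k) (mesh N₁ * j.1) (mesh N₂ * j.2)) * hneg k.1 (mesh N₁)
  have e2 : lcoef N₁ N₂ (fun j => ((p (j.1, j.2 + 1) - p j : ℝ) : ℂ)) k =
      (char1 k.2 (mesh N₂) - 1) * lcoef N₁ N₂ (fun j => (p j : ℂ)) k := by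
    simp only [Complex.ofReal_sub]
    rw [lcoef_sub, sub_mul, one_mul]
    congr 1
    unfold lcoef
    rw [← h2, ← mul_div_assoc, Finset.mul_sum]
    congr 1
    refine Finset.sum_congr rfl fun j _ => ?_
    linear_combination (-(p (j.1, j.2 + 1) : ℂ) *
      char2 (-k) (mesh N₁ * j.1) (mesh N₂ * j.2)) * hneg k.2 (mesh N₂)
  have h3 := card_mul_norm_lcoef_sq_le (N₁ := N₁) (N₂ := N₂)
    (fun j => ((p (j.1 + 1, j.2) - p j : ℝ) : ℂ)) k
  have h4 := card_mul_norm_lcoef_sq_le (N₁ := N₁) (N₂ := N₂)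
    (fun j => ((p (j.1, j.2 + 1) - p j : ℝ) : ℂ)) k
  rw [e1, norm_mul, mul_pow] at h3
  rw [e2, norm_mul, mul_pow] at h4
  simp only [Complex.norm_real, Real.norm_eq_abs, sq_abs] at h3 h4
  rw [freqSq_eq]
  have e3 : ∑ j ∈ box N₁ N₂, gradMul p p j = ∑ j ∈ box N₁ N₂, (p (j.1 + 1, j.2) - p j) ^ 2 +
      ∑ j ∈ box N₁ N₂, (p (j.1, j.2 + 1) - p j) ^ 2 := by
    rw [← Finset.sum_add_distrib]
    refine Finset.sum_congr rfl fun j _ => ?_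
    unfold gradMul
    ring
  rw [e3]
  linarith

theorem char1_mesh_ne_one {N : ℕ} {n : ℤ} (h0 : n ≠ 0) (h : |n| ≤ 2 * N) : char1 n (mesh N) ≠ 1 := by
  intro h1
  have h2 := norm_char1_sub_one_sq n (mesh N)
  rw [h1, sub_self, norm_zero, mul_pi_mesh] at h2
  have h3 : Real.sin (n * Real.pi / (2 * (N : ℝ) + 1)) = 0 := by
    have : Real.sin (n * Real.pi / (2 * (N : ℝ) + 1)) ^ 2 = 0 := by linarith
    exact pow_eq_zero_iff (two_ne_zero) |>.1 this
  rw [Real.sin_eq_zero_iff] at h3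
  obtain ⟨q, hq⟩ := h3
  have hN : (2 * (N : ℝ) + 1) ≠ 0 := by positivity
  rw [eq_div_iff hN] at hq
  have h4 : (q : ℝ) * (2 * N + 1) = n := by
    have hpi := Real.pi_ne_zero
    have : ((q : ℝ) * (2 * N + 1) - n) * Real.pi = 0 := by linarith
    have := (mul_eq_zero.1 this).resolve_right hpi
    linarith
  have h5 : q * (2 * N + 1) = n := by exact_mod_cast h4
  have h6 : q ≠ 0 := by
    rintro rfl
    simp at h5
    exact h0 h5.symm
  have h7 : 1 ≤ |q| := Int.one_le_abs h6
  rw [← h5, abs_mul, abs_of_nonneg (by positivity : (0 : ℤ) ≤ 2 * N + 1)] at h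
  nlinarith

/-- A shift multiplies the sum by a number c and leaves it invariant. Some c differs from 1, because
the components of l - k are at most 2N in modulus, less than the period 2N + 1. -/
theorem sum_char2_eq_zero {k l : ℤ × ℤ} (hk : k ∈ box N₁ N₂) (hl : l ∈ box N₁ N₂) (hne : l ≠ k) :
    ∑ j ∈ box N₁ N₂, char2 (l + -k) (mesh N₁ * j.1) (mesh N₂ * j.2) = 0 := by
  have h1 := sum_box_shift_fst (N₁ := N₁) (N₂ := N₂)
    (f := fun j => char2 (l + -k) (mesh N₁ * j.1) (mesh N₂ * j.2))
    (fun j => (char2_periodic _ j).1)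
  have h2 := sum_box_shift_snd (N₁ := N₁) (N₂ := N₂)
    (f := fun j => char2 (l + -k) (mesh N₁ * j.1) (mesh N₂ * j.2))
    (fun j => (char2_periodic _ j).2)
  simp only [(char2_step (l + -k) _).1, ← Finset.mul_sum] at h1
  simp only [(char2_step (l + -k) _).2, ← Finset.mul_sum] at h2
  have hk' := Finset.mem_product.1 hk
  have hl' := Finset.mem_product.1 hl
  rw [Finset.mem_Icc, Finset.mem_Icc] at hk' hl'
  have key : ∀ c s : ℂ, c ≠ 1 → c * s = s → s = 0 := fun c s hc h => by
    have : (c - 1) * s = 0 := by linear_combination h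
    exact (mul_eq_zero.1 this).resolve_left (sub_ne_zero.2 hc)
  by_cases h : l.1 = k.1
  · have h3 : l.2 ≠ k.2 := fun h4 => hne (Prod.ext h h4)
    refine key _ _ (char1_mesh_ne_one (N := N₂) (n := (l + -k).2) ?_ ?_) h2
    · simp only [Prod.snd_add, Prod.snd_neg]
      omega
    · simp only [Prod.snd_add, Prod.snd_neg]
      rw [abs_le]
      omega
  · refine key _ _ (char1_mesh_ne_one (N := N₁) (n := (l + -k).1) ?_ ?_) h1
    · simp only [Prod.fst_add, Prod.fst_neg]
      omega
    · simp only [Prod.fst_add, Prod.fst_neg]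
      rw [abs_le]
      omega

/-- exp(-x) ≤ 4!/x⁴ at x = r/(2m); the constant is 24 · 2⁴. -/
theorem exp_neg_div_le {r m : ℝ} (hr : 0 < r) (hm : 0 < m) :
    Real.exp (-(r / 2 * (1 / m))) ≤ 384 / r ^ 4 * m ^ 4 := by
  have hx : 0 < r / 2 * (1 / m) := by positivity
  have h := Real.pow_div_factorial_le_exp (r / 2 * (1 / m)) hx.le 4
  rw [Real.exp_neg]
  have h2 := inv_anti₀ (by positivity) h
  refine h2.trans (le_of_eq ?_)
  rw [show ((Nat.factorial 4 : ℕ) : ℝ) = 24 by norm_num [Nat.factorial]]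
  field_simp
  norm_num

/-- Sampling adds to the coefficient k only modes outside the box. For N₁ ≤ N₂ these satisfy |l₁| +
|l₂| ≥ N₁ + 1 > 1/m, so half of the decay makes the aliasing error smaller than any power of m and
the other half sums the series. -/
theorem norm_lcoef_sub_fc_le {r M : ℝ} (hr : 0 < r) {f : ℝ → ℝ → ℝ} (hf : Ana r M f)
    (hN : N₁ ≤ N₂) {k : ℤ × ℤ} (hk : k ∈ box N₁ N₂) :
    ‖lcoef N₁ N₂ (fun j => (f (mesh N₁ * j.1) (mesh N₂ * j.2) : ℂ)) k - fc f k‖ ≤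
      M * wtSum (r / 2) * (384 / r ^ 4) * mesh N₁ ^ 4 := by
  have hM := hf.nonneg
  set a := fc f with ha
  have hs := hf.summable hr
  set V : ℂ := (2 * (N₁ : ℂ) + 1) * (2 * (N₂ : ℂ) + 1) with hV
  have hpos : 0 < (2 * (N₁ : ℝ) + 1) * (2 * (N₂ : ℝ) + 1) := by positivity
  have hV0 : V ≠ 0 := by
    rw [← norm_pos_iff, hV, norm_card]
    exact hpos
  set S : ℤ × ℤ → ℂ := fun l =>
    (∑ j ∈ box N₁ N₂, char2 (l + -k) (mesh N₁ * j.1) (mesh N₂ * j.2)) / V with hS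
  have hS1 : ∀ l, ‖S l‖ ≤ 1 := fun l => by
    rw [hS]
    simp only
    rw [norm_div, hV, norm_card, div_le_one hpos]
    refine (norm_sum_le _ _).trans ?_
    simp only [norm_char2, Finset.sum_const, nsmul_eq_mul, mul_one]
    rw [card_box]
  have hSk : S k = 1 := by
    rw [hS]
    simp only [add_neg_cancel]
    have : ∀ y₁ y₂ : ℝ, char2 0 y₁ y₂ = 1 := fun y₁ y₂ => by simp [char2, char1_zero_left]
    simp only [this, Finset.sum_const, nsmul_eq_mul, mul_one]
    have h1 : ((box N₁ N₂).card : ℂ) = V := by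
      have := card_box N₁ N₂
      rw [hV]
      exact_mod_cast congrArg (fun x : ℝ => (x : ℂ)) this
    rw [h1, div_self hV0]
  have e1 : lcoef N₁ N₂ (fun j => (f (mesh N₁ * j.1) (mesh N₂ * j.2) : ℂ)) k =
      ∑' l, a l * S l := by
    unfold lcoef
    simp only [hf.eq]
    rw [← hV, div_eq_iff hV0, ← tsum_mul_right]
    have e2 : ∀ l, a l * S l * V =
        ∑ j ∈ box N₁ N₂, a l * char2 l (mesh N₁ * j.1) (mesh N₂ * j.2) *
          char2 (-k) (mesh N₁ * j.1) (mesh N₂ * j.2) := fun l => by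
      rw [hS]
      simp only
      rw [mul_assoc, div_mul_cancel₀ _ hV0, Finset.mul_sum]
      refine Finset.sum_congr rfl fun j _ => ?_
      rw [char2_add_left, mul_assoc]
    simp only [e2]
    rw [Summable.tsum_finsetSum fun j _ => (summable_fsum hs _ _).mul_right _]
    refine Finset.sum_congr rfl fun j _ => ?_
    rw [tsum_mul_right]
    rfl
  have hsum1 : Summable fun l => a l * S l := by
    refine Summable.of_norm_bounded hs fun l => ?_
    rw [norm_mul]
    exact mul_le_of_le_one_right (norm_nonneg _) (hS1 l)
  have hsum2 : HasSum (fun l => if l = k then a k else 0) (a k) := hasSum_ite_eq k (a k)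
  rw [e1, ← hsum2.tsum_eq, ← hsum1.tsum_sub hsum2.summable]
  have hm := mesh_pos N₁
  set E := Real.exp (-(r / 2 * (1 / mesh N₁))) with hE
  have hbound : ∀ l, ‖a l * S l - (if l = k then a k else 0)‖ ≤ M * E * wt (r / 2) l := by
    intro l
    have hnn : 0 ≤ M * E * wt (r / 2) l :=
      mul_nonneg (mul_nonneg hM (Real.exp_pos _).le) (wt_pos _ _).le
    by_cases h : l = k
    · rw [if_pos h, h, hSk, mul_one, sub_self, norm_zero, ← h]
      exact hnn
    rw [if_neg h, sub_zero]
    by_cases hl : l ∈ box N₁ N₂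
    · rw [hS]
      simp only
      rw [sum_char2_eq_zero hk hl h, zero_div, mul_zero, norm_zero]
      exact hnn
    · have h1 : (1 / mesh N₁) ≤ |(l.1 : ℝ)| + |(l.2 : ℝ)| := by
        have h2 : (N₁ : ℤ) + 1 ≤ |l.1| + |l.2| := by
          have h3 : ¬((-(N₁ : ℤ) ≤ l.1 ∧ l.1 ≤ N₁) ∧ (-(N₂ : ℤ) ≤ l.2 ∧ l.2 ≤ N₂)) := fun h4 =>
            hl (Finset.mem_product.2 ⟨Finset.mem_Icc.2 h4.1, Finset.mem_Icc.2 h4.2⟩)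
          rw [← abs_le, ← abs_le] at h3
          have h5 := abs_nonneg l.1
          have h6 := abs_nonneg l.2
          omega
        have h3 : ((N₁ : ℝ) + 1) ≤ |(l.1 : ℝ)| + |(l.2 : ℝ)| := by exact_mod_cast h2
        have h4 : 1 / mesh N₁ = N₁ + 1 / 2 := by
          unfold mesh
          have : 2 * (N₁ : ℝ) + 1 ≠ 0 := by positivity
          field_simp
        linarith
      have h2 : wt r l ≤ wt (r / 2) l * E := by
        unfold wt
        rw [hE, ← Real.exp_add, Real.exp_le_exp]
        nlinarith
      rw [norm_mul]
      calc ‖a l‖ * ‖S l‖ ≤ ‖a l‖ := mul_le_of_le_one_right (norm_nonneg _) (hS1 l)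
        _ ≤ M * wt r l := hf.bound l
        _ ≤ M * (wt (r / 2) l * E) := mul_le_mul_of_nonneg_left h2 hM
        _ = _ := by ring
  have h3 := tsum_of_norm_bounded ((summable_wt (half_pos hr)).mul_left (M * E)).hasSum hbound
  rw [tsum_mul_left] at h3
  have h4 := mul_le_mul_of_nonneg_left (exp_neg_div_le hr hm)
    (mul_nonneg hM (wtSum_nonneg (r / 2)))
  refine h3.trans (le_trans (le_of_eq ?_) (h4.trans (le_of_eq (by ring))))
  unfold wtSum
  ring

end

/-! ### The energies of the modes -/

theorem abs_norm_sq_sub_le {u v : ℂ} {e B : ℝ} (h : ‖u - v‖ ≤ e) (hv : ‖v‖ ≤ B) :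
    |‖u‖ ^ 2 - ‖v‖ ^ 2| ≤ e * (2 * B + e) := by
  have h1 := abs_norm_sub_norm_le u v
  have he : 0 ≤ e := (norm_nonneg _).trans h
  have h2 : ‖u‖ + ‖v‖ ≤ 2 * B + e := by
    have := norm_sub_norm_le u v
    linarith
  rw [show ‖u‖ ^ 2 - ‖v‖ ^ 2 = (‖u‖ - ‖v‖) * (‖u‖ + ‖v‖) by ring]
  exact abs_mul_le_mul_abs (h1.trans h) (by rwa [abs_of_nonneg (by positivity)])

/-- 4 sin²x = 2(1 - cos 2x), so for |2x| ≤ 1 this is the Taylor bound of the cosine; for larger |x|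
the quartic term dominates trivially. -/
theorem abs_four_mul_sin_sq_sub_le (x : ℝ) : |4 * Real.sin x ^ 2 - 4 * x ^ 2| ≤ 16 * x ^ 4 := by
  have hcos : Real.cos (2 * x) = 1 - 2 * Real.sin x ^ 2 := by
    rw [Real.cos_two_mul]
    linarith [Real.sin_sq_add_cos_sq x]
  by_cases h : |2 * x| ≤ 1
  · have h1 := Real.cos_bound h
    have h2 : |2 * x| ^ 4 = 16 * x ^ 4 := by
      rw [← abs_pow, abs_of_nonneg (by positivity)]
      ring
    rw [hcos, h2, abs_le] at h1
    have h3 : 0 ≤ x ^ 4 := by positivity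
    rw [abs_le]
    constructor <;> linarith [h1.1, h1.2]
  · push Not at h
    have h1 : 1 ≤ 4 * x ^ 2 := by
      have := pow_le_pow_left₀ zero_le_one h.le 2
      rw [sq_abs] at this
      linarith
    have h2 : Real.sin x ^ 2 ≤ x ^ 2 := Real.sin_sq_le_sq
    rw [abs_le]
    constructor <;> nlinarith [sq_nonneg (Real.sin x), sq_nonneg x]

section

variable {N₁ N₂ : ℕ}

theorem freqSq_nonneg (k : ℤ × ℤ) : 0 ≤ freqSq N₁ N₂ k := by unfold freqSq; positivity

theorem freqSq_le (k : ℤ × ℤ) : freqSq N₁ N₂ k ≤ 8 := by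
  unfold freqSq
  linarith [Real.sin_sq_le_one ((k.1 : ℝ) * Real.pi / (2 * (N₁ : ℝ) + 1)),
    Real.sin_sq_le_one ((k.2 : ℝ) * Real.pi / (2 * (N₂ : ℝ) + 1))]

/-- The transverse part is already O(m⁴ k₂²) because n = O(m²), so only the longitudinal frequency
survives at order m². The powers of k are absorbed later by `pow_mul_wt_le`. -/
theorem abs_freqSq_sub_le (hn : mesh N₂ ≤ 2 * mesh N₁ ^ 2) (k : ℤ × ℤ) :
    |freqSq N₁ N₂ k - (Real.pi * k.1 * mesh N₁) ^ 2| ≤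
      mesh N₁ ^ 4 * (Real.pi ^ 4 * (|(k.1 : ℝ)| + |(k.2 : ℝ)|) ^ 4 +
        4 * Real.pi ^ 2 * (|(k.1 : ℝ)| + |(k.2 : ℝ)|) ^ 2) := by
  have hm := mesh_pos N₁
  have hn0 := mesh_pos N₂
  set m := mesh N₁ with hm_def
  unfold freqSq
  rw [← mul_pi_mesh, ← mul_pi_mesh, ← hm_def]
  have h1 := abs_four_mul_sin_sq_sub_le (k.1 * (Real.pi * m / 2))
  have h2 : 4 * Real.sin (k.2 * (Real.pi * mesh N₂ / 2)) ^ 2 ≤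
      m ^ 4 * (4 * Real.pi ^ 2 * |(k.2 : ℝ)| ^ 2) := by
    refine (mul_le_mul_of_nonneg_left Real.sin_sq_le_sq (by norm_num)).trans ?_
    have h3 := pow_le_pow_left₀ hn0.le hn 2
    have h4 := mul_le_mul_of_nonneg_left h3 (show 0 ≤ Real.pi ^ 2 * (k.2 : ℝ) ^ 2 by positivity)
    rw [sq_abs]
    linarith
  have h3 : 16 * (k.1 * (Real.pi * m / 2)) ^ 4 = m ^ 4 * (Real.pi ^ 4 * |(k.1 : ℝ)| ^ 4) := by
    rw [← abs_pow, abs_of_nonneg (by positivity : 0 ≤ (k.1 : ℝ) ^ 4)]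
    ring
  have h4 : |(k.1 : ℝ)| ^ 4 ≤ (|(k.1 : ℝ)| + |(k.2 : ℝ)|) ^ 4 :=
    pow_le_pow_left₀ (abs_nonneg _) (le_add_of_nonneg_right (abs_nonneg _)) 4
  have h5 : |(k.2 : ℝ)| ^ 2 ≤ (|(k.1 : ℝ)| + |(k.2 : ℝ)|) ^ 2 :=
    pow_le_pow_left₀ (abs_nonneg _) (le_add_of_nonneg_left (abs_nonneg _)) 2
  rw [show 4 * Real.sin (k.1 * (Real.pi * m / 2)) ^ 2 +
      4 * Real.sin (k.2 * (Real.pi * mesh N₂ / 2)) ^ 2 - (Real.pi * k.1 * m) ^ 2 =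
      (4 * Real.sin (k.1 * (Real.pi * m / 2)) ^ 2 - 4 * (k.1 * (Real.pi * m / 2)) ^ 2) +
      4 * Real.sin (k.2 * (Real.pi * mesh N₂ / 2)) ^ 2 by ring, mul_add]
  refine (abs_add_le _ _).trans (add_le_add (h1.trans ?_) ?_)
  · rw [h3]
    exact mul_le_mul_of_nonneg_left (mul_le_mul_of_nonneg_left h4 (by positivity)) (by positivity)
  · rw [abs_of_nonneg (by positivity)]
    exact h2.trans (mul_le_mul_of_nonneg_left (mul_le_mul_of_nonneg_left h5 (by positivity))
      (by positivity))

theorem pow_mul_wt_le {r : ℝ} (hr : 0 < r) (p : ℕ) (k : ℤ × ℤ) :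
    (|(k.1 : ℝ)| + |(k.2 : ℝ)|) ^ p * wt r k ≤ p.factorial / r ^ p := by
  have hx : 0 ≤ r * (|(k.1 : ℝ)| + |(k.2 : ℝ)|) := by positivity
  have h := Real.pow_div_factorial_le_exp _ hx p
  unfold wt
  rw [Real.exp_neg, ← div_eq_mul_inv, div_le_div_iff₀ (Real.exp_pos _) (by positivity)]
  rw [div_le_iff₀ (by positivity), mul_pow] at h
  linarith

/-- The energy of a mode of a profile that travels on the lattice. -/
theorem exists_mode_bound {r M : ℝ} (hr : 0 < r) (hM : 0 ≤ M) :
    ∃ C > 0, ∀ (N₁ N₂ : ℕ) (F G : ℝ → ℝ → ℝ), mesh N₁ ≤ 1 → N₁ ≤ N₂ → mesh N₂ ≤ 2 * mesh N₁ ^ 2 →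
      Ana r M F → Ana r M G → ZeroMean F → ZeroMean G → ∀ (c₁ c₂ : ℝ), ∀ k ∈ box N₁ N₂,
      |‖lcoef N₁ N₂ (fun j => ((mesh N₁ ^ 2 * (1 / Real.sqrt 2 *
          (F (mesh N₁ * j.1 + c₁) (mesh N₂ * j.2) + G (mesh N₁ * j.1 + c₂) (mesh N₂ * j.2))) : ℝ) :
          ℂ)) k‖ ^ 2 - mesh N₁ ^ 4 / 2 *
          ‖char1 k.1 c₁ * fc F k + char1 k.1 c₂ * fc G k‖ ^ 2| ≤ C * mesh N₁ ^ 6 ∧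
      |freqSq N₁ N₂ k * ‖lcoef N₁ N₂ (fun j => ((mesh N₁ * (1 / Real.sqrt 2 *
          (antideriv F (mesh N₁ * j.1 + c₁) (mesh N₂ * j.2) -
            antideriv G (mesh N₁ * j.1 + c₂) (mesh N₂ * j.2))) : ℝ) : ℂ)) k‖ ^ 2 - mesh N₁ ^ 4 / 2 *
          ‖char1 k.1 c₁ * fc F k - char1 k.1 c₂ * fc G k‖ ^ 2| ≤ C * mesh N₁ ^ 6 := by
  set A := M * wtSum (r / 2) * (384 / r ^ 4) with hA_def
  have hA : 0 ≤ A := mul_nonneg (mul_nonneg hM (wtSum_nonneg _)) (by positivity)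
  set W := Real.pi ^ 4 * (24 / r ^ 4) + 4 * Real.pi ^ 2 * (2 / r ^ 2) with hW_def
  have hW : 0 ≤ W := by positivity
  refine ⟨8 * A * (4 * M + 2 * A) + 2 * M ^ 2 * W + 1, by positivity, ?_⟩
  intro N₁ N₂ F G hm1 hN hn hF hG hF0 hG0 c₁ c₂ k hk
  have hm := mesh_pos N₁
  set m := mesh N₁ with hm_def
  have hm4 : m ^ 4 ≤ 1 := pow_le_one₀ hm.le hm1
  have h2 : ‖((1 / Real.sqrt 2 : ℝ) : ℂ)‖ ^ 2 = 1 / 2 := by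
    rw [Complex.norm_real, Real.norm_eq_abs, sq_abs, div_pow, Real.sq_sqrt (by norm_num), one_pow]
  have est : ∀ {f : ℝ → ℝ → ℝ} (_ : Ana r M f) (c : ℝ),
      ‖lcoef N₁ N₂ (fun j => (f (m * j.1 + c) (mesh N₂ * j.2) : ℂ)) k - char1 k.1 c * fc f k‖ ≤
        A * m ^ 4 := fun {f} hf c => by
    have h3 := norm_lcoef_sub_fc_le hr (hf.shift hr c) hN hk
    rwa [fc_shift hr hf] at h3
  have nrm : ∀ {f : ℝ → ℝ → ℝ} (_ : Ana r M f) (c : ℝ), ‖char1 k.1 c * fc f k‖ ≤ M * wt r k :=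
    fun {f} hf c => by
      rw [norm_mul, norm_char1, one_mul]
      exact hf.bound k
  have hw1 : wt r k ≤ 1 := wt_le_one hr.le k
  have hMw : M * wt r k ≤ M := mul_le_of_le_one_right hM hw1
  have close : ∀ {u v u' v' : ℂ}, ‖u - u'‖ ≤ A * m ^ 4 → ‖v - v'‖ ≤ A * m ^ 4 →
      ‖u'‖ ≤ M * wt r k → ‖v'‖ ≤ M * wt r k →
      |‖u + v‖ ^ 2 - ‖u' + v'‖ ^ 2| ≤ 2 * A * m ^ 4 * (4 * M + 2 * A) := by
    intro u v u' v' h1 h2 h3 h4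
    have h5 : ‖(u + v) - (u' + v')‖ ≤ 2 * A * m ^ 4 := by
      rw [add_sub_add_comm]
      exact (norm_add_le _ _).trans (by linarith)
    have h6 : ‖u' + v'‖ ≤ 2 * M := (norm_add_le _ _).trans (by linarith)
    refine (abs_norm_sq_sub_le h5 h6).trans (mul_le_mul_of_nonneg_left ?_ (by positivity))
    have := mul_le_mul_of_nonneg_left hm4 (show 0 ≤ 2 * A by positivity)
    linarith
  have hm86 : m ^ 8 ≤ m ^ 6 := pow_le_pow_of_le_one hm.le hm1 (by norm_num)
  have hAM : 0 ≤ A * (4 * M + 2 * A) := by positivity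
  have hMW : 0 ≤ M ^ 2 * W := by positivity
  have hm6 : 0 < m ^ 6 := pow_pos hm 6
  constructor
  · have e : lcoef N₁ N₂ (fun j => ((m ^ 2 * (1 / Real.sqrt 2 *
          (F (m * j.1 + c₁) (mesh N₂ * j.2) + G (m * j.1 + c₂) (mesh N₂ * j.2))) : ℝ) : ℂ)) k =
        (m : ℂ) ^ 2 * (((1 / Real.sqrt 2 : ℝ) : ℂ) *
          (lcoef N₁ N₂ (fun j => (F (m * j.1 + c₁) (mesh N₂ * j.2) : ℂ)) k +
          lcoef N₁ N₂ (fun j => (G (m * j.1 + c₂) (mesh N₂ * j.2) : ℂ)) k)) := by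
      rw [← lcoef_add, ← lcoef_const_mul, ← lcoef_const_mul]
      congr 1
      funext j
      push_cast
      rfl
    have h3 := close (est hF c₁) (est hG c₂) (nrm hF c₁) (nrm hG c₂)
    rw [e, norm_mul, norm_mul, mul_pow, mul_pow, h2, norm_pow, Complex.norm_real,
      Real.norm_of_nonneg hm.le, show ∀ x y : ℝ, (m ^ 2) ^ 2 * (1 / 2 * x) - m ^ 4 / 2 * y =
        m ^ 4 / 2 * (x - y) from fun x y => by ring, abs_mul, abs_of_pos (by positivity)]
    refine (mul_le_mul_of_nonneg_left h3 (by positivity)).trans ?_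
    have h4 := mul_le_mul_of_nonneg_left hm86 hAM
    have h5 := mul_nonneg hAM hm6.le
    have h6 := mul_nonneg hMW hm6.le
    linarith
  · have e : lcoef N₁ N₂ (fun j => ((m * (1 / Real.sqrt 2 *
          (antideriv F (m * j.1 + c₁) (mesh N₂ * j.2) -
            antideriv G (m * j.1 + c₂) (mesh N₂ * j.2))) : ℝ) : ℂ)) k =
        (m : ℂ) * (((1 / Real.sqrt 2 : ℝ) : ℂ) *
          (lcoef N₁ N₂ (fun j => (antideriv F (m * j.1 + c₁) (mesh N₂ * j.2) : ℂ)) k -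
          lcoef N₁ N₂ (fun j => (antideriv G (m * j.1 + c₂) (mesh N₂ * j.2) : ℂ)) k)) := by
      rw [← lcoef_sub, ← lcoef_const_mul, ← lcoef_const_mul]
      congr 1
      funext j
      push_cast
      rfl
    have hX := hF.antideriv hr hF0
    have hY := hG.antideriv hr hG0
    have hXc := hF.fc_antideriv hr hF0
    have hYc := hG.fc_antideriv hr hG0
    set z := char1 k.1 c₁ * fc (antideriv F) k - char1 k.1 c₂ * fc (antideriv G) k with hz
    have hzw : ‖z‖ ≤ 2 * (M * wt r k) :=
      (norm_sub_le _ _).trans (by linarith [nrm hX c₁, nrm hY c₂])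
    have hdiv : ∀ {f : ℝ → ℝ → ℝ}, ZeroMean f → fc f k =
        (Real.pi : ℂ) * Complex.I * k.1 * divFst (fc f) k := by
      intro f hf
      unfold divFst
      by_cases h : k.1 = 0
      · have h5 := hf k.2
        rw [← h] at h5
        rw [h, Int.cast_zero, mul_zero, zero_mul]
        exact h5
      · rw [mul_div_cancel₀]
        simp [Real.pi_ne_zero, h]
    -- Multiplication by (πk₁)² converts the coefficients of the primitives into those of the
    -- profiles; together with the frequency π k₁ m it gives P the same order m⁴ as Q.
    have hz2 : ‖char1 k.1 c₁ * fc F k - char1 k.1 c₂ * fc G k‖ ^ 2 =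
        (Real.pi * k.1) ^ 2 * ‖z‖ ^ 2 := by
      have e2 : char1 k.1 c₁ * fc F k - char1 k.1 c₂ * fc G k =
          ((Real.pi * k.1 : ℝ) : ℂ) * Complex.I * z := by
        rw [hdiv hF0, hdiv hG0, hz, hXc, hYc]
        push_cast
        ring
      rw [e2, norm_mul, norm_mul, Complex.norm_I, mul_one, Complex.norm_real, mul_pow,
        Real.norm_eq_abs, sq_abs]
    have hclose := close (u := lcoef N₁ N₂ (fun j => (antideriv F (m * j.1 + c₁) (mesh N₂ * j.2) : ℂ)) k)
      (v := -lcoef N₁ N₂ (fun j => (antideriv G (m * j.1 + c₂) (mesh N₂ * j.2) : ℂ)) k)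
      (v' := -(char1 k.1 c₂ * fc (antideriv G) k))
      (est hX c₁) (by rw [← neg_sub', norm_neg]; exact est hY c₂) (nrm hX c₁)
      (by rw [norm_neg]; exact nrm hY c₂)
    rw [← sub_eq_add_neg, ← sub_eq_add_neg, ← hz] at hclose
    have hom := abs_freqSq_sub_le hn k
    rw [← hm_def] at hom
    set x := |(k.1 : ℝ)| + |(k.2 : ℝ)| with hx
    have hz3 : ‖z‖ ^ 2 ≤ 4 * M ^ 2 * wt r k := by
      have h5 := pow_le_pow_left₀ (norm_nonneg _) hzw 2
      have h6 : wt r k ^ 2 ≤ wt r k := by nlinarith [wt_pos r k]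
      have h7 := mul_le_mul_of_nonneg_left h6 (show 0 ≤ 4 * M ^ 2 by positivity)
      linarith
    have h4 := pow_mul_wt_le hr 4 k
    have h5 := pow_mul_wt_le hr 2 k
    rw [← hx, show ((Nat.factorial 4 : ℕ) : ℝ) = 24 by norm_num [Nat.factorial]] at h4
    rw [← hx, show ((Nat.factorial 2 : ℕ) : ℝ) = 2 by norm_num [Nat.factorial]] at h5
    have h6 : |(freqSq N₁ N₂ k - (Real.pi * k.1 * m) ^ 2) * ‖z‖ ^ 2| ≤ m ^ 4 * (4 * M ^ 2 * W) := by
      refine (abs_mul_le_mul_abs hom ((abs_of_nonneg (sq_nonneg _)).trans_le hz3)).trans ?_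
      have h7 : (Real.pi ^ 4 * x ^ 4 + 4 * Real.pi ^ 2 * x ^ 2) * wt r k ≤ W := by
        have := mul_le_mul_of_nonneg_left h4 (show 0 ≤ Real.pi ^ 4 by positivity)
        have := mul_le_mul_of_nonneg_left h5 (show 0 ≤ 4 * Real.pi ^ 2 by positivity)
        rw [hW_def]
        linarith
      have := mul_le_mul_of_nonneg_left h7 (show 0 ≤ m ^ 4 * (4 * M ^ 2) by positivity)
      linarith
    have h7 := abs_mul_le_mul_abs ((abs_of_nonneg (freqSq_nonneg (N₁ := N₁) (N₂ := N₂) k)).trans_le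
      (freqSq_le k)) hclose
    rw [e, norm_mul, norm_mul, mul_pow, mul_pow, h2, Complex.norm_real, Real.norm_of_nonneg hm.le,
      hz2]
    set w := lcoef N₁ N₂ (fun j => (antideriv F (m * j.1 + c₁) (mesh N₂ * j.2) : ℂ)) k -
      lcoef N₁ N₂ (fun j => (antideriv G (m * j.1 + c₂) (mesh N₂ * j.2) : ℂ)) k with hw
    rw [show freqSq N₁ N₂ k * (m ^ 2 * (1 / 2 * ‖w‖ ^ 2)) -
        m ^ 4 / 2 * ((Real.pi * k.1) ^ 2 * ‖z‖ ^ 2) =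
        m ^ 2 / 2 * (freqSq N₁ N₂ k * (‖w‖ ^ 2 - ‖z‖ ^ 2) +
          (freqSq N₁ N₂ k - (Real.pi * k.1 * m) ^ 2) * ‖z‖ ^ 2) by ring, abs_mul,
      abs_of_pos (by positivity)]
    refine (mul_le_mul_of_nonneg_left ((abs_add_le _ _).trans (add_le_add h7 h6))
      (by positivity)).trans ?_
    have h9 := mul_nonneg hAM hm6.le
    linarith

/-- The reference coefficient is O(m²) and the error O(m⁴), so the squares differ by O(m⁶). -/
theorem abs_norm_sq_sub_half_le {u v : ℂ} {m C D M Z : ℝ} (hm0 : 0 < m) (hm1 : m ≤ 1) (hC : 0 ≤ C)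
    (hD : 0 ≤ D) (hZ : Z ≤ 4 * M ^ 2) (huv : ‖u - v‖ ^ 2 ≤ D * m ^ 8)
    (hv : |‖v‖ ^ 2 - m ^ 4 / 2 * Z| ≤ C * m ^ 6) :
    |‖u‖ ^ 2 - m ^ 4 / 2 * Z| ≤ (C + (D + 1) * (2 * (2 * M ^ 2 + C + 1) + (D + 1))) * m ^ 6 := by
  set B := 2 * M ^ 2 + C + 1 with hB_def
  have hB : 1 ≤ B := by
    rw [hB_def]
    nlinarith [sq_nonneg M]
  have h1 : ‖u - v‖ ≤ (D + 1) * m ^ 4 := by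
    rw [← abs_norm]
    refine abs_le_of_sq_le_sq (huv.trans ?_) (by positivity)
    have : 0 ≤ (D ^ 2 + D + 1) * m ^ 8 := by positivity
    nlinarith
  have h64 : m ^ 6 ≤ m ^ 4 := pow_le_pow_of_le_one hm0.le hm1 (by norm_num)
  have h42 : m ^ 4 ≤ m ^ 2 := pow_le_pow_of_le_one hm0.le hm1 (by norm_num)
  have h2 : ‖v‖ ≤ B * m ^ 2 := by
    rw [← abs_norm]
    refine abs_le_of_sq_le_sq ?_ (by positivity)
    have h3 := (abs_le.1 hv).2
    have h4 := mul_le_mul_of_nonneg_left hZ (show 0 ≤ m ^ 4 / 2 by positivity)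
    have h5 := mul_le_mul_of_nonneg_left h64 hC
    have h6 : B * m ^ 4 ≤ B ^ 2 * m ^ 4 :=
      mul_le_mul_of_nonneg_right (by nlinarith) (by positivity)
    have h7 : 0 < m ^ 4 := by positivity
    have h8 : B * m ^ 4 = 2 * M ^ 2 * m ^ 4 + C * m ^ 4 + m ^ 4 := by rw [hB_def]; ring
    have h9 : (B * m ^ 2) ^ 2 = B ^ 2 * m ^ 4 := by ring
    rw [h9]
    linarith
  have h3 := abs_norm_sq_sub_le h1 h2
  have h4 : (D + 1) * m ^ 4 * (2 * (B * m ^ 2) + (D + 1) * m ^ 4) ≤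
      (D + 1) * (2 * B + (D + 1)) * m ^ 6 := by
    have h5 := mul_le_mul_of_nonneg_left h42 (show 0 ≤ D + 1 by linarith)
    have h6 := mul_le_mul_of_nonneg_left h5 (show 0 ≤ (D + 1) * m ^ 4 by positivity)
    linarith
  rw [show ‖u‖ ^ 2 - m ^ 4 / 2 * Z = (‖u‖ ^ 2 - ‖v‖ ^ 2) + (‖v‖ ^ 2 - m ^ 4 / 2 * Z) by ring]
  refine (abs_add_le _ _).trans ((add_le_add (h3.trans h4) hv).trans (le_of_eq ?_))
  ring

theorem isLatticePeriodic_approx {r M : ℝ} (hr : 0 < r) {ξ η : ℝ → ℝ → ℝ → ℝ} {t : ℝ}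
    (hξ : Ana r M (ξ (mesh N₁ ^ 3 * t))) (hη : Ana r M (η (mesh N₁ ^ 3 * t)))
    (hξ0 : ZeroMean (ξ (mesh N₁ ^ 3 * t))) (hη0 : ZeroMean (η (mesh N₁ ^ 3 * t))) :
    IsLatticePeriodic N₁ N₂ (approxQ N₁ N₂ ξ η t) ∧
      IsLatticePeriodic N₁ N₂ (approxP N₁ N₂ ξ η t) := by
  constructor
  · have h3 := isLatticePeriodic_sample (N₁ := N₁) (N₂ := N₂) (g := fun y₁ y₂ =>
      mesh N₁ ^ 2 * (1 / Real.sqrt 2 * (ξ (mesh N₁ ^ 3 * t) (y₁ + -mesh N₁ * t) y₂ +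
        η (mesh N₁ ^ 3 * t) (y₁ + mesh N₁ * t) y₂)))
      (fun y₁ y₂ => by simp only [add_right_comm _ (2 : ℝ), hξ.periodic_fst, hη.periodic_fst])
      (fun y₁ y₂ => by simp only [hξ.periodic_snd, hη.periodic_snd])
    simp only [← approxQ_eq] at h3
    exact h3
  · have h1 := hξ.antideriv hr hξ0
    have h2 := hη.antideriv hr hη0
    have h3 := isLatticePeriodic_sample (N₁ := N₁) (N₂ := N₂) (g := fun y₁ y₂ =>
      mesh N₁ * (1 / Real.sqrt 2 * (antideriv (ξ (mesh N₁ ^ 3 * t)) (y₁ + -mesh N₁ * t) y₂ -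
        antideriv (η (mesh N₁ ^ 3 * t)) (y₁ + mesh N₁ * t) y₂)))
      (fun y₁ y₂ => by simp only [add_right_comm _ (2 : ℝ), h1.periodic_fst, h2.periodic_fst])
      (fun y₁ y₂ => by simp only [h1.periodic_snd, h2.periodic_snd])
    simp only [← approxP_eq] at h3
    exact h3

/-- The specific energies of a state close to a pair of travelling profiles. -/
theorem exists_specificEnergy_bound {r M D : ℝ} (hr : 0 < r) (hM : 0 ≤ M) (hD : 0 ≤ D) :
    ∃ C > 0, ∀ (N₁ N₂ : ℕ) (ξ η : ℝ → ℝ → ℝ → ℝ) (t : ℝ) (Q P : ℤ × ℤ → ℝ), mesh N₁ ≤ 1 → N₁ ≤ N₂ →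
      mesh N₂ ≤ 2 * mesh N₁ ^ 2 →
      1 ≤ (2 * (N₁ : ℝ) + 1) * (2 * (N₂ : ℝ) + 1) * mesh N₁ ^ 3 →
      Ana r M (ξ (mesh N₁ ^ 3 * t)) → Ana r M (η (mesh N₁ ^ 3 * t)) →
      ZeroMean (ξ (mesh N₁ ^ 3 * t)) → ZeroMean (η (mesh N₁ ^ 3 * t)) →
      IsLatticePeriodic N₁ N₂ P →
      ∑ j ∈ box N₁ N₂, (Q j - approxQ N₁ N₂ ξ η t j) ^ 2 ≤ D * mesh N₁ ^ 5 →
      ∑ j ∈ box N₁ N₂, gradMul (fun j => P j - approxP N₁ N₂ ξ η t j)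
        (fun j => P j - approxP N₁ N₂ ξ η t j) j ≤ D * mesh N₁ ^ 5 → ∀ k ∈ box N₁ N₂,
      |specificEnergy N₁ N₂ Q P (waveVector N₁ N₂ k) - mesh N₁ ^ 4 *
        ((‖fourierCoef (ξ (mesh N₁ ^ 3 * t)) k‖ ^ 2 +
          ‖fourierCoef (η (mesh N₁ ^ 3 * t)) k‖ ^ 2) / 2)| ≤ C * mesh N₁ ^ 6 := by
  obtain ⟨C, hC, hmode⟩ := exists_mode_bound hr hM
  refine ⟨4 * (C + (D + 1) * (2 * (2 * M ^ 2 + C + 1) + (D + 1))), by positivity, ?_⟩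
  intro N₁ N₂ ξ η t Q P hm1 hN hn hcard hξ hη hξ0 hη0 hP hq hp k hk
  have hm := mesh_pos N₁
  obtain ⟨hQa, hPa⟩ := hmode N₁ N₂ _ _ hm1 hN hn hξ hη hξ0 hη0 (-mesh N₁ * t) (mesh N₁ * t) k hk
  simp only [← approxQ_eq] at hQa
  simp only [← approxP_eq] at hPa
  have hPaper := (isLatticePeriodic_approx (N₁ := N₁) (N₂ := N₂) hr hξ hη hξ0 hη0).2
  set m := mesh N₁ with hm_def
  set F := ξ (m ^ 3 * t)
  set G := η (m ^ 3 * t)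
  set a := char1 k.1 (-m * t) * fc F k with ha
  set b := char1 k.1 (m * t) * fc G k with hb
  have hcard' : ∀ {x : ℝ}, 0 ≤ x →
      (2 * (N₁ : ℝ) + 1) * (2 * (N₂ : ℝ) + 1) * x ≤ D * m ^ 5 → x ≤ D * m ^ 8 := by
    intro x hx h
    have h1 := mul_le_mul_of_nonneg_right h (pow_pos hm 3).le
    have h2 := mul_le_mul_of_nonneg_right hcard hx
    linarith
  have hnorm : ‖a‖ ^ 2 = ‖fc F k‖ ^ 2 ∧ ‖b‖ ^ 2 = ‖fc G k‖ ^ 2 := by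
    rw [ha, hb, norm_mul, norm_mul, norm_char1, norm_char1, one_mul, one_mul]
    exact ⟨rfl, rfl⟩
  have hfour : ∀ f : ℝ → ℝ → ℝ, ‖fourierCoef f k‖ ^ 2 = 4 * ‖fc f k‖ ^ 2 := fun f => by
    unfold fc
    rw [norm_div, div_pow, Complex.norm_ofNat]
    ring
  have hle : ∀ {f : ℝ → ℝ → ℝ}, Ana r M f → ‖fc f k‖ ^ 2 ≤ M ^ 2 := fun hf =>
    pow_le_pow_left₀ (norm_nonneg _) ((hf.bound k).trans
      (mul_le_of_le_one_right hM (wt_le_one hr.le k))) 2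
  -- The cross terms of the two waves, which oscillate in time through the phases of a and b, cancel
  -- between potential and kinetic energy.
  have hpar : ‖a + b‖ ^ 2 + ‖a - b‖ ^ 2 = 2 * (‖fc F k‖ ^ 2 + ‖fc G k‖ ^ 2) := by
    have := parallelogram_law_with_norm ℝ a b
    rw [← hnorm.1, ← hnorm.2]
    nlinarith
  have hF2 := hle hξ
  have hG2 := hle hη
  have h1 := abs_norm_sq_sub_half_le (u := lcoef N₁ N₂ (fun j => (Q j : ℂ)) k) (M := M) hm hm1 hC.le
    hD (by nlinarith [sq_nonneg ‖a - b‖]) (hcard' (sq_nonneg _) (by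
      rw [← lcoef_sub]
      refine (card_mul_norm_lcoef_sq_le _ k).trans (le_trans (le_of_eq ?_) hq)
      refine Finset.sum_congr rfl fun j _ => ?_
      rw [← Complex.ofReal_sub, Complex.norm_real, Real.norm_eq_abs, sq_abs])) hQa
  have hsq : ∀ z : ℂ, freqSq N₁ N₂ k * ‖z‖ ^ 2 =
      ‖((Real.sqrt (freqSq N₁ N₂ k) : ℝ) : ℂ) * z‖ ^ 2 := fun z => by
    rw [norm_mul, mul_pow, Complex.norm_real, Real.norm_eq_abs, sq_abs,
      Real.sq_sqrt (freqSq_nonneg k)]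
  rw [hsq] at hPa
  have h2 := abs_norm_sq_sub_half_le
    (u := ((Real.sqrt (freqSq N₁ N₂ k) : ℝ) : ℂ) * lcoef N₁ N₂ (fun j => (P j : ℂ)) k)
    (M := M) hm hm1 hC.le hD (by nlinarith [sq_nonneg ‖a + b‖]) (hcard' (sq_nonneg _) (by
      rw [← mul_sub, ← hsq, ← lcoef_sub]
      refine le_trans (le_of_eq ?_)
        ((card_mul_freqSq_mul_norm_lcoef_sq_le (hP.sub hPaper) k).trans hp)
      simp only [Complex.ofReal_sub])) hPa
  rw [← hsq] at h2
  rw [specificEnergy_eq Q P hk, hfour, hfour]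
  have e : 2 * (freqSq N₁ N₂ k * ‖lcoef N₁ N₂ (fun j => (P j : ℂ)) k‖ ^ 2 +
      ‖lcoef N₁ N₂ (fun j => (Q j : ℂ)) k‖ ^ 2) -
      m ^ 4 * ((4 * ‖fc F k‖ ^ 2 + 4 * ‖fc G k‖ ^ 2) / 2) =
      2 * ((freqSq N₁ N₂ k * ‖lcoef N₁ N₂ (fun j => (P j : ℂ)) k‖ ^ 2 -
        m ^ 4 / 2 * ‖a - b‖ ^ 2) +
      (‖lcoef N₁ N₂ (fun j => (Q j : ℂ)) k‖ ^ 2 - m ^ 4 / 2 * ‖a + b‖ ^ 2)) := by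
    linear_combination m ^ 4 * hpar
  rw [e, abs_mul, abs_two]
  have h3 := abs_add_le (freqSq N₁ N₂ k * ‖lcoef N₁ N₂ (fun j => (P j : ℂ)) k‖ ^ 2 -
        m ^ 4 / 2 * ‖a - b‖ ^ 2)
      (‖lcoef N₁ N₂ (fun j => (Q j : ℂ)) k‖ ^ 2 - m ^ 4 / 2 * ‖a + b‖ ^ 2)
  linarith

end

/-! ### From the estimates to the statement: rounding, high modes, uniformity over solutions -/

theorem mesh_bounds_of_near_sq {N₁ N₂ : ℕ} (hm : mesh N₁ ≤ 1 / 2)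
    (h : |((N₂ : ℝ) + 1 / 2) - ((N₁ : ℝ) + 1 / 2) ^ 2| < 1) :
    |mesh N₂ - mesh N₁ ^ 2| ≤ 2 * mesh N₁ ^ 4 ∧ N₁ ≤ N₂ ∧ mesh N₂ ≤ 2 * mesh N₁ ^ 2 := by
  have e : ∀ N : ℕ, mesh N = 1 / ((N : ℝ) + 1 / 2) := fun N => by
    unfold mesh
    field_simp
  have hm0 := mesh_pos N₁
  have hx0 : 0 < (N₁ : ℝ) + 1 / 2 := by positivity
  have hy0 : 0 < (N₂ : ℝ) + 1 / 2 := by positivity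
  have hx2 : 2 ≤ (N₁ : ℝ) + 1 / 2 := by
    rw [e, div_le_iff₀ hx0] at hm
    linarith
  have h1 : |mesh N₂ - mesh N₁ ^ 2| ≤ 2 * mesh N₁ ^ 4 := by
    rw [e, e]
    set x := (N₁ : ℝ) + 1 / 2
    set y := (N₂ : ℝ) + 1 / 2
    -- With x ≥ 2 the rounding error is at most x²/2, so y is comparable to x² and 1/y - 1/x² is
    -- O(x⁻⁴).
    have hy : x ^ 2 / 2 ≤ y := by nlinarith [(abs_lt.1 h).1]
    rw [show 1 / y - (1 / x) ^ 2 = -((y - x ^ 2) / (y * x ^ 2)) by field_simp; ring, abs_neg, abs_div,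
      abs_of_pos (by positivity : 0 < y * x ^ 2), div_le_iff₀ (by positivity)]
    refine h.le.trans ?_
    rw [show 2 * (1 / x) ^ 4 * (y * x ^ 2) = 2 * y / x ^ 2 by field_simp, le_div_iff₀ (by positivity)]
    linarith
  refine ⟨h1, ?_, ?_⟩
  · have h2 : (N₁ : ℝ) ≤ N₂ := by nlinarith [(abs_lt.1 h).1]
    exact_mod_cast h2
  · have h3 := (abs_le.1 h1).2
    have h4 : mesh N₁ ^ 2 ≤ 1 / 4 := by nlinarith
    nlinarith [sq_nonneg (mesh N₁)]

/-- The weight of radius ρ/2 beyond the threshold is at most exp(-(1 + δ/2)|log m|) ≤ m; this is the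
origin of the 2 in the threshold. -/
theorem fourierCoef_sq_le_of_high {ρ n R δ m : ℝ} (hρ : 0 < ρ) (hn : 0 ≤ n) (hR : 0 ≤ R)
    (hδ : 0 ≤ δ) (hm : 0 < m) (hm1 : m ≤ 1) {f : ℝ → ℝ → ℝ} (h0 : ZeroMean f)
    (hs : Summable (normTerm ρ n f)) (hb : ∑' k, normTerm ρ n f k ≤ R ^ 2) {k : ℤ × ℤ}
    (hk : (2 + δ) * |Real.log m| / ρ < |(k.1 : ℝ)| + |(k.2 : ℝ)|) :
    ‖fourierCoef f k‖ ^ 2 ≤ R ^ 2 * m ^ 2 := by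
  have h1 := pow_le_pow_left₀ (norm_nonneg _) (norm_fourierCoef_le hρ hn h0 hs hb hR k) 2
  refine h1.trans ?_
  rw [mul_pow]
  refine mul_le_mul_of_nonneg_left ?_ (sq_nonneg R)
  have hlog := Real.log_nonpos hm.le hm1
  rw [div_lt_iff₀ hρ, abs_of_nonpos hlog] at hk
  have h2 : wt (ρ / 2) k ≤ m := by
    unfold wt
    rw [← Real.le_log_iff_exp_le hm]
    nlinarith
  exact pow_le_pow_left₀ (wt_pos _ _).le h2 2

theorem specificEnergy_eq_zero {N₁ N₂ : ℕ} (Q P : ℤ × ℤ → ℝ) {κ : ℝ × ℝ}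
    (h : ∀ k ∈ box N₁ N₂, κ ≠ waveVector N₁ N₂ k) : specificEnergy N₁ N₂ Q P κ = 0 := by
  unfold specificEnergy
  refine Finset.sum_eq_zero fun k hk => ?_
  rw [Finset.mem_filter] at hk
  exact absurd hk.2.symm (h k hk.1)

/-- The pairs of profiles that solve the KP equations and are bounded in the analytic norm. -/
def BoundedKP (α ρ n T R : ℝ) : Type :=
  {p : (ℝ → ℝ → ℝ → ℝ) × (ℝ → ℝ → ℝ → ℝ) // IsKPSolution α T p.1 p.2 ∧
    ∀ s ∈ Icc (-T) T, MemH ρ n (p.1 s) (p.2 s) ∧ normH ρ n (p.1 s) (p.2 s) ≤ R}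

section

variable {α ρ n T R : ℝ}

theorem BoundedKP.ana (hρ : 0 < ρ) (hn : 0 ≤ n) (hR : 0 ≤ R) (i : BoundedKP α ρ n T R) {s : ℝ}
    (hs : s ∈ Icc (-T) T) : Ana (ρ / 2) R (i.1.1 s) ∧ Ana (ρ / 2) R (i.1.2 s) := by
  obtain ⟨h1, h2⟩ := i.2.2 s hs
  have h3 := tsum_normTerm_le hR h2
  exact ⟨(i.2.1.regular_fst s hs).ana hρ hn h1.1 h3.1 hR,
    (i.2.1.regular_snd s hs).ana hρ hn h1.2 h3.2 hR⟩

theorem BoundedKP.zeroMean (i : BoundedKP α ρ n T R) {s : ℝ} (hs : s ∈ Icc (-T) T) :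
    ZeroMean (i.1.1 s) ∧ ZeroMean (i.1.2 s) :=
  ⟨(i.2.1.regular_fst s hs).zeroMean, (i.2.1.regular_snd s hs).zeroMean⟩

theorem BoundedKP.family_fst (hρ : 0 < ρ) (hn : 0 ≤ n) (hR : 0 ≤ R) (hT : 0 < T) :
    KPFamily α T 1 fun i : BoundedKP α ρ n T R => i.1.1 where
  pos := hT
  ana := ⟨ρ / 2, R, half_pos hρ, fun p => (p.1.ana hρ hn hR p.2.2).1⟩
  zeroMean i _ hs := (i.zeroMean hs).1
  deriv i s hs y₁ y₂ := by
    rw [one_mul]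
    exact i.2.1.eq_fst s hs y₁ y₂

theorem BoundedKP.family_snd (hρ : 0 < ρ) (hn : 0 ≤ n) (hR : 0 ≤ R) (hT : 0 < T) :
    KPFamily α T (-1) fun i : BoundedKP α ρ n T R => i.1.2 where
  pos := hT
  ana := ⟨ρ / 2, R, half_pos hρ, fun p => (p.1.ana hρ hn hR p.2.2).2⟩
  zeroMean i _ hs := (i.zeroMean hs).2
  deriv i s hs y₁ y₂ := by
    rw [neg_one_mul]
    exact i.2.1.eq_snd s hs y₁ y₂

end

end ETL

end

open ETL

theorem proposition5p3 (α β γ δ ρ n T₀ R : ℝ) (hγ : 0 < γ) (hγ' : γ < 1 / 2) (hδ : 0 < δ)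
    (hρ : 0 < ρ) (hn : 1 ≤ n) (hT₀ : 0 < T₀) (hR : 0 < R) :
    ∃ μ₀ : ℝ, 0 < μ₀ ∧ ∃ C : ℝ, 0 < C ∧
      ∀ N₁ N₂ : ℕ, ETL.mesh N₁ < μ₀ →
        -- `σ = 2` up to the rounding of `N₂`, as `N₂ + 1/2 = (N₁ + 1/2)²` has no integer solution
        |((N₂ : ℝ) + 1 / 2) - ((N₁ : ℝ) + 1 / 2) ^ 2| < 1 →
      ∀ ξ η : ℝ → ℝ → ℝ → ℝ, ETL.IsKPSolution α T₀ ξ η →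
        (∀ s ∈ Set.Icc (-T₀) T₀, ETL.MemH ρ n (ξ s) (η s) ∧ ETL.normH ρ n (ξ s) (η s) ≤ R) →
      (∃ Q P : ℝ → ℤ × ℤ → ℝ,
        ETL.IsCorrespondingSolution N₁ N₂ α β (T₀ / ETL.mesh N₁ ^ 3) ξ η Q P) ∧
      ∀ Q P : ℝ → ℤ × ℤ → ℝ,
        ETL.IsCorrespondingSolution N₁ N₂ α β (T₀ / ETL.mesh N₁ ^ 3) ξ η Q P →
        ∀ t : ℝ, |t| ≤ T₀ / ETL.mesh N₁ ^ 3 →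
          -- closeness on the lattice
          (∀ j ∈ ETL.box N₁ N₂,
            |Q t j - ETL.approxQ N₁ N₂ ξ η t j| + |P t j - ETL.approxP N₁ N₂ ξ η t j|
              ≤ C * ETL.mesh N₁ ^ γ) ∧
          -- low modes
          (∀ k ∈ ETL.box N₁ N₂,
            |(k.1 : ℝ)| + |(k.2 : ℝ)| ≤ (2 + δ) * |Real.log (ETL.mesh N₁)| / ρ →
            |ETL.specificEnergy N₁ N₂ (Q t) (P t) (ETL.waveVector N₁ N₂ k) -
                ETL.mesh N₁ ^ 4 *
                  ((‖ETL.fourierCoef (ξ (ETL.mesh N₁ ^ 3 * t)) k‖ ^ 2 +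
                    ‖ETL.fourierCoef (η (ETL.mesh N₁ ^ 3 * t)) k‖ ^ 2) / 2)|
              ≤ C * ETL.mesh N₁ ^ (4 + γ)) ∧
          -- high modes
          (∀ k ∈ ETL.box N₁ N₂,
            (2 + δ) * |Real.log (ETL.mesh N₁)| / ρ < |(k.1 : ℝ)| + |(k.2 : ℝ)| →
            |ETL.specificEnergy N₁ N₂ (Q t) (P t) (ETL.waveVector N₁ N₂ k)|
              ≤ ETL.mesh N₁ ^ (4 + γ)) ∧
          -- no energy at any other specific wave vector
          (∀ κ : ℝ × ℝ, (∀ k ∈ ETL.box N₁ N₂, κ ≠ ETL.waveVector N₁ N₂ k) →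
            ETL.specificEnergy N₁ N₂ (Q t) (P t) κ = 0) := by
  have hn0 : 0 ≤ n := by linarith
  -- The family is indexed by all bounded solutions at once, so the constants obtained here do not
  -- depend on the solution.
  obtain ⟨K, J, J', hx⟩ := (BoundedKP.family_fst (α := α) hρ hn0 hR.le hT₀).exists_wave
  obtain ⟨L, H, H', hy⟩ := (BoundedKP.family_snd (α := α) hρ hn0 hR.le hT₀).exists_wave
  obtain ⟨C, hC, happ⟩ := hx.exists_approxSol hy (fun _ _ => rfl) (fun _ _ => rfl) β
  obtain ⟨μ₁, hμ₁, D, hD, hshadow⟩ := exists_shadowing α β T₀ hC hT₀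
  obtain ⟨B, hB, henergy⟩ := exists_specificEnergy_bound (half_pos hρ) hR.le hD.le
  -- The bound 1/(B + R²) absorbs the constant of the high modes: (B + R²)m⁶ ≤ m⁵ ≤ m^(4+γ), so that
  -- part needs no constant.
  refine ⟨min (1 / 2) (min μ₁ (1 / (B + R ^ 2))), by positivity, B + 2 * D + 1, by positivity, ?_⟩
  intro N₁ N₂ hμ hrnd ξ η hkp hbd
  have hm0 := mesh_pos N₁
  have hm12 : mesh N₁ ≤ 1 / 2 := (hμ.trans_le (min_le_left _ _)).le
  have hm1 : mesh N₁ ≤ 1 := by linarith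
  have hmμ : mesh N₁ < μ₁ := hμ.trans_le ((min_le_right _ _).trans (min_le_left _ _))
  have hmB : mesh N₁ ≤ 1 / (B + R ^ 2) :=
    (hμ.trans_le ((min_le_right _ _).trans (min_le_right _ _))).le
  rw [le_div_iff₀ (by positivity)] at hmB
  obtain ⟨hmesh, hNN, hmesh2⟩ := mesh_bounds_of_near_sq hm12 hrnd
  obtain ⟨_, hcard, _⟩ := mesh_box_bounds hm12 hmesh
  let i : BoundedKP α ρ n T₀ R := ⟨(ξ, η), hkp, hbd⟩
  have hana : ∀ {s : ℝ}, s ∈ Icc (-T₀) T₀ → Ana (ρ / 2) R (ξ s) ∧ Ana (ρ / 2) R (η s) :=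
    fun hs => i.ana hρ hn0 hR.le hs
  have hzero : ∀ {s : ℝ}, s ∈ Icc (-T₀) T₀ → ZeroMean (ξ s) ∧ ZeroMean (η s) :=
    fun hs => i.zeroMean hs
  obtain ⟨Qt, Pt, dQ, dP, hsol⟩ := happ i N₁ N₂ hm1 hmesh
  have h0 : mesh N₁ ^ 3 * 0 ∈ Icc (-T₀) T₀ := by
    rw [mul_zero]
    constructor <;> linarith
  obtain ⟨hQper, hPper⟩ := isLatticePeriodic_approx (half_pos hρ) (N₂ := N₂) (t := 0) (hana h0).1
    (hana h0).2 (hzero h0).1 (hzero h0).2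
  obtain ⟨⟨Q₁, P₁, hs₁, hQ₁, hP₁⟩, hall⟩ :=
    hshadow N₁ N₂ _ _ Qt Pt dQ dP hmμ hmesh hQper hPper hsol
  refine ⟨⟨Q₁, P₁, hs₁, fun j => ⟨congrFun hQ₁ j, congrFun hP₁ j⟩⟩, ?_⟩
  intro Q P hQP t ht
  have htI := abs_le.1 ht
  obtain ⟨hq, hp, hpsup⟩ := hall Q P hQP.1 (funext fun j => (hQP.2 j).1)
    (funext fun j => (hQP.2 j).2) t htI
  have hsI : mesh N₁ ^ 3 * t ∈ Icc (-T₀) T₀ := by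
    rw [mem_Icc, ← abs_le, abs_mul, abs_of_pos (pow_pos hm0 3), mul_comm]
    rwa [le_div_iff₀ (pow_pos hm0 3)] at ht
  have hen := henergy N₁ N₂ ξ η t (Q t) (P t) hm1 hNN hmesh2 hcard (hana hsI).1 (hana hsI).2
    (hzero hsI).1 (hzero hsI).2 (hQP.1.periodic_P t htI) hq hp
  have hγ1 : mesh N₁ ≤ mesh N₁ ^ γ := by
    have := Real.rpow_le_rpow_of_exponent_ge hm0 hm1 (show γ ≤ 1 by linarith)
    rwa [Real.rpow_one] at this
  have hγ5 : mesh N₁ ^ 5 ≤ mesh N₁ ^ (4 + γ) := by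
    have := Real.rpow_le_rpow_of_exponent_ge hm0 hm1 (show 4 + γ ≤ 5 by linarith)
    rwa [show (5 : ℝ) = ((5 : ℕ) : ℝ) by norm_num, Real.rpow_natCast] at this
  have hγ6 : mesh N₁ ^ 6 ≤ mesh N₁ ^ 5 := pow_le_pow_of_le_one hm0.le hm1 (by norm_num)
  refine ⟨fun j hj => ?_, fun k hk _ => ?_, fun k hk hhigh => ?_, fun κ hκ =>
    specificEnergy_eq_zero _ _ hκ⟩
  -- One term of the sum of squares is at most D m⁵, which is weaker than needed: D m⁵ ≤ (D + 1)²
  -- m².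
  · have h1 : |Q t j - approxQ N₁ N₂ ξ η t j| ≤ (D + 1) * mesh N₁ := by
      refine abs_le_of_sq_le_sq (((Finset.single_le_sum (f := fun j =>
        (Q t j - approxQ N₁ N₂ ξ η t j) ^ 2) (fun _ _ => sq_nonneg _) hj).trans hq).trans ?_)
        (by positivity)
      have h2 : mesh N₁ ^ 5 ≤ mesh N₁ ^ 2 := pow_le_pow_of_le_one hm0.le hm1 (by norm_num)
      have h3 := mul_le_mul_of_nonneg_left h2 hD.le
      have h4 : 0 ≤ (D ^ 2 + D + 1) * mesh N₁ ^ 2 := by positivity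
      linarith
    have h2 := hpsup j hj
    have h3 := mul_le_mul_of_nonneg_left hγ1 (show 0 ≤ 2 * D + 1 by positivity)
    have h4 : 0 ≤ B * mesh N₁ ^ γ := by positivity
    linarith
  · refine (hen k hk).trans (mul_le_mul (by linarith) (hγ6.trans hγ5) (by positivity)
      (by positivity))
  · obtain ⟨hmem, hnorm⟩ := hbd _ hsI
    have htsum := tsum_normTerm_le hR.le hnorm
    have h1 := fourierCoef_sq_le_of_high hρ hn0 hR.le hδ.le hm0 hm1 (hzero hsI).1 hmem.1 htsum.1 hhigh
    have h2 := fourierCoef_sq_le_of_high hρ hn0 hR.le hδ.le hm0 hm1 (hzero hsI).2 hmem.2 htsum.2 hhigh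
    set f := ‖fourierCoef (ξ (mesh N₁ ^ 3 * t)) k‖ ^ 2
    set g := ‖fourierCoef (η (mesh N₁ ^ 3 * t)) k‖ ^ 2
    have hf : 0 ≤ f := sq_nonneg _
    have hg : 0 ≤ g := sq_nonneg _
    have h3 := abs_sub_abs_le_abs_sub
      (specificEnergy N₁ N₂ (Q t) (P t) (waveVector N₁ N₂ k)) (mesh N₁ ^ 4 * ((f + g) / 2))
    have h4 : |mesh N₁ ^ 4 * ((f + g) / 2)| ≤ R ^ 2 * mesh N₁ ^ 6 := by
      rw [abs_of_nonneg (by positivity)]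
      have := mul_le_mul_of_nonneg_left (show (f + g) / 2 ≤ R ^ 2 * mesh N₁ ^ 2 by linarith)
        (pow_pos hm0 4).le
      linarith
    have h5 := mul_le_mul_of_nonneg_right hmB (pow_pos hm0 5).le
    have h6 := hen k hk
    linarith
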